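/- **Setting.** Let $q_1,q_2,q_3,r_1,r_2,\bar x,\bar y,\bar v,\bar\omega>0$, let $\delta=1/m$ with an integer $m\ge 1$, and consider the exactly discretised unicycle $$f(\mathbf x,\mathbf u)=\Big(x+\tfrac v\omega(\sin(\theta+\delta\omega)-\sin\theta),\ y+\tfrac v\omega(\cos\theta-\cos(\theta+\delta\omega)),\ \theta+\delta\omega\Big)\quad(\omega\ne0),$$ $f(\mathbf x,\mathbf u)=(x+\delta v\cos\theta,\ y+\delta v\sin\theta,\ \theta)$ for $\omega=0$, where $\mathbf x=(x,y,\theta)$, $\mathbf u=(v,\omega)$. The constraints are $\mathbf x\in X_\Theta=[-\bar x,\bar x]\times[-\bar y,\bar y]\times\Theta$ with a set $\Theta\subseteq\mathbb R$ of orientations, and $\mathbf u\in U=[-\bar v,\bar v]\times[-\bar\omega,\bar\omega]$. $\mathcal U^N(\mathbf x_0)$ is the set of control sequences of length $N$ in $U$ whose trajectory $\mathbf x_{\mathbf u}(k;\mathbf x_0)$, $0\le k\le N$, stays in $X_\Theta$ ($\mathcal U^\infty$: all truncations are admissible). Let $\ell(\mathbf x,\mathbf u)=q_1x^4+q_2y^2+q_3\theta^4+r_1v^4+r_2\omega^4$,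 $\ell^*(\mathbf x)=\min_{\mathbf u\in\mathcal U^1(\mathbf x)}\ell(\mathbf x,\mathbf u)$, $V_N(\mathbf x_0)=\inf_{\mathbf u\in\mathcal U^N(\mathbf x_0)}\sum_{k<N}\ell(\mathbf x_{\mathbf u}(k;\mathbf x_0),\mathbf u(k))$ (all depending on $\Theta$). An MPC feedback $\mu_N$ assigns to each $\mathbf x\in X_\Theta$ the first element of a minimising sequence in $\mathcal U^N(\mathbf x)$. Assume $r_2\le q_3\delta/2$ and $r_1\le q_1\delta/2$. **Partition.** Fix $s>0$ and put $\mathcal N_1=\{\mathbf x\in X_\Theta: q_1x^4+q_2y^2<s\}$, $\mathcal N_2=X_\Theta\setminus\mathcal N_1$. Assume that $s$ is small enough for the curved maneuver on $\mathcal N_1$ to respect the constraints: for all $y\in[0,\bar y]$ with $q_2y^2<s$, writing $a=\arctan\sqrt y$ and $v=ya/(4-4/\sqrt{y+1})$, one has $a\le\bar\omega$, $v\le\bar v$, $2v\sin(a)/a\le\bar x$ (for $y=0$, read $v=0$ and $\sin(a)\,v/a=0$). **Coefficients on $\mathcal N_2$.** Let $k=\lceil\frac{\pi/2}{\min\{\bar\omega,\pi/2\}\delta}\rceil$,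 $l=\lceil\frac{\sqrt{\bar x^2+\bar y^2}}{\bar v\delta}\rceil$, $t_i=(l-i)/l$, and $c_n=1$ for $0\le n<k$; $c_{k+i}=1+\frac{q_3\pi^4}{16k^4s}(i^4+\frac1{2\delta^3})$ for $0\le i<k$; $c_{2k+i}=d_i$ for $0\le i<l$; $c_{2k+l+i}=\frac{q_3\pi^4}{16k^4s}((k-i)^4+\frac1{2\delta^3})$ for $0\le i<k$; $c_n=0$ for $n\ge L:=3k+l$. Let $c^{\mathrm{fr}}$ be this sequence with $d_i=d_i^{\mathrm{fr}}:=t_i^2+\frac{q_3(\pi/2)^4+r_1\bar v^4}{s}$, and $c^{\mathcal N_2}$ the one with $$d_i=\max\Big\{d^{\mathrm{fr}}_i,\ t_i^2+(1-t_i^2)\tfrac{q_3\pi^4}{s+q_3\pi^4}+\tfrac{r_1\bar v^4}{s}\Big\}$$ (the two coincide if $15s\le q_3\pi^4$). **Coefficients on $\mathcal N_1$.** Let $k=\lceil\frac{\pi}{\min\{\bar\omega,\pi\}\delta}\rceil$, $l=\lceil\frac{\sqrt[4]{s/q_1}}{\min\{\bar v,\sqrt[4]{s/q_1}\}\delta}\rceil$,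 $K=(\sqrt{s/q_2}+\frac32)^4/64$, and $c^{\mathcal N_1}_n=1$ for $n<k+l$, $n\ne k$; $c^{\mathcal N_1}_k=1+\frac1{2l(l\delta)^3}$; for $j\in\{0,1,2,3\}$, $c^{\mathcal N_1}_{k+l+jm}=p_j$ and $c^{\mathcal N_1}_{k+l+jm+i}=p_j+e_j$ for $1\le i<m$; $c^{\mathcal N_1}_n=0$ for $n\ge L:=k+l+4m$. Here $p_0=1+\frac{Kr_1+r_2}{q_2}$, $p_1=\frac9{16}+\frac{q_3+r_2+(q_1+r_1)K}{q_2}$, $p_2=\frac14+\frac{r_2+(16q_1+r_1)K}{q_2}$, $p_3=\frac1{16}+\frac{q_3+r_2+(q_1+r_1)K}{q_2}$, $e_0=\frac{q_1K+q_3}{q_2}$, $e_1=\frac{15q_1K}{q_2}$, $e_2=\frac{q_3}{q_2}$, $e_3=0$. For each of the three sequences let $\bar c_0=c_0$, let $\bar c_1\ge\dots\ge\bar c_{L-1}$ be $c_1,\dots,c_{L-1}$ in descending order, $\bar c_n=0$ for $n\ge L$, and put $\sum_{n<i}\bar c_n=:\gamma_i^{\mathrm{fr}},\gamma_i^{\mathcal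 N_2},\gamma_i^{\mathcal N_1}$, respectively. Let $\gamma_i=\min\{i,\max\{\gamma_i^{\mathcal N_1},\gamma_i^{\mathcal N_2}\}\}$ and $$\alpha_N=1-\frac{(\gamma_N-1)\prod_{k=2}^N(\gamma_k-1)}{\prod_{k=2}^N\gamma_k-\prod_{k=2}^N(\gamma_k-1)}.$$ **Claim.** 1. $(\gamma_i)_{i\in\mathbb N_0}$ is monotonically increasing and bounded. 2. For every $\Theta\subseteq\mathbb R$ with $[-\pi,\pi]\subseteq\Theta$ (in particular $\Theta=\mathbb R$ and $\Theta=[-\pi,\pi]$): (a) there are $\mathcal K_\infty$-functions with $\underline\eta(\|\mathbf x\|)\le\ell^*(\mathbf x)\le\bar\eta(\|\mathbf x\|)$ on $X_\Theta$; (b) every $\mathbf x_0=(x_0,y_0,0)\in\mathcal N_1$ (resp. $\mathcal N_2$) has some $\mathbf u\in\mathcal U^\infty(\mathbf x_0)$ with $\ell(\mathbf x_{\mathbf u}(n;\mathbf x_0),\mathbf u(n))\le c_n\,\ell^*(\mathbf x_0)$ for all $n\ge0$, where $c=c^{\mathcal N_1}$ (resp. $c=c^{\mathrm{fr}}$); (c)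 for all $i\ge1$ and all $\mathbf x_0\in X_\Theta$ with $|\theta_0|\le\pi$: $V_i(\mathbf x_0)\le\gamma_i\,\ell^*(\mathbf x_0)$; moreover $V_i(\mathbf x_0)\le\gamma_i^{\mathcal N_j}\ell^*(\mathbf x_0)$ if $\mathbf x_0\in\mathcal N_j$, $j=1,2$, and $V_i(\mathbf x_0)\le\gamma_i^{\mathrm{fr}}\ell^*(\mathbf x_0)$ if $\mathbf x_0\in\mathcal N_2$ and either $x_0y_0\theta_0\ge0$ or $|\theta_0|+\arctan(|y_0|/|x_0|)\le\pi$; (d) if $\Theta$ is closed, an MPC feedback exists for every horizon $N\ge1$. 3. Let $N\ge2$ with $\alpha_N>0$. For $\Theta=[-\pi,\pi]$ and every MPC feedback $\mu_N$, the relaxed Lyapunov inequality $V_N(f(\mathbf x,\mu_N(\mathbf x)))\le V_N(\mathbf x)-\alpha_N\ell(\mathbf x,\mu_N(\mathbf x))$ holds on $S=X_\Theta$, and the MPC closed loop (without terminal constraints or costs) is asymptotically stable on $S$: from $S$ it stays in $S$, satisfies the control constraints, and $\|\mathbf x_{\mu_N}(n;\mathbf x_0)\|\le\beta(\|\mathbf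 x_0\|,n)$ for all $\mathbf x_0\in S$, $n\ge0$, with one $\mathcal{KL}$-function $\beta$. For $\Theta=\mathbb R$ the same holds with $S=\{\mathbf x\in X_{\mathbb R}: V_N(\mathbf x)\le q_3\pi^4\}$. -/

import Mathlib

open Set Filter Topology
open scoped NNReal ENNReal

noncomputable section

namespace UnicycleMPC

/-! ### Problem data, dynamics and constraints -/

/-- States `(x, y, θ)` with the Euclidean norm. -/
abbrev State := EuclideanSpace ℝ (Fin 3)

/-- Controls `(v, ω)`. -/
abbrev Input := ℝ × ℝ

/-- Weights `q₁, q₂, q₃, r₁, r₂`, bounds `x̄, ȳ, v̄, ω̄`, and the number `m` of sampling instants per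
second; the sampling period is `δ = 1 / m`. -/
structure Params where
  q1 : ℝ
  q2 : ℝ
  q3 : ℝ
  r1 : ℝ
  r2 : ℝ
  xbar : ℝ
  ybar : ℝ
  vbar : ℝ
  wbar : ℝ
  m : ℕ
  q1_pos : 0 < q1
  q2_pos : 0 < q2
  q3_pos : 0 < q3
  r1_pos : 0 < r1
  r2_pos : 0 < r2
  xbar_pos : 0 < xbar
  ybar_pos : 0 < ybar
  vbar_pos : 0 < vbar
  wbar_pos : 0 < wbar
  m_pos : 0 < m

/-- The sampling period. -/
def Params.δ (p : Params) : ℝ := 1 / (p.m : ℝ)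

/-- The exact discrete-time unicycle model with piecewise constant controls. -/
def step (p : Params) (z : State) (u : Input) : State :=
  if u.2 = 0 then
    !₂[z 0 + p.δ * u.1 * Real.cos (z 2), z 1 + p.δ * u.1 * Real.sin (z 2), z 2]
  else
    !₂[z 0 + u.1 / u.2 * (Real.sin (z 2 + p.δ * u.2) - Real.sin (z 2)),
       z 1 + u.1 / u.2 * (Real.cos (z 2) - Real.cos (z 2 + p.δ * u.2)),
       z 2 + p.δ * u.2]

/-- The open-loop trajectory `x_u(·; x₀)`. -/
def traj (p : Params) (u : ℕ → Input) (z : State) : ℕ → State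
  | 0 => z
  | n + 1 => step p (traj p u z n) (u n)

/-- The state constraint set `X = [-x̄, x̄] × [-ȳ, ȳ] × Θ`, for a set `Θ` of orientations. -/
def stateSet (p : Params) (Θ : Set ℝ) : Set State :=
  {z | |z 0| ≤ p.xbar ∧ |z 1| ≤ p.ybar ∧ z 2 ∈ Θ}

/-- The control constraint set `U = [-v̄, v̄] × [-ω̄, ω̄]`. -/
def inputSet (p : Params) : Set Input :=
  {u | |u.1| ≤ p.vbar ∧ |u.2| ≤ p.wbar}

/-- `u ∈ 𝒰^N(z)`. Only `u 0, …, u (N - 1)` matter. -/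
def Admissible (p : Params) (Θ : Set ℝ) (N : ℕ) (z : State) (u : ℕ → Input) : Prop :=
  (∀ k < N, u k ∈ inputSet p) ∧ ∀ k ≤ N, traj p u z k ∈ stateSet p Θ

/-- `u ∈ 𝒰^∞(z)`. -/
def AdmissibleInf (p : Params) (Θ : Set ℝ) (z : State) (u : ℕ → Input) : Prop :=
  ∀ N : ℕ, 1 ≤ N → Admissible p Θ N z u

/-! ### Costs, value function, MPC feedback -/

/-- The stage cost `ℓ(x, u) = q₁ x⁴ + q₂ y² + q₃ θ⁴ + r₁ v⁴ + r₂ ω⁴`. -/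
def stageCost (p : Params) (z : State) (u : Input) : ℝ :=
  p.q1 * z 0 ^ 4 + p.q2 * z 1 ^ 2 + p.q3 * z 2 ^ 4 + p.r1 * u.1 ^ 4 + p.r2 * u.2 ^ 4

/-- `ℓ*(z) = min { ℓ(z, u) : u ∈ 𝒰¹(z) }`. -/
def minStageCost (p : Params) (Θ : Set ℝ) (z : State) : ℝ :=
  sInf {c : ℝ | ∃ u : ℕ → Input, Admissible p Θ 1 z u ∧ c = stageCost p z (u 0)}

/-- The finite horizon cost `J_N(z, u)`. -/
def cost (p : Params) (N : ℕ) (z : State) (u : ℕ → Input) : ℝ :=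
  ∑ k ∈ Finset.range N, stageCost p (traj p u z k) (u k)

/-- The value function `V_N(z) = inf { J_N(z, u) : u ∈ 𝒰^N(z) }`, equal to `∞` if `𝒰^N(z) = ∅`. -/
def value (p : Params) (Θ : Set ℝ) (N : ℕ) (z : State) : ℝ≥0∞ :=
  ⨅ (u : ℕ → Input) (_ : Admissible p Θ N z u), ENNReal.ofReal (cost p N z u)

/-- `μ` is an MPC feedback law with horizon `N`: on the state constraint set, `μ z` is the first
element of a minimizing admissible control sequence of length `N`. -/
def IsMPCFeedback (p : Params) (Θ : Set ℝ) (N : ℕ) (μ : State → Input) : Prop :=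
  ∀ z ∈ stateSet p Θ, ∃ u : ℕ → Input,
    Admissible p Θ N z u ∧ ENNReal.ofReal (cost p N z u) = value p Θ N z ∧ μ z = u 0

/-- The closed-loop trajectory `x_μ(·; z)`. -/
def closedLoop (p : Params) (μ : State → Input) (z : State) : ℕ → State
  | 0 => z
  | n + 1 => step p (closedLoop p μ z n) (μ (closedLoop p μ z n))

/-! ### Comparison functions and asymptotic stability -/

/-- Class `𝒦_∞`. -/
def IsClassKInf (η : ℝ≥0 → ℝ≥0) : Prop :=
  Continuous η ∧ StrictMono η ∧ η 0 = 0 ∧ Tendsto η atTop atTop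

/-- Class `𝒦ℒ` (discrete time). -/
def IsClassKL (β : ℝ≥0 → ℕ → ℝ≥0) : Prop :=
  (∀ n, IsClassKInf (fun r => β r n)) ∧
    ∀ r, 0 < r → StrictAnti (β r) ∧ Tendsto (β r) atTop (𝓝 0)

/-- The closed loop of `μ` is asymptotically stable (with respect to the origin) on the set `S`:
from every initial state in `S` the closed loop remains in `S`, respects the control constraints,
and satisfies one common `𝒦ℒ` estimate. -/
def AsymptoticallyStableOn (p : Params) (μ : State → Input) (S : Set State) : Prop :=
  ∃ β : ℝ≥0 → ℕ → ℝ≥0, IsClassKL β ∧ ∀ z ∈ S, ∀ n : ℕ,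
    closedLoop p μ z n ∈ S ∧ μ (closedLoop p μ z n) ∈ inputSet p ∧
      ‖closedLoop p μ z n‖₊ ≤ β ‖z‖₊ n

/-- The relaxed Lyapunov inequality `V_N(f(z, μ(z))) ≤ V_N(z) - α ℓ(z, μ(z))` on `S`. -/
def RelaxedLyapunovOn (p : Params) (Θ : Set ℝ) (N : ℕ) (α : ℝ) (μ : State → Input)
    (S : Set State) : Prop :=
  ∀ z ∈ S, value p Θ N (step p z (μ z)) + ENNReal.ofReal (α * stageCost p z (μ z))
    ≤ value p Θ N z

/-- The performance index `α_N` of a sequence `g` of growth bounds. -/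
def perfIndex (g : ℕ → ℝ) (N : ℕ) : ℝ :=
  1 - (g N - 1) * (∏ k ∈ Finset.Icc 2 N, (g k - 1)) /
    ((∏ k ∈ Finset.Icc 2 N, g k) - ∏ k ∈ Finset.Icc 2 N, (g k - 1))

/-! ### The partition of the state set -/

/-- States near the origin: `q₁ x⁴ + q₂ y² < s`. -/
def nearSet (p : Params) (Θ : Set ℝ) (s : ℝ) : Set State :=
  {z | z ∈ stateSet p Θ ∧ p.q1 * z 0 ^ 4 + p.q2 * z 1 ^ 2 < s}

/-- The remaining states. -/
def farSet (p : Params) (Θ : Set ℝ) (s : ℝ) : Set State :=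
  stateSet p Θ \ nearSet p Θ s

/-! ### Rearrangement and accumulation of coefficients -/

/-- For coefficients `c 0, …, c (L - 1)`: keep `c 0` in front, sort `c 1, …, c (L - 1)` in descending
order, and continue by zero. -/
def rearranged (c : ℕ → ℝ) (L : ℕ) : ℕ → ℝ
  | 0 => c 0
  | n + 1 => (((List.range (L - 1)).map (fun j => c (j + 1))).insertionSort (· ≥ ·)).getD n 0

/-- The accumulated bounds `γ_i = ∑_{n < i} c̄_n` of the rearranged coefficients. -/
def accumulated (c : ℕ → ℝ) (L : ℕ) (i : ℕ) : ℝ :=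
  ∑ n ∈ Finset.range i, rearranged c L n

/-! ### Coefficients away from the origin -/

/-- Number of steps for a turn by 90 degrees. -/
def turnFar (p : Params) : ℕ := ⌈(Real.pi / 2) / (min p.wbar (Real.pi / 2) * p.δ)⌉₊

/-- Number of steps to drive from a corner of the box to its centre. -/
def driveFar (p : Params) : ℕ := ⌈√(p.ybar ^ 2 + p.xbar ^ 2) / (p.vbar * p.δ)⌉₊

/-- Length of the manoeuvre. -/
def lengthFar (p : Params) : ℕ := 3 * turnFar p + driveFar p

/-- Coefficients of the manoeuvre: wait, turn, drive (with given coefficients), turn. -/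
def coeffFarWith (drive : ℕ → ℝ) (p : Params) (s : ℝ) (n : ℕ) : ℝ :=
  let k := turnFar p
  let l := driveFar p
  if n < k then 1
  else if n < 2 * k then
    1 + p.q3 * Real.pi ^ 4 / (16 * (k : ℝ) ^ 4 * s) *
      (((n - k : ℕ) : ℝ) ^ 4 + 1 / (2 * p.δ ^ 3))
  else if n < 2 * k + l then drive (n - 2 * k)
  else if n < 3 * k + l then
    p.q3 * Real.pi ^ 4 / (16 * (k : ℝ) ^ 4 * s) *
      (((k : ℝ) - ((n - (2 * k + l) : ℕ) : ℝ)) ^ 4 + 1 / (2 * p.δ ^ 3))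
  else 0

/-- The fraction `(l - i) / l` of the distance that is left after `i` driving steps. -/
def remaining (p : Params) (i : ℕ) : ℝ := ((driveFar p : ℝ) - (i : ℝ)) / (driveFar p : ℝ)

/-- Driving coefficients when the heading during the drive lies in `[-π/2, π/2]`. -/
def driveCoeffFront (p : Params) (s : ℝ) (i : ℕ) : ℝ :=
  remaining p i ^ 2 + (p.q3 * (Real.pi / 2) ^ 4 + p.r1 * p.vbar ^ 4) / s

/-- Driving coefficients covering also headings of modulus up to `min |θ₀| π` during the drive. -/
def driveCoeff (p : Params) (s : ℝ) (i : ℕ) : ℝ :=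
  max (driveCoeffFront p s i)
    (remaining p i ^ 2
      + (1 - remaining p i ^ 2) * (p.q3 * Real.pi ^ 4 / (s + p.q3 * Real.pi ^ 4))
      + p.r1 * p.vbar ^ 4 / s)

/-- Coefficients for initial states with orientation zero. -/
def coeffFarFront (p : Params) (s : ℝ) : ℕ → ℝ := coeffFarWith (driveCoeffFront p s) p s

/-- Coefficients for arbitrary orientation. -/
def coeffFar (p : Params) (s : ℝ) : ℕ → ℝ := coeffFarWith (driveCoeff p s) p s

/-- The growth bounds from the coefficients `coeffFarFront`. -/
def growthFarFront (p : Params) (s : ℝ) : ℕ → ℝ := accumulated (coeffFarFront p s) (lengthFar p)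

/-- The growth bounds `γ_i^{𝒩₂}`. -/
def growthFar (p : Params) (s : ℝ) : ℕ → ℝ := accumulated (coeffFar p s) (lengthFar p)

/-! ### Coefficients near the origin -/

/-- The fourth root of `s / q₁`. -/
def nearRadius (p : Params) (s : ℝ) : ℝ := √(√(s / p.q1))

/-- Number of steps for a turn by 180 degrees. -/
def turnNear (p : Params) : ℕ := ⌈Real.pi / (min p.wbar Real.pi * p.δ)⌉₊

/-- Number of steps to drive to the `y`-axis. -/
def driveNear (p : Params) (s : ℝ) : ℕ :=
  ⌈nearRadius p s / (min p.vbar (nearRadius p s) * p.δ)⌉₊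

/-- Length of the manoeuvre; its last part takes four seconds. -/
def lengthNear (p : Params) (s : ℝ) : ℕ := turnNear p + driveNear p s + 4 * p.m

/-- The constant `(√(s/q₂) + 3/2)⁴ / 64`. -/
def speedConst (p : Params) (s : ℝ) : ℝ := (√(s / p.q2) + 3 / 2) ^ 4 / 64

/-- Coefficients at the beginning of the four phases, of one second each, of the last part. -/
def phaseCoeff (p : Params) (s : ℝ) : ℕ → ℝ
  | 0 => 1 + speedConst p s * p.r1 / p.q2 + p.r2 / p.q2
  | 1 => 9 / 16 + (p.q3 + p.r2 + (p.q1 + p.r1) * speedConst p s) / p.q2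
  | 2 => 1 / 4 + (p.r2 + (16 * p.q1 + p.r1) * speedConst p s) / p.q2
  | 3 => 1 / 16 + (p.q3 + p.r2 + (p.q1 + p.r1) * speedConst p s) / p.q2
  | _ => 0

/-- What is added to `phaseCoeff` in the interior of a phase. -/
def phaseExtra (p : Params) (s : ℝ) : ℕ → ℝ
  | 0 => (p.q1 * speedConst p s + p.q3) / p.q2
  | 1 => 15 * p.q1 * speedConst p s / p.q2
  | 2 => p.q3 / p.q2
  | _ => 0

/-- Coefficients of the manoeuvre: wait, drive to the `y`-axis, four curved phases. -/
def coeffNear (p : Params) (s : ℝ) (n : ℕ) : ℝ :=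
  let k := turnNear p
  let l := driveNear p s
  if n < k then 1
  else if n = k then 1 + 1 / (2 * (l : ℝ) * ((l : ℝ) * p.δ) ^ 3)
  else if n < k + l then 1
  else if n < k + l + 4 * p.m then
    let j := n - (k + l)
    phaseCoeff p s (j / p.m) + if j % p.m = 0 then 0 else phaseExtra p s (j / p.m)
  else 0

/-- The growth bounds `γ_i^{𝒩₁}`. -/
def growthNear (p : Params) (s : ℝ) : ℕ → ℝ := accumulated (coeffNear p s) (lengthNear p s)

/-- The speed used in the curved phases when starting at `(0, y, 0)`, `y ≥ 0`. -/
def curveSpeed (y : ℝ) : ℝ := y * Real.arctan √y / (4 - 4 / √(y + 1))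

/-- The curved phases, started at any `(0, y, 0)` in the near set, respect the bounds `ω̄`, `v̄` and
`x̄`: the angular speed is `arctan √y`, the speed is `curveSpeed y`, and the largest `x`-coordinate
is `2 sin (arctan √y) * curveSpeed y / arctan √y`. -/
def CurveFits (p : Params) (s : ℝ) : Prop :=
  ∀ y : ℝ, 0 ≤ y → y ≤ p.ybar → p.q2 * y ^ 2 < s →
    Real.arctan √y ≤ p.wbar ∧ curveSpeed y ≤ p.vbar ∧
      2 * (Real.sin (Real.arctan √y) * curveSpeed y / Real.arctan √y) ≤ p.xbar

/-! ### The growth bounds -/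

/-- `γ_i = min { i, max { γ_i^{𝒩₁}, γ_i^{𝒩₂} } }`. -/
def growth (p : Params) (s : ℝ) (i : ℕ) : ℝ :=
  min (i : ℝ) (max (growthNear p s i) (growthFar p s i))

end UnicycleMPC

end

noncomputable section

namespace UnicycleMPC

/-! ### Basic facts on the dynamics and the costs -/

/-! The heart of the matter is cost controllability: each state with orientation in `[-π, π]` admits
an explicit maneuver to the origin whose `n`-th stage cost is at most a coefficient times `ℓ*`.
Resting fixes every state, so `ℓ*` is the cost of resting (`minStageCost_eq`), `V_i ≤ i ℓ*`, and a
maneuver that ends at the origin continues for free. Summing the coefficients gives the growth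
bounds `γ_i`.

Near the origin the maneuver turns to orientation zero, drives to the `y`-axis and returns along
four arcs of one second each (`maneuver_near`, `CurveData.maneuver`). Away from it, it turns to a
heading on the line through the origin, drives there forwards or backwards, and turns to zero
(`maneuver_far_front`, `maneuver_far_back`).

A nonzero initial orientation fits into the same coefficients for three reasons. The waiting steps
with coefficient one are available for turning: when the angle shrinks, the drop of `q₃ θ⁴` pays for
the angular speed in all steps but the first, and the excess of the first step is recovered in the
second (`Shrinks.turn_cost_le`). Hence partial sums over at least two steps are unaffected, while
horizon one is covered by resting (`value_le_accumulated`). Next, two turns by 90 degrees reach the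
heading in the front half plane in all "front" cases (`exists_turnPlan`); otherwise the opposite
heading lies between zero and the initial orientation and one such turn reaches it. Finally, that
second variant consumes the coefficients in another order, which is harmless because sorting in
descending order maximises all partial sums (`sum_le_accumulated`).

Growth bounds imply stability through a linear program. From the successor state one may follow the
optimal sequence for a while and then switch to a sequence that obeys the growth bound; eliminating
the unknown stage costs from these inequalities leaves exactly `α_N` (`le_of_growth_bounds`,
`value_step_add_le`). If `α_N > 0`, the value function decays geometrically, and its polynomial
bounds in the norm turn this into a `𝒦ℒ` estimate. Growth bounds are needed along optimal
trajectories, so their orientations must stay in `[-π, π]`: by constraint in one case, by the level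
`q₃ π⁴` of the value function in the other. -/

theorem Params.m_pos' (p : Params) : (0 : ℝ) < p.m := Nat.cast_pos.2 p.m_pos

theorem Params.δ_pos (p : Params) : 0 < p.δ := one_div_pos.2 p.m_pos'

theorem Params.δ_mul_m (p : Params) : p.δ * p.m = 1 := by
  have := p.m_pos'
  unfold Params.δ
  field_simp

theorem state_ext {z w : State} (h0 : z 0 = w 0) (h1 : z 1 = w 1) (h2 : z 2 = w 2) : z = w := by
  ext i
  fin_cases i
  · exact h0
  · exact h1
  · exact h2

theorem eq_vec (z : State) : z = !₂[z 0, z 1, z 2] := state_ext rfl rfl rfl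

/-- Using `sinc` instead of a quotient removes the case `t = 0`. Both branches of `step` thereby
obey one formula, from which its continuity across `ω = 0` can be read off. -/
theorem sin_add_sub_sin (a t : ℝ) :
    Real.sin (a + t) - Real.sin a = t * Real.sinc (t / 2) * Real.cos (a + t / 2) := by
  have h : Real.sin (a + t) - Real.sin a = 2 * Real.sin (t / 2) * Real.cos (a + t / 2) := by
    rw [Real.sin_sub_sin]
    ring_nf
  rw [h]
  rcases eq_or_ne t 0 with rfl | ht
  · simp
  · rw [Real.sinc_of_ne_zero (by positivity)]
    field_simp

theorem cos_sub_cos_add (a t : ℝ) :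
    Real.cos a - Real.cos (a + t) = t * Real.sinc (t / 2) * Real.sin (a + t / 2) := by
  have h := sin_add_sub_sin (a - Real.pi / 2) t
  rw [show a - Real.pi / 2 + t = (a + t) - Real.pi / 2 by ring,
    show a - Real.pi / 2 + t / 2 = (a + t / 2) - Real.pi / 2 by ring,
    Real.sin_sub_pi_div_two, Real.sin_sub_pi_div_two, Real.cos_sub_pi_div_two] at h
  linarith

theorem step_two (p : Params) (z : State) (u : Input) : step p z u 2 = z 2 + p.δ * u.2 := by
  unfold step
  split_ifs with h
  · simp [h]
  · simp

theorem step_zero (p : Params) (z : State) (u : Input) :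
    step p z u 0 = z 0 + p.δ * u.1 * Real.sinc (p.δ * u.2 / 2)
      * Real.cos (z 2 + p.δ * u.2 / 2) := by
  unfold step
  split_ifs with h
  · simp [h]
  · have := sin_add_sub_sin (z 2) (p.δ * u.2)
    simp only [Matrix.cons_val_zero, this]
    field_simp

theorem step_one (p : Params) (z : State) (u : Input) :
    step p z u 1 = z 1 + p.δ * u.1 * Real.sinc (p.δ * u.2 / 2)
      * Real.sin (z 2 + p.δ * u.2 / 2) := by
  unfold step
  split_ifs with h
  · simp [h]
  · have := cos_sub_cos_add (z 2) (p.δ * u.2)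
    simp only [Matrix.cons_val_zero, Matrix.cons_val_one, this]
    field_simp

theorem continuous_step (p : Params) :
    Continuous (fun q : State × Input => step p q.1 q.2) := by
  have hs := Real.continuous_sinc
  have h0 : Continuous fun q : State × Input => q.1 0 := by fun_prop
  have h1 : Continuous fun q : State × Input => q.1 1 := by fun_prop
  have h2 : Continuous fun q : State × Input => q.1 2 := by fun_prop
  refine (PiLp.continuous_toLp 2 (fun _ : Fin 3 => ℝ)).comp
    (continuous_pi (f := fun (q : State × Input) (i : Fin 3) => step p q.1 q.2 i) fun i => ?_)
  fin_cases i
  · simp only [Fin.zero_eta, step_zero]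
    fun_prop
  · simp only [Fin.mk_one, step_one]
    fun_prop
  · simp only [Fin.reduceFinMk, step_two]
    fun_prop

theorem step_rest (p : Params) (z : State) : step p z (0, 0) = z := by
  refine state_ext ?_ ?_ ?_
  · simp [step_zero]
  · simp [step_one]
  · simp [step_two]

theorem traj_congr {p : Params} {u v : ℕ → Input} (z : State) {n : ℕ}
    (h : ∀ k < n, u k = v k) : traj p u z n = traj p v z n := by
  induction n with
  | zero => rfl
  | succ n ih => rw [traj, traj, ih fun k hk => h k (by omega), h n (by omega)]

theorem traj_add (p : Params) (u : ℕ → Input) (z : State) (j n : ℕ) :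
    traj p u z (j + n) = traj p (fun k => u (j + k)) (traj p u z j) n := by
  induction n with
  | zero => rfl
  | succ n ih => rw [← Nat.add_assoc, traj, traj, ih]

theorem traj_one_add (p : Params) (u : ℕ → Input) (z : State) (n : ℕ) :
    traj p u z (n + 1) = traj p (fun k => u (k + 1)) (step p z (u 0)) n := by
  rw [Nat.add_comm, traj_add]
  simp only [Nat.add_comm 1, traj]

theorem traj_eq {p : Params} {u : ℕ → Input} {X : ℕ → State} {L : ℕ}
    (h : ∀ n < L, step p (X n) (u n) = X (n + 1)) {n : ℕ} (hn : n ≤ L) :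
    traj p u (X 0) n = X n := by
  induction n with
  | zero => rfl
  | succ n ih => rw [traj, ih (by omega), h n (by omega)]

theorem traj_rest (p : Params) (z : State) (n : ℕ) : traj p (fun _ => (0, 0)) z n = z :=
  traj_eq (X := fun _ => z) (L := n) (fun _ _ => step_rest p z) le_rfl

/-- The stage cost of resting at a state. -/
def restCost (p : Params) (z : State) : ℝ := p.q1 * z 0 ^ 4 + p.q2 * z 1 ^ 2 + p.q3 * z 2 ^ 4

theorem restCost_nonneg (p : Params) (z : State) : 0 ≤ restCost p z := by
  have := p.q1_pos; have := p.q2_pos; have := p.q3_pos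
  unfold restCost
  positivity

theorem stageCost_eq (p : Params) (z : State) (u : Input) :
    stageCost p z u = restCost p z + p.r1 * u.1 ^ 4 + p.r2 * u.2 ^ 4 := rfl

theorem restCost_le_stageCost (p : Params) (z : State) (u : Input) :
    restCost p z ≤ stageCost p z u := by
  have := p.r1_pos; have := p.r2_pos
  rw [stageCost_eq]
  have : 0 ≤ p.r1 * u.1 ^ 4 := by positivity
  have : 0 ≤ p.r2 * u.2 ^ 4 := by positivity
  linarith

theorem stageCost_rest (p : Params) (z : State) : stageCost p z (0, 0) = restCost p z := by
  simp [stageCost_eq]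

theorem stageCost_nonneg (p : Params) (z : State) (u : Input) : 0 ≤ stageCost p z u :=
  (restCost_nonneg p z).trans (restCost_le_stageCost p z u)

theorem cost_nonneg (p : Params) (N : ℕ) (z : State) (u : ℕ → Input) : 0 ≤ cost p N z u :=
  Finset.sum_nonneg fun _ _ => stageCost_nonneg _ _ _

theorem zero_mem_inputSet (p : Params) : ((0, 0) : Input) ∈ inputSet p := by
  simp [inputSet, p.vbar_pos.le, p.wbar_pos.le]

theorem admissible_rest {p : Params} {Θ : Set ℝ} {z : State} (hz : z ∈ stateSet p Θ) (N : ℕ) :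
    Admissible p Θ N z fun _ => (0, 0) :=
  ⟨fun _ _ => zero_mem_inputSet p, fun k _ => by rwa [traj_rest]⟩

/-- The zero control keeps the state fixed, so it is admissible at every feasible state and makes
both input terms vanish. -/
theorem minStageCost_eq {p : Params} {Θ : Set ℝ} {z : State} (hz : z ∈ stateSet p Θ) :
    minStageCost p Θ z = restCost p z := by
  refine IsLeast.csInf_eq ⟨⟨_, admissible_rest hz 1, (stageCost_rest p z).symm⟩, ?_⟩
  rintro c ⟨u, -, rfl⟩
  exact restCost_le_stageCost _ _ _

theorem cost_congr {p : Params} {u v : ℕ → Input} (z : State) {N : ℕ}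
    (h : ∀ k < N, u k = v k) : cost p N z u = cost p N z v := by
  refine Finset.sum_congr rfl fun k hk => ?_
  have hk := Finset.mem_range.1 hk
  rw [traj_congr z fun j hj => h j (by omega), h k hk]

theorem Admissible.congr {p : Params} {Θ : Set ℝ} {u v : ℕ → Input} {z : State} {N : ℕ}
    (hu : Admissible p Θ N z u) (h : ∀ k < N, u k = v k) : Admissible p Θ N z v :=
  ⟨fun k hk => h k hk ▸ hu.1 k hk, fun k hk => by
    rw [← traj_congr z fun j hj => h j (by omega)]
    exact hu.2 k hk⟩

theorem stateSet_mono (p : Params) {Θ Θ' : Set ℝ} (h : Θ ⊆ Θ') : stateSet p Θ ⊆ stateSet p Θ' :=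
  fun _ hz => ⟨hz.1, hz.2.1, h hz.2.2⟩

theorem Admissible.mono {p : Params} {Θ Θ' : Set ℝ} {u : ℕ → Input} {z : State} {N : ℕ}
    (hu : Admissible p Θ N z u) (h : Θ ⊆ Θ') : Admissible p Θ' N z u :=
  ⟨hu.1, fun k hk => stateSet_mono p h (hu.2 k hk)⟩

theorem value_le_cost {p : Params} {Θ : Set ℝ} {u : ℕ → Input} {z : State} {N : ℕ}
    (hu : Admissible p Θ N z u) : value p Θ N z ≤ ENNReal.ofReal (cost p N z u) :=
  iInf₂_le u hu

theorem value_le_rest {p : Params} {Θ : Set ℝ} {z : State} (hz : z ∈ stateSet p Θ) (N : ℕ) :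
    value p Θ N z ≤ ENNReal.ofReal (N * minStageCost p Θ z) := by
  refine (value_le_cost (admissible_rest hz N)).trans_eq ?_
  simp [cost, traj_rest, stageCost_rest, minStageCost_eq hz]

/-! ### Existence of optimal controls -/

theorem continuous_traj (p : Params) (z : State) (n : ℕ) :
    Continuous fun u : ℕ → Input => traj p u z n := by
  induction n with
  | zero => exact continuous_const
  | succ n ih => exact (continuous_step p).comp (ih.prodMk (continuous_apply n))

theorem continuous_cost (p : Params) (z : State) (N : ℕ) :
    Continuous fun u : ℕ → Input => cost p N z u := by
  refine continuous_finsetSum _ fun k _ => ?_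
  have hT := continuous_traj p z k
  have hu : Continuous fun u : ℕ → Input => u k := continuous_apply k
  unfold stageCost
  fun_prop

theorem isClosed_stateSet (p : Params) {Θ : Set ℝ} (hΘ : IsClosed Θ) :
    IsClosed (stateSet p Θ) := by
  have h2 : Continuous fun z : State => z 2 := by fun_prop
  have h0 : Continuous fun z : State => |z 0| := by fun_prop
  have h1 : Continuous fun z : State => |z 1| := by fun_prop
  exact IsClosed.inter (isClosed_le h0 continuous_const)
    (IsClosed.inter (isClosed_le h1 continuous_const) (hΘ.preimage h2))

theorem isCompact_inputSet (p : Params) : IsCompact (inputSet p) := by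
  have : inputSet p = Set.Icc (-p.vbar) p.vbar ×ˢ Set.Icc (-p.wbar) p.wbar := by
    ext u
    simp only [inputSet, mem_ofPred_eq, mem_prod, mem_Icc, abs_le]
  rw [this]
  exact isCompact_Icc.prod isCompact_Icc

/-- Tychonoff: control sequences with values in the compact input set form a compact product, the
state constraints up to time `N` are closed conditions on it, and the cost is continuous. -/
theorem exists_optimal (p : Params) {Θ : Set ℝ} (hΘ : IsClosed Θ) (N : ℕ) {z : State}
    (hz : z ∈ stateSet p Θ) : ∃ u : ℕ → Input, Admissible p Θ N z u ∧
      ENNReal.ofReal (cost p N z u) = value p Θ N z := by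
  let K : Set (ℕ → Input) := (Set.univ.pi fun _ => inputSet p) ∩
    ⋂ k ∈ {k | k ≤ N}, (fun u => traj p u z k) ⁻¹' stateSet p Θ
  have hK : IsCompact K := (isCompact_univ_pi fun _ => isCompact_inputSet p).inter_right
    (isClosed_biInter fun k _ => (isClosed_stateSet p hΘ).preimage (continuous_traj p z k))
  have hKA : ∀ u ∈ K, Admissible p Θ N z u := fun u hu =>
    ⟨fun k _ => hu.1 k trivial, fun k hk => Set.mem_iInter₂.1 hu.2 k hk⟩
  have hne : K.Nonempty := ⟨fun _ => (0, 0), fun _ _ => zero_mem_inputSet p,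
    Set.mem_iInter₂.2 fun k hk => (admissible_rest hz N).2 k hk⟩
  obtain ⟨u, huK, hu⟩ := hK.exists_isMinOn hne (continuous_cost p z N).continuousOn
  refine ⟨u, hKA u huK, le_antisymm (le_iInf₂ fun v hv => ?_) (value_le_cost (hKA u huK))⟩
  -- A competitor is unconstrained from time `N` on, whereas the compact set constrains all times;
  -- its irrelevant tail is replaced by zero.
  let v' : ℕ → Input := fun k => if k < N then v k else (0, 0)
  have hvv : ∀ k < N, v k = v' k := fun k hk => by simp [v', hk]
  have hv' : v' ∈ K := by
    refine ⟨fun k _ => ?_, Set.mem_iInter₂.2 fun k hk => (hv.congr hvv).2 k hk⟩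
    by_cases hk : k < N
    · simpa [v', hk] using hv.1 k hk
    · simpa [v', hk] using zero_mem_inputSet p
  rw [cost_congr z hvv]
  exact ENNReal.ofReal_le_ofReal (hu hv')

theorem exists_isMPCFeedback (p : Params) {Θ : Set ℝ} (hΘ : IsClosed Θ) (N : ℕ) :
    ∃ μ : State → Input, IsMPCFeedback p Θ N μ := by
  choose! u hu using fun z (hz : z ∈ stateSet p Θ) => exists_optimal p hΘ N hz
  exact ⟨fun z => u z 0, fun z hz => ⟨u z, (hu z hz).1, (hu z hz).2, rfl⟩⟩

/-! ### Comparison functions -/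

theorem norm_sq_state (z : State) : ‖z‖ ^ 2 = z 0 ^ 2 + z 1 ^ 2 + z 2 ^ 2 := by
  rw [EuclideanSpace.norm_sq_eq]
  simp [Fin.sum_univ_three]

/-- The factor in the quartic lower bound of the stage cost. -/
def lowFactor (p : Params) : ℝ≥0 :=
  ⟨min p.q1 (min (p.q2 / p.ybar ^ 2) p.q3) / 3, by
    have := p.q1_pos; have := p.q2_pos; have := p.q3_pos; have := p.ybar_pos
    positivity⟩

theorem lowFactor_pos (p : Params) : 0 < lowFactor p := by
  have := p.q1_pos; have := p.q2_pos; have := p.q3_pos; have := p.ybar_pos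
  change (0 : ℝ) < min p.q1 (min (p.q2 / p.ybar ^ 2) p.q3) / 3
  positivity

/-- The factor in the polynomial upper bound of the stage cost. -/
def upFactor (p : Params) : ℝ≥0 :=
  ⟨p.q1 + p.q2 + p.q3, by linarith [p.q1_pos, p.q2_pos, p.q3_pos]⟩

theorem upFactor_pos (p : Params) : 0 < upFactor p := by
  change (0 : ℝ) < p.q1 + p.q2 + p.q3
  linarith [p.q1_pos, p.q2_pos, p.q3_pos]

/-- The cost is only quadratic in `y`, but `|y| ≤ ȳ` gives `y² ≥ y⁴ / ȳ²`, so a pure quartic lower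
bound in the norm holds on the constraint set. -/
theorem le_restCost {p : Params} {Θ : Set ℝ} {z : State} (hz : z ∈ stateSet p Θ) :
    (lowFactor p : ℝ) * ‖z‖ ^ 4 ≤ restCost p z := by
  have hy := p.ybar_pos
  set c := min p.q1 (min (p.q2 / p.ybar ^ 2) p.q3) with hc
  have h1 : c ≤ p.q1 := min_le_left _ _
  have h2 : c ≤ p.q2 / p.ybar ^ 2 := (min_le_right _ _).trans (min_le_left _ _)
  have h3 : c ≤ p.q3 := (min_le_right _ _).trans (min_le_right _ _)
  have hc0 : 0 < c := by
    have := p.q1_pos; have := p.q2_pos; have := p.q3_pos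
    positivity
  have hyz : z 1 ^ 2 ≤ p.ybar ^ 2 := sq_le_sq' (abs_le.1 hz.2.1).1 (abs_le.1 hz.2.1).2
  have h2' : c * z 1 ^ 4 ≤ p.q2 * z 1 ^ 2 := by
    rw [le_div_iff₀ (by positivity)] at h2
    calc c * z 1 ^ 4 = c * z 1 ^ 2 * z 1 ^ 2 := by ring
      _ ≤ c * p.ybar ^ 2 * z 1 ^ 2 := by gcongr
      _ ≤ p.q2 * z 1 ^ 2 := by gcongr
  have h1' : c * z 0 ^ 4 ≤ p.q1 * z 0 ^ 4 := by gcongr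
  have h3' : c * z 2 ^ 4 ≤ p.q3 * z 2 ^ 4 := by gcongr
  have h4 : ‖z‖ ^ 4 ≤ 3 * (z 0 ^ 4 + z 1 ^ 4 + z 2 ^ 4) := by
    rw [show ‖z‖ ^ 4 = (‖z‖ ^ 2) ^ 2 by ring, norm_sq_state]
    nlinarith [sq_nonneg (z 0 ^ 2 - z 1 ^ 2), sq_nonneg (z 0 ^ 2 - z 2 ^ 2),
      sq_nonneg (z 1 ^ 2 - z 2 ^ 2)]
  change c / 3 * ‖z‖ ^ 4 ≤ _
  calc c / 3 * ‖z‖ ^ 4 ≤ c / 3 * (3 * (z 0 ^ 4 + z 1 ^ 4 + z 2 ^ 4)) := by gcongr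
    _ = c * z 0 ^ 4 + c * z 1 ^ 4 + c * z 2 ^ 4 := by ring
    _ ≤ _ := by
      unfold restCost
      linarith

theorem restCost_le (p : Params) (z : State) :
    restCost p z ≤ upFactor p * (‖z‖ ^ 4 + ‖z‖ ^ 2) := by
  have h := norm_sq_state z
  have := p.q1_pos; have := p.q2_pos; have := p.q3_pos
  have h0 : z 0 ^ 2 ≤ ‖z‖ ^ 2 := by nlinarith
  have h1 : z 1 ^ 2 ≤ ‖z‖ ^ 2 := by nlinarith
  have h2 : z 2 ^ 2 ≤ ‖z‖ ^ 2 := by nlinarith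
  have h0' : z 0 ^ 4 ≤ ‖z‖ ^ 4 := by nlinarith [sq_nonneg (z 0)]
  have h2' : z 2 ^ 4 ≤ ‖z‖ ^ 4 := by nlinarith [sq_nonneg (z 2)]
  have hn : 0 ≤ ‖z‖ ^ 4 := by positivity
  have hn2 : 0 ≤ ‖z‖ ^ 2 := by positivity
  change _ ≤ (p.q1 + p.q2 + p.q3) * _
  unfold restCost
  calc _ ≤ p.q1 * ‖z‖ ^ 4 + p.q2 * ‖z‖ ^ 2 + p.q3 * ‖z‖ ^ 4 := by gcongr
    _ ≤ _ := by nlinarith [mul_nonneg p.q1_pos.le hn2, mul_nonneg p.q2_pos.le hn,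
        mul_nonneg p.q3_pos.le hn2]

theorem isClassKInf_quartic {c : ℝ≥0} (hc : 0 < c) : IsClassKInf fun r => c * r ^ 4 := by
  refine ⟨by fun_prop, fun a b h => ?_, by simp, ?_⟩
  · have : a ^ 4 < b ^ 4 := pow_lt_pow_left₀ h (zero_le) (by norm_num)
    exact mul_lt_mul_of_pos_left this hc
  · rw [← NNReal.tendsto_coe_atTop]
    have h : Tendsto (fun r : ℝ≥0 => (c : ℝ) * (r : ℝ) ^ 4) atTop atTop :=
      ((tendsto_pow_atTop (by norm_num)).comp
        (NNReal.tendsto_coe_atTop.2 tendsto_id)).const_mul_atTop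
        (NNReal.coe_pos.2 hc)
    simpa using h

theorem isClassKInf_quartic_add_sq {c : ℝ≥0} (hc : 0 < c) :
    IsClassKInf fun r => c * (r ^ 4 + r ^ 2) := by
  refine ⟨by fun_prop, fun a b h => ?_, by simp, ?_⟩
  · have h4 : a ^ 4 < b ^ 4 := pow_lt_pow_left₀ h (zero_le) (by norm_num)
    have h2 : a ^ 2 < b ^ 2 := pow_lt_pow_left₀ h (zero_le) (by norm_num)
    exact mul_lt_mul_of_pos_left (add_lt_add h4 h2) hc
  · refine tendsto_atTop_mono (fun r => ?_) (isClassKInf_quartic hc).2.2.2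
    exact mul_le_mul_right (le_self_add) c

theorem exists_bounds (p : Params) (Θ : Set ℝ) :
    ∃ ηlow ηup : ℝ≥0 → ℝ≥0, IsClassKInf ηlow ∧ IsClassKInf ηup ∧ ∀ z ∈ stateSet p Θ,
      (ηlow ‖z‖₊ : ℝ) ≤ minStageCost p Θ z ∧ minStageCost p Θ z ≤ (ηup ‖z‖₊ : ℝ) := by
  refine ⟨_, _, isClassKInf_quartic (lowFactor_pos p), isClassKInf_quartic_add_sq (upFactor_pos p),
    fun z hz => ?_⟩
  rw [minStageCost_eq hz]
  exact ⟨by simpa using le_restCost hz, by simpa using restCost_le p z⟩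

/-! ### Accumulation of rearranged coefficients -/

/-- Entry by entry, a sublist of a descending list is dominated by the list itself; nonnegativity
takes care of the entries beyond the length of the sublist. -/
theorem sum_le_of_sublist {l l' : List ℝ} (h : l'.Sublist l) (hs : l.Pairwise (· ≥ ·))
    (h0 : ∀ a ∈ l, 0 ≤ a) {j : ℕ} (hj : l'.length ≤ j) :
    l'.sum ≤ ∑ n ∈ Finset.range j, l.getD n 0 := by
  induction h generalizing j with
  | slnil => simp
  | @cons l₁ l₂ a _ ih =>
    rw [List.pairwise_cons] at hs
    -- If the head is omitted, every later entry moves one place forward, and in a descending list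
    -- it is at most the entry whose place it takes. The inner induction proves this for `getD`,
    -- whose default `0` is harmless by nonnegativity.
    refine (ih hs.2 (fun b hb => h0 b (List.mem_cons_of_mem _ hb)) hj).trans
      (Finset.sum_le_sum fun n _ => ?_)
    induction n generalizing l₂ a with
    | zero =>
      cases l₂ with
      | nil => simpa using h0 a (by simp)
      | cons b t => simpa using hs.1 b (by simp)
    | succ n ihn =>
      cases l₂ with
      | nil => simp
      | cons b t =>
        rw [List.getD_cons_succ, List.getD_cons_succ]
        have hs2 := List.pairwise_cons.1 hs.2
        by_cases hn : n < t.length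
        · rw [List.getD_eq_getElem _ _ hn, List.getD_eq_getElem _ _ (by simp; omega)]
          rcases Nat.eq_zero_or_pos n with rfl | hn0
          · exact hs2.1 _ (List.getElem_mem _)
          · exact List.pairwise_iff_getElem.1 hs.2 n (n + 1) (by simp; omega) (by simp; omega)
              (by omega)
        · rw [List.getD_eq_default _ _ (not_lt.1 hn)]
          by_cases hn' : n < (b :: t).length
          · rw [List.getD_eq_getElem _ _ hn']
            exact h0 _ (List.mem_cons_of_mem _ (List.getElem_mem _))
          · rw [List.getD_eq_default _ _ (not_lt.1 hn')]
  | @cons_cons l₁ l₂ a _ ih =>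
    obtain ⟨i, rfl⟩ : ∃ i, j = i + 1 := ⟨j - 1, by simp at hj; omega⟩
    rw [List.pairwise_cons] at hs
    rw [Finset.sum_range_succ', List.sum_cons, add_comm]
    have := ih hs.2 (fun b hb => h0 b (List.mem_cons_of_mem _ hb)) (j := i) (by simpa using hj)
    simpa using this

/-- The terms with index at least `L` vanish, and by injectivity the others, apart from `c 0`, form
a submultiset of `c 1, …, c (L - 1)`. Up to order it is therefore a sublist of the sorted list. This
is what allows a maneuver to use the coefficients in any order that starts with `c 0`. -/
theorem sum_le_accumulated {c : ℕ → ℝ} {L : ℕ} (hc : ∀ n, 0 ≤ c n) (hL : ∀ n, L ≤ n → c n = 0)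
    {σ : ℕ → ℕ} (hσ : Function.Injective σ) (hσ0 : σ 0 = 0) (i : ℕ) :
    ∑ n ∈ Finset.range i, c (σ n) ≤ accumulated c L i := by
  cases i with
  | zero => simp [accumulated]
  | succ j =>
    rw [accumulated, Finset.sum_range_succ', Finset.sum_range_succ', hσ0]
    refine add_le_add_left ?_ (c 0)
    set f : ℕ → ℝ := fun n => c (n + 1)
    set ls := ((List.range (L - 1)).map f).insertionSort (· ≥ ·) with hls
    have hpos : ∀ n, 1 ≤ σ (n + 1) := fun n => by
      by_contra h
      have : σ (n + 1) = σ 0 := by omega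
      exact absurd (hσ this) (by omega)
    -- `T` collects the summands that can be nonzero, and `S` the positions of their coefficients in
    -- the unsorted list, shifted by one because `c 0` is kept apart.
    set T := (Finset.range j).filter fun n => σ (n + 1) < L
    set S := T.image fun n => σ (n + 1) - 1
    have hinj : Set.InjOn (fun n => σ (n + 1) - 1) T := fun a _ b _ hab => by
      have h1 := hpos a
      have h2 := hpos b
      simp only at hab
      have := hσ (show σ (a + 1) = σ (b + 1) by omega)
      omega
    have hsum : ∑ n ∈ Finset.range j, c (σ (n + 1)) = ∑ t ∈ S, f t := by
      rw [Finset.sum_image hinj]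
      rw [← Finset.sum_subset (Finset.filter_subset (fun n => σ (n + 1) < L) (Finset.range j))]
      · refine Finset.sum_congr rfl fun n _ => ?_
        simp only [f]
        rw [Nat.sub_add_cancel (hpos n)]
      · intro n hn hn'
        refine hL _ ?_
        simpa [Finset.mem_range.1 hn] using hn'
    have hSle : S.val ≤ (Finset.range (L - 1)).val := by
      rw [Finset.val_le_iff]
      intro t ht
      obtain ⟨n, hn, rfl⟩ := Finset.mem_image.1 ht
      have := (Finset.mem_filter.1 hn).2
      have := hpos n
      simp only [Finset.mem_range]
      omega
    have hcoe : ((Finset.range (L - 1)).val.map f) = (ls : Multiset ℝ) := by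
      rw [hls, Multiset.coe_eq_coe.2 (List.perm_insertionSort _ _)]
      rfl
    have hMle : S.val.map f ≤ (ls : Multiset ℝ) := hcoe ▸ Multiset.map_le_map hSle
    obtain ⟨l', hl'⟩ : ∃ l' : List ℝ, (l' : Multiset ℝ) = S.val.map f :=
      Quotient.exists_rep _
    rw [← hl', Multiset.coe_le] at hMle
    obtain ⟨l'', hp, hsub⟩ := hMle
    have hlen : l''.length ≤ j := by
      rw [hp.length_eq, ← Multiset.coe_card, hl', Multiset.card_map]
      calc S.card ≤ T.card := Finset.card_image_le
        _ ≤ (Finset.range j).card := Finset.card_filter_le _ _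
        _ = j := by simp
    have key := sum_le_of_sublist hsub (List.pairwise_insertionSort _ _) (fun a ha => by
      rw [List.mem_insertionSort] at ha
      obtain ⟨n, -, rfl⟩ := List.mem_map.1 ha
      exact hc _) hlen
    rw [hp.sum_eq, ← Multiset.sum_coe, hl'] at key
    rw [hsum]
    exact key

theorem rearranged_nonneg {c : ℕ → ℝ} (hc : ∀ n, 0 ≤ c n) (L n : ℕ) : 0 ≤ rearranged c L n := by
  cases n with
  | zero => exact hc 0
  | succ n =>
    rw [rearranged]
    by_cases h : n < (((List.range (L - 1)).map (fun j => c (j + 1))).insertionSort (· ≥ ·)).length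
    · rw [List.getD_eq_getElem _ _ h]
      have := List.getElem_mem h
      rw [List.mem_insertionSort] at this
      obtain ⟨j, -, hj⟩ := List.mem_map.1 this
      rw [← hj]
      exact hc _
    · rw [List.getD_eq_default _ _ (not_lt.1 h)]

theorem accumulated_mono {c : ℕ → ℝ} (hc : ∀ n, 0 ≤ c n) (L : ℕ) : Monotone (accumulated c L) :=
  monotone_nat_of_le_succ fun n => by
    rw [accumulated, accumulated, Finset.sum_range_succ]
    exact le_add_of_nonneg_right (rearranged_nonneg hc L n)

/-- The sorted part has `L - 1` entries, so the sums become constant. The index `L + 1` rather than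
`L` also covers `L = 0`, where `rearranged` still contributes `c 0`. -/
theorem accumulated_le {c : ℕ → ℝ} (hc : ∀ n, 0 ≤ c n) (L i : ℕ) :
    accumulated c L i ≤ accumulated c L (L + 1) := by
  rcases le_total i (L + 1) with h | h
  · exact accumulated_mono hc L h
  · refine le_of_eq (Finset.sum_subset (Finset.range_mono h) fun n _ hn => ?_).symm
    simp only [Finset.mem_range, not_lt] at hn
    obtain ⟨n, rfl⟩ : ∃ i, n = i + 1 := ⟨n - 1, by omega⟩
    rw [rearranged, List.getD_eq_default]
    simp
    omega

theorem accumulated_one (c : ℕ → ℝ) (L : ℕ) : accumulated c L 1 = c 0 := by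
  simp [accumulated, rearranged]

/-! ### Properties of the coefficients -/

/-- Capping the speed `b` by the distance `a` forces the motion to last at least one second. This is
the second conclusion, on which the estimates of the input costs rely. -/
theorem one_le_ceil_mul {a b d : ℝ} (ha : 0 < a) (hb : 0 < b) (hd : 0 < d) :
    a ≤ ⌈a / (min b a * d)⌉₊ * (min b a * d) ∧ 1 ≤ ⌈a / (min b a * d)⌉₊ * d ∧
      1 ≤ ⌈a / (min b a * d)⌉₊ := by
  have hm : 0 < min b a := lt_min hb ha
  have h := Nat.le_ceil (a / (min b a * d))
  have h1 : a ≤ ⌈a / (min b a * d)⌉₊ * (min b a * d) := (div_le_iff₀ (by positivity)).1 h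
  refine ⟨h1, ?_, Nat.one_le_iff_ne_zero.2 (Nat.ceil_pos.2 (by positivity)).ne'⟩
  have h2 : a * 1 ≤ a * (⌈a / (min b a * d)⌉₊ * d) := by
    calc a * 1 ≤ ⌈a / (min b a * d)⌉₊ * (min b a * d) := by linarith
      _ ≤ ⌈a / (min b a * d)⌉₊ * (a * d) := by
        gcongr
        exact min_le_right _ _
      _ = _ := by ring
  exact le_of_mul_le_mul_left h2 ha

theorem turnFar_spec (p : Params) :
    Real.pi / 2 ≤ turnFar p * (min p.wbar (Real.pi / 2) * p.δ) ∧ 1 ≤ turnFar p * p.δ ∧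
      1 ≤ turnFar p :=
  one_le_ceil_mul (by positivity) p.wbar_pos p.δ_pos

theorem turnNear_spec (p : Params) :
    Real.pi ≤ turnNear p * (min p.wbar Real.pi * p.δ) ∧ 1 ≤ turnNear p * p.δ ∧
      1 ≤ turnNear p :=
  one_le_ceil_mul Real.pi_pos p.wbar_pos p.δ_pos

theorem nearRadius_pos {p : Params} {s : ℝ} (hs : 0 < s) : 0 < nearRadius p s := by
  have := p.q1_pos
  unfold nearRadius
  positivity

theorem nearRadius_pow {p : Params} {s : ℝ} (hs : 0 < s) : p.q1 * nearRadius p s ^ 4 = s := by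
  have := p.q1_pos
  rw [nearRadius, show (√√(s / p.q1)) ^ 4 = ((√√(s / p.q1)) ^ 2) ^ 2 by ring,
    Real.sq_sqrt (by positivity), Real.sq_sqrt (by positivity)]
  field_simp

theorem driveNear_spec (p : Params) {s : ℝ} (hs : 0 < s) :
    nearRadius p s ≤ driveNear p s * (min p.vbar (nearRadius p s) * p.δ) ∧
      1 ≤ driveNear p s * p.δ ∧ 1 ≤ driveNear p s :=
  one_le_ceil_mul (nearRadius_pos hs) p.vbar_pos p.δ_pos

theorem driveFar_spec (p : Params) :
    √(p.xbar ^ 2 + p.ybar ^ 2) ≤ driveFar p * (p.vbar * p.δ) ∧ 1 ≤ driveFar p := by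
  have hv := p.vbar_pos
  have hd := p.δ_pos
  have hx := p.xbar_pos
  have hy := p.ybar_pos
  have h := Nat.le_ceil (√(p.ybar ^ 2 + p.xbar ^ 2) / (p.vbar * p.δ))
  rw [add_comm (p.xbar ^ 2)]
  exact ⟨(div_le_iff₀ (by positivity)).1 h,
    Nat.one_le_iff_ne_zero.2 (Nat.ceil_pos.2 (by positivity)).ne'⟩

theorem driveCoeffFront_nonneg (p : Params) {s : ℝ} (hs : 0 < s) (i : ℕ) :
    0 ≤ driveCoeffFront p s i := by
  have := p.q3_pos; have := p.r1_pos; have := p.vbar_pos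
  unfold driveCoeffFront
  positivity

theorem driveCoeffFront_le (p : Params) (s : ℝ) (i : ℕ) :
    driveCoeffFront p s i ≤ driveCoeff p s i := le_max_left _ _

theorem coeffFarWith_nonneg {d : ℕ → ℝ} (hd : ∀ i, 0 ≤ d i) (p : Params) {s : ℝ} (hs : 0 < s)
    (n : ℕ) : 0 ≤ coeffFarWith d p s n := by
  have := p.q3_pos; have := p.δ_pos
  simp only [coeffFarWith]
  split_ifs
  · exact zero_le_one
  · positivity
  · exact hd _
  · have : ∀ a : ℝ, 0 ≤ a ^ 4 := fun a => by positivity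
    have := this ((turnFar p : ℝ) - ((n - (2 * turnFar p + driveFar p) : ℕ) : ℝ))
    positivity
  · exact le_rfl

theorem coeffFarWith_eq_zero (d : ℕ → ℝ) (p : Params) (s : ℝ) {n : ℕ} (hn : lengthFar p ≤ n) :
    coeffFarWith d p s n = 0 := by
  unfold lengthFar at hn
  simp only [coeffFarWith]
  rw [if_neg (by omega), if_neg (by omega), if_neg (by omega), if_neg (by omega)]

theorem coeffFarWith_le {d d' : ℕ → ℝ} (h : ∀ i, d i ≤ d' i) (p : Params) (s : ℝ) (n : ℕ) :
    coeffFarWith d p s n ≤ coeffFarWith d' p s n := by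
  simp only [coeffFarWith]
  split_ifs <;> simp [h]

theorem coeffFarFront_nonneg (p : Params) {s : ℝ} (hs : 0 < s) (n : ℕ) : 0 ≤ coeffFarFront p s n :=
  coeffFarWith_nonneg (driveCoeffFront_nonneg p hs) p hs n

theorem coeffFar_nonneg (p : Params) {s : ℝ} (hs : 0 < s) (n : ℕ) : 0 ≤ coeffFar p s n :=
  coeffFarWith_nonneg (fun i => (driveCoeffFront_nonneg p hs i).trans (driveCoeffFront_le p s i))
    p hs n

theorem speedConst_nonneg (p : Params) (s : ℝ) : 0 ≤ speedConst p s := by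
  unfold speedConst
  positivity

theorem phaseCoeff_nonneg (p : Params) (s : ℝ) (i : ℕ) : 0 ≤ phaseCoeff p s i := by
  have := p.q1_pos; have := p.q2_pos; have := p.q3_pos; have := p.r1_pos; have := p.r2_pos
  have := speedConst_nonneg p s
  unfold phaseCoeff
  split <;> positivity

theorem phaseExtra_nonneg (p : Params) (s : ℝ) (i : ℕ) : 0 ≤ phaseExtra p s i := by
  have := p.q1_pos; have := p.q2_pos; have := p.q3_pos; have := speedConst_nonneg p s
  unfold phaseExtra
  split <;> positivity

theorem coeffNear_nonneg (p : Params) (s : ℝ) (n : ℕ) : 0 ≤ coeffNear p s n := by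
  have := p.δ_pos
  simp only [coeffNear]
  split_ifs
  · exact zero_le_one
  · positivity
  · exact zero_le_one
  · exact add_nonneg (phaseCoeff_nonneg _ _ _) le_rfl
  · exact add_nonneg (phaseCoeff_nonneg _ _ _) (phaseExtra_nonneg _ _ _)
  · exact le_rfl

theorem coeffNear_eq_zero (p : Params) {s : ℝ} (hs : 0 < s) {n : ℕ} (hn : lengthNear p s ≤ n) :
    coeffNear p s n = 0 := by
  unfold lengthNear at hn
  have := (driveNear_spec p hs).2.2
  simp only [coeffNear]
  rw [if_neg (by omega), if_neg (by omega), if_neg (by omega), if_neg (by omega)]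

theorem growth_mono (p : Params) {s : ℝ} (hs : 0 < s) : Monotone (growth p s) := fun _ _ h =>
  min_le_min (Nat.cast_le.2 h) (max_le_max (accumulated_mono (coeffNear_nonneg p s) _ h)
    (accumulated_mono (coeffFar_nonneg p hs) _ h))

theorem growth_bddAbove (p : Params) {s : ℝ} (hs : 0 < s) : BddAbove (Set.range (growth p s)) :=
  ⟨_, by
    rintro _ ⟨i, rfl⟩
    exact (min_le_right _ _).trans (max_le_max (accumulated_le (coeffNear_nonneg p s) _ i)
      (accumulated_le (coeffFar_nonneg p hs) _ i))⟩

theorem coeffNear_zero (p : Params) (s : ℝ) : coeffNear p s 0 = 1 := by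
  have := (turnNear_spec p).2.2
  simp only [coeffNear]
  rw [if_pos (by omega)]

theorem coeffFarWith_zero (d : ℕ → ℝ) (p : Params) (s : ℝ) : coeffFarWith d p s 0 = 1 := by
  have := (turnFar_spec p).2.2
  simp only [coeffFarWith]
  rw [if_pos (by omega)]

theorem growth_one (p : Params) (s : ℝ) : growth p s 1 = 1 := by
  simp [growth, growthNear, growthFar, accumulated_one, coeffNear_zero, coeffFar,
    coeffFarWith_zero]

theorem one_le_growth (p : Params) {s : ℝ} (hs : 0 < s) {i : ℕ} (hi : 1 ≤ i) :
    1 ≤ growth p s i := growth_one p s ▸ growth_mono p hs hi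

/-! ### The performance index -/

theorem prod_sub_one_nonneg {g : ℕ → ℝ} (hg : ∀ k, 2 ≤ k → 1 ≤ g k) (n : ℕ) :
    0 ≤ ∏ k ∈ Finset.Icc 2 n, (g k - 1) :=
  Finset.prod_nonneg fun k hk => by linarith [hg k (Finset.mem_Icc.1 hk).1]

theorem prod_sub_one_lt {g : ℕ → ℝ} (hg : ∀ k, 2 ≤ k → 1 ≤ g k) {N : ℕ} (hN : 2 ≤ N) :
    ∏ k ∈ Finset.Icc 2 N, (g k - 1) < ∏ k ∈ Finset.Icc 2 N, g k := by
  induction N, hN using Nat.le_induction with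
  | base => simp
  | succ n hn ih =>
    rw [Finset.prod_Icc_succ_top (by omega), Finset.prod_Icc_succ_top (by omega)]
    have h1 := hg (n + 1) (by omega)
    have h2 := prod_sub_one_nonneg hg n
    nlinarith

theorem perfIndex_le_one {g : ℕ → ℝ} (hg : ∀ k, 2 ≤ k → 1 ≤ g k) {N : ℕ} (hN : 2 ≤ N) :
    perfIndex g N ≤ 1 := by
  have h1 := prod_sub_one_nonneg hg N
  have h2 := prod_sub_one_lt hg hN
  have h3 := hg N hN
  have : 0 ≤ (g N - 1) * (∏ k ∈ Finset.Icc 2 N, (g k - 1)) /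
      ((∏ k ∈ Finset.Icc 2 N, g k) - ∏ k ∈ Finset.Icc 2 N, (g k - 1)) :=
    div_nonneg (mul_nonneg (by linarith) h1) (by linarith)
  unfold perfIndex
  linarith

/-- The linear program behind the performance index. -/
theorem le_of_growth_bounds {g c : ℕ → ℝ} {D : ℝ} {N : ℕ} (hg : ∀ k, 2 ≤ k → 1 ≤ g k)
    (hN : 2 ≤ N) (h0 : ∑ j ∈ Finset.Ico 0 N, c j ≤ g N * c 0)
    (hD : ∀ k, 1 ≤ k → k < N → D + ∑ j ∈ Finset.Ico k N, c j ≤ g (N - k + 1) * c k) :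
    D ≤ (1 - perfIndex g N) * c 0 := by
  -- The constraints are eliminated from the last time backwards. With `P`, `Q` the products of `g k
  -- - 1` and of `g k` up to `n`, and `S` the sum of the last `n - 1` costs, the invariant is `(Q -
  -- P) D ≤ P S`. The induction step adds `g (n + 1)` times the invariant to `P` times the
  -- constraint at time `N - n`, whose own cost enters with the factor `g (n + 1) - 1`.
  have key : ∀ n, 1 ≤ n → n ≤ N →
      ((∏ k ∈ Finset.Icc 2 n, g k) - ∏ k ∈ Finset.Icc 2 n, (g k - 1)) * D ≤
        (∏ k ∈ Finset.Icc 2 n, (g k - 1)) * ∑ j ∈ Finset.Ico (N - n + 1) N, c j := by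
    intro n hn
    induction n, hn using Nat.le_induction with
    | base =>
      intro h
      rw [Nat.sub_add_cancel h]
      simp
    | succ n hn ih =>
      intro h
      have ih := ih (by omega)
      have hk := hD (N - n) (by omega) (by omega)
      rw [show N - (N - n) + 1 = n + 1 by omega,
        Finset.sum_eq_sum_Ico_succ_bot (by omega : N - n < N)] at hk
      rw [Finset.prod_Icc_succ_top (by omega), Finset.prod_Icc_succ_top (by omega),
        show N - (n + 1) + 1 = N - n by omega,
        Finset.sum_eq_sum_Ico_succ_bot (by omega : N - n < N)]
      have hP := prod_sub_one_nonneg hg n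
      have h1 := hg (n + 1) (by omega)
      set P := ∏ k ∈ Finset.Icc 2 n, (g k - 1)
      set Q := ∏ k ∈ Finset.Icc 2 n, g k
      set S := ∑ j ∈ Finset.Ico (N - n + 1) N, c j
      have e1 := mul_le_mul_of_nonneg_left hk hP
      have e2 := mul_le_mul_of_nonneg_left ih (by linarith : 0 ≤ g (n + 1))
      nlinarith
  have hN1 := key N (by omega) le_rfl
  rw [Nat.sub_self, zero_add] at hN1
  rw [Finset.sum_eq_sum_Ico_succ_bot (by omega : 0 < N), zero_add] at h0
  have hP := prod_sub_one_nonneg hg N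
  have hQ := prod_sub_one_lt hg hN
  rw [perfIndex, sub_sub_cancel, div_mul_eq_mul_div, le_div_iff₀ (by linarith)]
  have := mul_le_mul_of_nonneg_left h0 hP
  nlinarith

/-! ### The relaxed Lyapunov inequality -/

/-- The growth bound on the states with orientation in `[-π, π]`. -/
def GrowthBound (p : Params) (Θ : Set ℝ) (g : ℕ → ℝ) : Prop :=
  ∀ z ∈ stateSet p Θ, |z 2| ≤ Real.pi → ∀ i, 1 ≤ i →
    value p Θ i z ≤ ENNReal.ofReal (g i * minStageCost p Θ z)

/-- The easy half of dynamic programming: any admissible continuation may be attached to the first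
`j` steps. -/
theorem value_le_cost_add (p : Params) (Θ : Set ℝ) {u : ℕ → Input} {z : State} {j : ℕ} (n : ℕ)
    (hu : Admissible p Θ j z u) :
    value p Θ (j + n) z ≤ ENNReal.ofReal (cost p j z u) + value p Θ n (traj p u z j) := by
  conv_rhs => rw [value]
  simp only [ENNReal.add_iInf]
  refine le_iInf₂ fun v hv => ?_
  set w : ℕ → Input := fun k => if k < j then u k else v (k - j) with hw
  have hwu : ∀ k < j, u k = w k := fun k hk => by simp [w, hk]
  have hwv : (fun k => w (j + k)) = v := by
    funext k
    simp [w]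
  have htr : ∀ k, traj p w z (j + k) = traj p v (traj p u z j) k := fun k => by
    rw [traj_add, hwv, traj_congr z hwu]
  have hw' : Admissible p Θ (j + n) z w := by
    refine ⟨fun k hk => ?_, fun k hk => ?_⟩
    · by_cases h : k < j
      · simpa [w, h] using hu.1 k h
      · simpa [w, h] using hv.1 (k - j) (by omega)
    · rcases le_total k j with h | h
      · rw [← traj_congr z fun i hi => hwu i (by omega)]
        exact hu.2 k h
      · obtain ⟨i, rfl⟩ := Nat.exists_eq_add_of_le h
        rw [htr]
        exact hv.2 i (by omega)
  refine (value_le_cost hw').trans_eq ?_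
  rw [← ENNReal.ofReal_add (cost_nonneg _ _ _ _) (cost_nonneg _ _ _ _), cost,
    Finset.sum_range_add]
  congr 2
  · exact (cost_congr z hwu).symm
  · refine Finset.sum_congr rfl fun k _ => ?_
    rw [htr]
    congr 1
    exact congrFun hwv k

/-- With `c k` the stage costs of the optimal sequence and `D` the excess of the value at the
successor over the sum of `c 1, …, c (N - 1)`, the growth bounds at the states visited are precisely
the constraints of `le_of_growth_bounds`. -/
theorem value_step_add_le {p : Params} {Θ : Set ℝ} {g : ℕ → ℝ} (hG : GrowthBound p Θ g)
    (hg : ∀ k, 1 ≤ k → 1 ≤ g k) {N : ℕ} (hN : 2 ≤ N) (hα : 0 < perfIndex g N) {z : State}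
    {u : ℕ → Input} (hu : Admissible p Θ N z u)
    (hopt : ENNReal.ofReal (cost p N z u) = value p Θ N z)
    (hθ : ∀ k < N, |traj p u z k 2| ≤ Real.pi) :
    value p Θ N (step p z (u 0)) + ENNReal.ofReal (perfIndex g N * stageCost p z (u 0))
      ≤ value p Θ N z := by
  set c : ℕ → ℝ := fun k => stageCost p (traj p u z k) (u k) with hc
  have hc0 : ∀ k, 0 ≤ c k := fun k => stageCost_nonneg _ _ _
  have hmin : ∀ k ≤ N, minStageCost p Θ (traj p u z k) ≤ c k := fun k hk => by
    rw [minStageCost_eq (hu.2 k hk)]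
    exact restCost_le_stageCost _ _ _
  have hV : ∀ k < N, ∀ i, 1 ≤ i → value p Θ i (traj p u z k) ≤ ENNReal.ofReal (g i * c k) :=
    fun k hk i hi => (hG _ (hu.2 k hk.le) (hθ k hk) i hi).trans <| ENNReal.ofReal_le_ofReal <|
      mul_le_mul_of_nonneg_left (hmin k hk.le) (by linarith [hg i hi])
  have hsum : ∑ j ∈ Finset.Ico 0 N, c j ≤ g N * c 0 := by
    have := hV 0 (by omega) N (by omega)
    rw [traj, ← hopt, ENNReal.ofReal_le_ofReal_iff
      (mul_nonneg (by linarith [hg N (by omega)]) (hc0 0))] at this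
    simpa [cost] using this
  set ν := (value p Θ N (step p z (u 0))).toReal with hν
  have hfin : value p Θ N (step p z (u 0)) ≠ ⊤ :=
    ne_top_of_le_ne_top ENNReal.ofReal_ne_top (hV 1 (by omega) N (by omega))
  -- From the successor, the optimal controls are kept up to time `k`; the remaining horizon is then
  -- `N - (k - 1) = N - k + 1`, and the growth bound is applied there.
  have hνle : ∀ k, 1 ≤ k → k < N →
      ν ≤ ∑ j ∈ Finset.Ico 1 k, c j + g (N - k + 1) * c k := by
    intro k hk hkN
    have hshift : ∀ n, traj p (fun i => u (i + 1)) (step p z (u 0)) n = traj p u z (n + 1) :=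
      fun n => (traj_one_add p u z n).symm
    have hadm : Admissible p Θ (k - 1) (step p z (u 0)) fun i => u (i + 1) :=
      ⟨fun i hi => hu.1 _ (by omega), fun i hi => hshift i ▸ hu.2 _ (by omega)⟩
    have h1 := value_le_cost_add p Θ (N - k + 1) hadm
    rw [show k - 1 + (N - k + 1) = N by omega, hshift, Nat.sub_add_cancel hk] at h1
    have h2 := h1.trans (add_le_add_right (hV k hkN (N - k + 1) (by omega)) _)
    have hgc : 0 ≤ g (N - k + 1) * c k :=
      mul_nonneg (by linarith [hg (N - k + 1) (by omega)]) (hc0 k)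
    rw [← ENNReal.ofReal_add (cost_nonneg _ _ _ _) hgc] at h2
    have h3 := ENNReal.toReal_le_of_le_ofReal (add_nonneg (cost_nonneg _ _ _ _) hgc) h2
    refine h3.trans_eq ?_
    congr 1
    rw [cost, Finset.sum_Ico_eq_sum_range]
    refine Finset.sum_congr rfl fun i _ => ?_
    rw [hshift, Nat.add_comm 1]
  have hD : ν - ∑ j ∈ Finset.Ico 1 N, c j ≤ (1 - perfIndex g N) * c 0 := by
    refine le_of_growth_bounds (fun k hk => hg k (by omega)) hN hsum fun k hk hkN => ?_
    have h1 := hνle k hk hkN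
    have h2 := Finset.sum_Ico_consecutive c hk hkN.le
    linarith
  have hcN : cost p N z u = c 0 + ∑ j ∈ Finset.Ico 1 N, c j := by
    have : cost p N z u = ∑ j ∈ Finset.Ico 0 N, c j := by simp [cost, hc]
    rw [this, Finset.sum_eq_sum_Ico_succ_bot (by omega : 0 < N)]
  rw [← hopt, ← ENNReal.ofReal_toReal hfin, ← ENNReal.ofReal_add ENNReal.toReal_nonneg
    (mul_nonneg hα.le (stageCost_nonneg _ _ _)), hcN]
  refine ENNReal.ofReal_le_ofReal ?_
  change ν + perfIndex g N * c 0 ≤ _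
  linarith

/-! ### Asymptotic stability -/

theorem isClassKInf_root {a : ℝ≥0} (ha : 0 < a) :
    IsClassKInf fun r => NNReal.sqrt (NNReal.sqrt (a * (r ^ 4 + r ^ 2))) := by
  obtain ⟨h1, h2, h3, h4⟩ := isClassKInf_quartic_add_sq ha
  have hs : Tendsto NNReal.sqrt atTop atTop := NNReal.sqrt.tendsto_atTop
  refine ⟨by fun_prop, fun x y h => ?_, by simp, hs.comp (hs.comp h4)⟩
  exact NNReal.sqrt_lt_sqrt.2 (NNReal.sqrt_lt_sqrt.2 (h2 h))

theorem le_root {a b : ℝ≥0} (h : a ^ 4 ≤ b) : a ≤ NNReal.sqrt (NNReal.sqrt b) := by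
  rw [NNReal.le_sqrt_iff_sq_le, NNReal.le_sqrt_iff_sq_le, ← pow_mul]
  exact h

/-- The value function lies between `ℓ*` and `G ℓ*`, so a decrease by `α ℓ*` is a contraction by `1
- α / G`. Bounding `ℓ*` below by a multiple of the fourth power of the norm, and above by one of `r⁴
+ r²`, makes `β` a fourth root. -/
theorem asymptoticallyStableOn_of_decay {p : Params} {Θ : Set ℝ} {μ : State → Input}
    {S : Set State} {N : ℕ} {α G : ℝ} (hα : 0 < α) (hαG : α ≤ G) (hSX : S ⊆ stateSet p Θ)
    (hinv : ∀ z ∈ S, step p z (μ z) ∈ S) (hμ : ∀ z ∈ S, μ z ∈ inputSet p)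
    (hup : ∀ z ∈ S, value p Θ N z ≤ ENNReal.ofReal (G * minStageCost p Θ z))
    (hlow : ∀ z ∈ S, ENNReal.ofReal (minStageCost p Θ z) ≤ value p Θ N z)
    (hrel : RelaxedLyapunovOn p Θ N α μ S) : AsymptoticallyStableOn p μ S := by
  have hG : 0 < G := hα.trans_le hαG
  -- The maximum keeps the rate positive when `α = G`; a zero rate would destroy strict monotonicity
  -- of `β` in both arguments.
  set ρ : ℝ := max (1 - α / G) (1 / 2) with hρ
  have hρ0 : 0 < ρ := lt_max_of_lt_right (by norm_num)
  have hρ1 : ρ < 1 := max_lt (by linarith [div_pos hα hG]) (by norm_num)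
  set V : State → ℝ := fun z => (value p Θ N z).toReal with hV
  have hfin : ∀ z ∈ S, value p Θ N z ≠ ⊤ := fun z hz =>
    ne_top_of_le_ne_top ENNReal.ofReal_ne_top (hup z hz)
  have hm : ∀ z ∈ S, 0 ≤ minStageCost p Θ z := fun z hz => by
    rw [minStageCost_eq (hSX hz)]
    exact restCost_nonneg _ _
  have hupV : ∀ z ∈ S, V z ≤ G * minStageCost p Θ z := fun z hz =>
    ENNReal.toReal_le_of_le_ofReal (mul_nonneg hG.le (hm z hz)) (hup z hz)
  have hlowV : ∀ z ∈ S, minStageCost p Θ z ≤ V z := fun z hz =>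
    (ENNReal.ofReal_le_iff_le_toReal (hfin z hz)).1 (hlow z hz)
  have hdec : ∀ z ∈ S, V (step p z (μ z)) ≤ ρ * V z := by
    intro z hz
    have h := hrel z hz
    have h' := ENNReal.toReal_mono (hfin z hz) h
    rw [ENNReal.toReal_add (hfin _ (hinv z hz)) ENNReal.ofReal_ne_top,
      ENNReal.toReal_ofReal (mul_nonneg hα.le (stageCost_nonneg _ _ _))] at h'
    have h1 : minStageCost p Θ z ≤ stageCost p z (μ z) := by
      rw [minStageCost_eq (hSX hz)]
      exact restCost_le_stageCost _ _ _
    have h2 : α / G * V z ≤ α * stageCost p z (μ z) := by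
      calc α / G * V z ≤ α / G * (G * minStageCost p Θ z) := by
            gcongr
            exact hupV z hz
        _ = α * minStageCost p Θ z := by field_simp
        _ ≤ _ := by gcongr
    have h3 : (1 - α / G) * V z ≤ ρ * V z := by
      have : 0 ≤ V z := ENNReal.toReal_nonneg
      gcongr
      exact le_max_left _ _
    change V (step p z (μ z)) + _ ≤ V z at h'
    linarith
  set ρn : ℝ≥0 := ⟨ρ, hρ0.le⟩
  have hρn0 : 0 < ρn := hρ0
  set Gn : ℝ≥0 := ⟨G, hG.le⟩
  have hGn : 0 < Gn := hG
  set K : ℝ≥0 := Gn * upFactor p / lowFactor p with hK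
  have hK0 : 0 < K := div_pos (mul_pos hGn (upFactor_pos p)) (lowFactor_pos p)
  refine ⟨fun r n => NNReal.sqrt (NNReal.sqrt (ρn ^ n * K * (r ^ 4 + r ^ 2))),
    ⟨fun n => isClassKInf_root (mul_pos (pow_pos hρn0 n) hK0), fun r hr => ⟨?_, ?_⟩⟩, ?_⟩
  · intro a b hab
    refine NNReal.sqrt_lt_sqrt.2 (NNReal.sqrt_lt_sqrt.2 ?_)
    have h : ρn ^ b < ρn ^ a := pow_lt_pow_right_of_lt_one₀ hρn0 hρ1 hab
    have hr' : 0 < r ^ 4 + r ^ 2 := by positivity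
    exact mul_lt_mul_of_pos_right (mul_lt_mul_of_pos_right h hK0) hr'
  · have h1 : Tendsto (fun n : ℕ => ρn ^ n * K * (r ^ 4 + r ^ 2)) atTop (𝓝 (0 * K * (r ^ 4 + r ^ 2))) :=
      ((NNReal.tendsto_pow_atTop_nhds_zero_of_lt_one hρ1).mul_const K).mul_const _
    have h2 : Continuous fun x : ℝ≥0 => NNReal.sqrt (NNReal.sqrt x) := by fun_prop
    have h3 := (h2.tendsto _).comp h1
    simp only [zero_mul, NNReal.sqrt_zero] at h3
    exact h3
  · intro z hz n
    have hS : ∀ n, closedLoop p μ z n ∈ S := fun n => by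
      induction n with
      | zero => exact hz
      | succ n ih => exact hinv _ ih
    have hVn : V (closedLoop p μ z n) ≤ ρ ^ n * V z := by
      induction n with
      | zero => simp [closedLoop]
      | succ n ih =>
        calc _ ≤ ρ * V (closedLoop p μ z n) := hdec _ (hS n)
          _ ≤ ρ * (ρ ^ n * V z) := by gcongr
          _ = _ := by ring
    refine ⟨hS n, hμ _ (hS n), le_root ?_⟩
    have h1 := (le_restCost (hSX (hS n))).trans_eq (minStageCost_eq (hSX (hS n))).symm
    have h2 : ρ ^ n * V z ≤ ρ ^ n * (G * (upFactor p * (‖z‖ ^ 4 + ‖z‖ ^ 2))) := by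
      gcongr
      refine (hupV z hz).trans ?_
      gcongr
      rw [minStageCost_eq (hSX hz)]
      exact restCost_le p z
    have h3 := h1.trans ((hlowV _ (hS n)).trans (hVn.trans h2))
    have h4 : lowFactor p * ‖closedLoop p μ z n‖₊ ^ 4 ≤
        ρn ^ n * (Gn * (upFactor p * (‖z‖₊ ^ 4 + ‖z‖₊ ^ 2))) := by
      rw [← NNReal.coe_le_coe]
      push_cast
      exact h3
    have h5 : ρn ^ n * K * (‖z‖₊ ^ 4 + ‖z‖₊ ^ 2) =
        ρn ^ n * (Gn * (upFactor p * (‖z‖₊ ^ 4 + ‖z‖₊ ^ 2))) / lowFactor p := by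
      rw [hK]
      ring
    rw [h5, le_div_iff₀ (lowFactor_pos p), mul_comm]
    exact h4

theorem stageCost_le_cost (p : Params) (z : State) (u : ℕ → Input) {N k : ℕ} (hk : k < N) :
    stageCost p (traj p u z k) (u k) ≤ cost p N z u :=
  Finset.single_le_sum (f := fun k => stageCost p (traj p u z k) (u k))
    (fun _ _ => stageCost_nonneg _ _ _) (Finset.mem_range.2 hk)

theorem minStageCost_le_value {p : Params} {Θ : Set ℝ} {N : ℕ} (hN : 1 ≤ N) {z : State}
    (hz : z ∈ stateSet p Θ) : ENNReal.ofReal (minStageCost p Θ z) ≤ value p Θ N z := by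
  rw [value, minStageCost_eq hz]
  refine le_iInf₂ fun u _ => ENNReal.ofReal_le_ofReal ?_
  have h := stageCost_le_cost p z u (Nat.lt_of_succ_le hN)
  rw [traj] at h
  exact (restCost_le_stageCost p z (u 0)).trans h

/-- The set `S` has to provide two things: orientations in `[-π, π]` along optimal trajectories,
where the growth bound is available, and closedness under a decrease of the value, which gives
invariance through the relaxed Lyapunov inequality itself. -/
theorem stable_of_growthBound {p : Params} {Θ : Set ℝ} {g : ℕ → ℝ} (hG : GrowthBound p Θ g)
    (hg : ∀ k, 1 ≤ k → 1 ≤ g k) {N : ℕ} (hN : 2 ≤ N) (hα : 0 < perfIndex g N)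
    {μ : State → Input} (hμ : IsMPCFeedback p Θ N μ) {S : Set State} (hSX : S ⊆ stateSet p Θ)
    (hθ : ∀ z ∈ S, ∀ u, Admissible p Θ N z u → ENNReal.ofReal (cost p N z u) = value p Θ N z →
      ∀ k < N, |traj p u z k 2| ≤ Real.pi)
    (hS : ∀ z ∈ S, ∀ z' ∈ stateSet p Θ, value p Θ N z' ≤ value p Θ N z → z' ∈ S) :
    RelaxedLyapunovOn p Θ N (perfIndex g N) μ S ∧ AsymptoticallyStableOn p μ S := by
  have hrel : RelaxedLyapunovOn p Θ N (perfIndex g N) μ S := fun z hz => by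
    obtain ⟨u, hu, hopt, h0⟩ := hμ z (hSX hz)
    rw [h0]
    exact value_step_add_le hG hg hN hα hu hopt (hθ z hz u hu hopt)
  refine ⟨hrel, asymptoticallyStableOn_of_decay (N := N) (G := g N) hα
    ((perfIndex_le_one (fun k hk => hg k (by omega)) hN).trans (hg N (by omega))) hSX
    (fun z hz => ?_) (fun z hz => ?_) (fun z hz => ?_)
    (fun z hz => minStageCost_le_value (by omega) (hSX hz)) hrel⟩
  · obtain ⟨u, hu, hopt, h0⟩ := hμ z (hSX hz)
    exact hS z hz _ (h0 ▸ hu.2 1 (by omega)) (le_self_add.trans (hrel z hz))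
  · obtain ⟨u, hu, -, h0⟩ := hμ z (hSX hz)
    exact h0 ▸ hu.1 0 (by omega)
  · obtain ⟨u, hu, hopt, -⟩ := hμ z (hSX hz)
    exact hG z (hSX hz) (hθ z hz u hu hopt 0 (by omega)) N (by omega)

theorem stable_Icc {p : Params} {g : ℕ → ℝ}
    (hG : GrowthBound p (Set.Icc (-Real.pi) Real.pi) g) (hg : ∀ k, 1 ≤ k → 1 ≤ g k) {N : ℕ}
    (hN : 2 ≤ N) (hα : 0 < perfIndex g N) {μ : State → Input}
    (hμ : IsMPCFeedback p (Set.Icc (-Real.pi) Real.pi) N μ) :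
    RelaxedLyapunovOn p (Set.Icc (-Real.pi) Real.pi) N (perfIndex g N) μ
        (stateSet p (Set.Icc (-Real.pi) Real.pi)) ∧
      AsymptoticallyStableOn p μ (stateSet p (Set.Icc (-Real.pi) Real.pi)) :=
  stable_of_growthBound hG hg hN hα hμ subset_rfl
    (fun _ _ _ hu _ k hk => abs_le.2 (hu.2 k hk.le).2.2) fun _ _ _ hz' _ => hz'

/-- Each stage cost of an optimal trajectory is at most the value, hence at most `q₃ π⁴`; its
orientation term alone then forces `|θ| ≤ π`. -/
theorem stable_univ {p : Params} {g : ℕ → ℝ} (hG : GrowthBound p Set.univ g)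
    (hg : ∀ k, 1 ≤ k → 1 ≤ g k) {N : ℕ} (hN : 2 ≤ N) (hα : 0 < perfIndex g N)
    {μ : State → Input} (hμ : IsMPCFeedback p Set.univ N μ) :
    RelaxedLyapunovOn p Set.univ N (perfIndex g N) μ
        {z | z ∈ stateSet p Set.univ ∧
          value p Set.univ N z ≤ ENNReal.ofReal (p.q3 * Real.pi ^ 4)} ∧
      AsymptoticallyStableOn p μ
        {z | z ∈ stateSet p Set.univ ∧
          value p Set.univ N z ≤ ENNReal.ofReal (p.q3 * Real.pi ^ 4)} := by
  refine stable_of_growthBound hG hg hN hα hμ (fun z hz => hz.1) (fun z hz u hu hopt k hk => ?_)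
    fun z hz z' hz' h => ⟨hz', h.trans hz.2⟩
  have h1 := hz.2
  have hq3 := p.q3_pos
  rw [← hopt, ENNReal.ofReal_le_ofReal_iff (by positivity)] at h1
  have h2 : stageCost p (traj p u z k) (u k) ≤ cost p N z u :=
    stageCost_le_cost p z u hk
  have h3 := (restCost_le_stageCost p (traj p u z k) (u k)).trans (h2.trans h1)
  have h4 : p.q3 * traj p u z k 2 ^ 4 ≤ p.q3 * Real.pi ^ 4 := by
    refine le_trans ?_ h3
    have := p.q1_pos; have := p.q2_pos
    unfold restCost
    have : 0 ≤ p.q1 * traj p u z k 0 ^ 4 + p.q2 * traj p u z k 1 ^ 2 := by positivity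
    linarith
  have h5 := le_of_mul_le_mul_left h4 hq3
  rw [← Even.pow_abs (by decide : Even 4)] at h5
  exact le_of_pow_le_pow_left₀ (by norm_num) Real.pi_pos.le h5

/-! ### Maneuvers -/

/-- There are controls that steer `z` to `z'` in `L` steps, with orientations in `[-π, π]` and with
stage costs bounded by `b`. -/
def Maneuver (p : Params) (z z' : State) (L : ℕ) (b : ℕ → ℝ) : Prop :=
  ∃ u : ℕ → Input, Admissible p (Set.Icc (-Real.pi) Real.pi) L z u ∧ traj p u z L = z' ∧
    ∀ n < L, stageCost p (traj p u z n) (u n) ≤ b n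

theorem Maneuver.mono {p : Params} {z z' : State} {L : ℕ} {b b' : ℕ → ℝ}
    (h : Maneuver p z z' L b) (hb : ∀ n < L, b n ≤ b' n) : Maneuver p z z' L b' := by
  obtain ⟨u, hu, hL, hc⟩ := h
  exact ⟨u, hu, hL, fun n hn => (hc n hn).trans (hb n hn)⟩

theorem Maneuver.append {p : Params} {z z' z'' : State} {L L' : ℕ} {b : ℕ → ℝ}
    (h : Maneuver p z z' L b) (h' : Maneuver p z' z'' L' fun n => b (L + n)) :
    Maneuver p z z'' (L + L') b := by
  obtain ⟨u, hu, rfl, hb⟩ := h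
  obtain ⟨v, hv, rfl, hb'⟩ := h'
  set w : ℕ → Input := fun k => if k < L then u k else v (k - L) with hw
  have hwu : ∀ k < L, u k = w k := fun k hk => by simp [w, hk]
  have hwv : ∀ k, w (L + k) = v k := fun k => by simp [w]
  have htr : ∀ k, traj p w z (L + k) = traj p v (traj p u z L) k := fun k => by
    rw [traj_add, traj_congr z hwu]
    simp only [hwv]
  refine ⟨w, ⟨fun k hk => ?_, fun k hk => ?_⟩, htr L', fun k hk => ?_⟩
  · rcases lt_or_ge k L with h | h
    · exact hwu k h ▸ hu.1 k h
    · obtain ⟨i, rfl⟩ := Nat.exists_eq_add_of_le h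
      exact hwv i ▸ hv.1 i (by omega)
  · rcases le_total k L with h | h
    · rw [← traj_congr z fun i hi => hwu i (by omega)]
      exact hu.2 k h
    · obtain ⟨i, rfl⟩ := Nat.exists_eq_add_of_le h
      exact htr i ▸ hv.2 i (by omega)
  · rcases lt_or_ge k L with h | h
    · rw [← traj_congr z fun i hi => hwu i (by omega), ← hwu k h]
      exact hb k h
    · obtain ⟨i, rfl⟩ := Nat.exists_eq_add_of_le h
      rw [htr, hwv]
      exact hb' i (by omega)

theorem Maneuver.of_path {p : Params} {X : ℕ → State} {u : ℕ → Input} {L : ℕ} {b : ℕ → ℝ}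
    (hX : ∀ n < L, step p (X n) (u n) = X (n + 1)) (hu : ∀ n < L, u n ∈ inputSet p)
    (hS : ∀ n ≤ L, X n ∈ stateSet p (Set.Icc (-Real.pi) Real.pi))
    (hb : ∀ n < L, stageCost p (X n) (u n) ≤ b n) : Maneuver p (X 0) (X L) L b :=
  ⟨u, ⟨hu, fun _ hn => traj_eq hX hn ▸ hS _ hn⟩, traj_eq hX le_rfl,
    fun n hn => traj_eq hX hn.le ▸ hb n hn⟩

/-- Having arrived at the origin, the system rests there at zero cost. -/
theorem Maneuver.exists_admissibleInf {p : Params} {z : State} {L : ℕ} {b : ℕ → ℝ}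
    (h : Maneuver p z !₂[0, 0, 0] L b) (hb : ∀ n, L ≤ n → 0 ≤ b n) {Θ : Set ℝ}
    (hΘ : Set.Icc (-Real.pi) Real.pi ⊆ Θ) :
    ∃ u : ℕ → Input, AdmissibleInf p Θ z u ∧ ∀ n, stageCost p (traj p u z n) (u n) ≤ b n := by
  have hz0 : (!₂[0, 0, 0] : State) ∈ stateSet p (Set.Icc (-Real.pi) Real.pi) := by
    simp [stateSet, p.xbar_pos.le, p.ybar_pos.le, Real.pi_pos.le]
  obtain ⟨u, hu, hL, hc⟩ := h
  set w : ℕ → Input := fun k => if k < L then u k else (0, 0) with hw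
  have hwu : ∀ k < L, u k = w k := fun k hk => by simp [w, hk]
  have hw0 : ∀ k, w (L + k) = (0, 0) := fun k => by simp [w]
  have htr : ∀ k, traj p w z (L + k) = !₂[0, 0, 0] := fun k => by
    rw [traj_add, ← traj_congr z hwu, hL]
    simp only [hw0]
    exact traj_rest p _ k
  refine ⟨w, fun N _ => ⟨fun k _ => ?_, fun k _ => ?_⟩, fun k => ?_⟩
  · rcases lt_or_ge k L with h | h
    · exact hwu k h ▸ hu.1 k h
    · obtain ⟨i, rfl⟩ := Nat.exists_eq_add_of_le h
      exact hw0 i ▸ zero_mem_inputSet p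
  · refine stateSet_mono p hΘ ?_
    rcases le_total k L with h | h
    · rw [← traj_congr z fun i hi => hwu i (by omega)]
      exact hu.2 k h
    · obtain ⟨i, rfl⟩ := Nat.exists_eq_add_of_le h
      exact htr i ▸ hz0
  · rcases lt_or_ge k L with h | h
    · rw [← traj_congr z fun i hi => hwu i (by omega), ← hwu k h]
      exact hc k h
    · obtain ⟨i, rfl⟩ := Nat.exists_eq_add_of_le h
      rw [htr, hw0, stageCost_rest]
      simpa [restCost] using hb _ h

/-- Reflection at the `x`-axis. -/
def reflect (z : State) : State := !₂[z 0, -z 1, -z 2]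

theorem reflect_reflect (z : State) : reflect (reflect z) = z :=
  state_ext (by simp [reflect]) (by simp [reflect]) (by simp [reflect])

/-- This symmetry reduces the curved maneuver to `y > 0`. -/
theorem step_reflect (p : Params) (z : State) (u : Input) :
    step p (reflect z) (u.1, -u.2) = reflect (step p z u) := by
  have e1 : p.δ * -u.2 / 2 = -(p.δ * u.2 / 2) := by ring
  have e2 : -z 2 + -(p.δ * u.2 / 2) = -(z 2 + p.δ * u.2 / 2) := by ring
  refine state_ext ?_ ?_ ?_
  · simp only [reflect, step_zero, Matrix.cons_val, e1, e2, Real.sinc_neg, Real.cos_neg]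
  · simp only [reflect, step_one, Matrix.cons_val, e1, e2, Real.sinc_neg, Real.sin_neg]
    ring
  · simp [reflect, step_two]
    ring

theorem Maneuver.of_reflect {p : Params} {z z' : State} {L : ℕ} {b : ℕ → ℝ}
    (h : Maneuver p (reflect z) (reflect z') L b) : Maneuver p z z' L b := by
  obtain ⟨u, hu, hL, hc⟩ := h
  set w : ℕ → Input := fun k => ((u k).1, -(u k).2) with hw
  have htr : ∀ n, traj p w z n = reflect (traj p u (reflect z) n) := fun n => by
    induction n with
    | zero => exact (reflect_reflect z).symm
    | succ n ih => rw [traj, traj, ih, ← step_reflect]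
  refine ⟨w, ⟨fun k hk => ?_, fun k hk => ?_⟩, ?_, fun k hk => ?_⟩
  · simpa [inputSet, w] using hu.1 k hk
  · rw [htr]
    obtain ⟨h0, h1, h2⟩ := hu.2 k hk
    refine ⟨by simpa [reflect] using h0, by simpa [reflect] using h1, ?_⟩
    simp only [reflect, mem_Icc, Matrix.cons_val] at h2 ⊢
    constructor <;> linarith [h2.1, h2.2]
  · rw [htr, hL, reflect_reflect]
  · rw [htr]
    refine le_trans (le_of_eq ?_) (hc k hk)
    simp [stageCost, reflect, w, Even.neg_pow (by decide : Even 4)]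

/-! ### Elementary maneuvers -/

theorem maneuver_turn {p : Params} {x y : ℝ} {a : ℕ → ℝ} {L : ℕ} {b : ℕ → ℝ}
    (hx : |x| ≤ p.xbar) (hy : |y| ≤ p.ybar) (ha : ∀ n ≤ L, |a n| ≤ Real.pi)
    (hω : ∀ n < L, |a (n + 1) - a n| ≤ p.wbar * p.δ)
    (hb : ∀ n < L, p.q1 * x ^ 4 + p.q2 * y ^ 2 + p.q3 * a n ^ 4
      + p.r2 * ((a (n + 1) - a n) / p.δ) ^ 4 ≤ b n) :
    Maneuver p !₂[x, y, a 0] !₂[x, y, a L] L b := by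
  have hδ := p.δ_pos
  refine Maneuver.of_path (X := fun n => !₂[x, y, a n])
    (u := fun n => (0, (a (n + 1) - a n) / p.δ)) (fun n _ => ?_) (fun n hn => ?_)
    (fun n hn => ?_) (fun n hn => ?_)
  · refine state_ext ?_ ?_ ?_
    · simp [step_zero]
    · simp [step_one]
    · simp only [step_two, Matrix.cons_val]
      field_simp
      ring
  · refine ⟨by simpa using p.vbar_pos.le, ?_⟩
    simp only [abs_div, abs_of_pos hδ]
    exact (div_le_iff₀ hδ).2 (hω n hn)
  · exact ⟨by simpa using hx, by simpa using hy, by simpa [abs_le] using ha n hn⟩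
  · refine le_trans (le_of_eq ?_) (hb n hn)
    simp [stageCost]

/-- The radius `r` is signed and the speed is `-r / (l δ)`, so one statement covers driving forwards
and backwards. The positions are convex combinations of the endpoints and therefore stay in the box.
-/
theorem maneuver_drive {p : Params} {x y r ψ : ℝ} {l : ℕ} {b : ℕ → ℝ} (hl : 1 ≤ l)
    (hx : |x| ≤ p.xbar) (hy : |y| ≤ p.ybar) (hx' : |x + r * Real.cos ψ| ≤ p.xbar)
    (hy' : |y + r * Real.sin ψ| ≤ p.ybar) (hψ : |ψ| ≤ Real.pi)
    (hr : |r| ≤ l * (p.vbar * p.δ))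
    (hb : ∀ n < l, p.q1 * (x + ((l : ℝ) - n) / l * (r * Real.cos ψ)) ^ 4
      + p.q2 * (y + ((l : ℝ) - n) / l * (r * Real.sin ψ)) ^ 2 + p.q3 * ψ ^ 4
      + p.r1 * (r / (l * p.δ)) ^ 4 ≤ b n) :
    Maneuver p !₂[x + r * Real.cos ψ, y + r * Real.sin ψ, ψ] !₂[x, y, ψ] l b := by
  have hδ := p.δ_pos
  have hl0 : (0 : ℝ) < l := Nat.cast_pos.2 hl
  have hconv : ∀ {w d B : ℝ}, |w| ≤ B → |w + d| ≤ B → ∀ n ≤ l,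
      |w + ((l : ℝ) - n) / l * d| ≤ B := by
    intro w d B h1 h2 n hn
    have hn' : (n : ℝ) ≤ l := Nat.cast_le.2 hn
    set t := ((l : ℝ) - n) / l with ht
    have ht0 : 0 ≤ t := div_nonneg (by linarith) hl0.le
    have ht1 : t ≤ 1 := (div_le_one hl0).2 (by linarith [(Nat.cast_nonneg n : (0 : ℝ) ≤ n)])
    rw [abs_le] at h1 h2 ⊢
    constructor <;> nlinarith
  have h := Maneuver.of_path (p := p) (L := l) (b := b)
    (X := fun n => !₂[x + ((l : ℝ) - n) / l * (r * Real.cos ψ),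
      y + ((l : ℝ) - n) / l * (r * Real.sin ψ), ψ])
    (u := fun n => (-(r / (l * p.δ)), 0)) (fun n _ => ?_) (fun n hn => ?_)
    (fun n hn => ?_) (fun n hn => ?_)
  · convert h using 2
    · simp [div_self hl0.ne']
    · simp
  · refine state_ext ?_ ?_ ?_
    · simp [step_zero]
      field_simp
      ring
    · simp [step_one]
      field_simp
      ring
    · simp [step_two]
  · refine ⟨?_, by simpa using p.wbar_pos.le⟩
    simp only [abs_neg, abs_div, abs_of_pos (mul_pos hl0 hδ)]
    rw [div_le_iff₀ (mul_pos hl0 hδ)]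
    linarith
  · exact ⟨by simpa using hconv hx hx' n hn, by simpa using hconv hy hy' n hn,
      by simpa [abs_le] using hψ⟩
  · refine le_trans (le_of_eq ?_) (hb n hn)
    simp [stageCost, Even.neg_pow (by decide : Even 4)]

/-- One second on a circle of signed radius `R`: after `m δ = 1` seconds the heading has changed by
exactly `ω`. -/
theorem maneuver_arc {p : Params} {x y θ R ω : ℝ} {b : ℕ → ℝ}
    (hv : |R * ω| ≤ p.vbar) (hω : |ω| ≤ p.wbar)
    (hS : ∀ n ≤ p.m, |x + R * (Real.sin (θ + n * p.δ * ω) - Real.sin θ)| ≤ p.xbar ∧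
      |y + R * (Real.cos θ - Real.cos (θ + n * p.δ * ω))| ≤ p.ybar ∧
      |θ + n * p.δ * ω| ≤ Real.pi)
    (hb : ∀ n < p.m, p.q1 * (x + R * (Real.sin (θ + n * p.δ * ω) - Real.sin θ)) ^ 4
      + p.q2 * (y + R * (Real.cos θ - Real.cos (θ + n * p.δ * ω))) ^ 2
      + p.q3 * (θ + n * p.δ * ω) ^ 4 + p.r1 * (R * ω) ^ 4 + p.r2 * ω ^ 4 ≤ b n) :
    Maneuver p !₂[x, y, θ] !₂[x + R * (Real.sin (θ + ω) - Real.sin θ),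
      y + R * (Real.cos θ - Real.cos (θ + ω)), θ + ω] p.m b := by
  have hδ := p.δ_pos
  have h := Maneuver.of_path (p := p) (L := p.m) (b := b)
    (X := fun n => !₂[x + R * (Real.sin (θ + n * p.δ * ω) - Real.sin θ),
      y + R * (Real.cos θ - Real.cos (θ + n * p.δ * ω)), θ + n * p.δ * ω])
    (u := fun n => (R * ω, ω)) (fun n _ => ?_) (fun n _ => ⟨hv, hω⟩)
    (fun n hn => ?_) (fun n hn => ?_)
  · convert h using 2
    · simp
    · simp [mul_comm (p.m : ℝ), p.δ_mul_m]
  · have e : θ + ((n + 1 : ℕ) : ℝ) * p.δ * ω = θ + n * p.δ * ω + p.δ * ω := by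
      push_cast
      ring
    have h1 := sin_add_sub_sin (θ + n * p.δ * ω) (p.δ * ω)
    have h2 := cos_sub_cos_add (θ + n * p.δ * ω) (p.δ * ω)
    refine state_ext ?_ ?_ ?_
    · simp only [step_zero, e, Matrix.cons_val]
      linear_combination (-R) * h1
    · simp only [step_one, e, Matrix.cons_val]
      linear_combination (-R) * h2
    · simp only [step_two, e, Matrix.cons_val]
  · obtain ⟨h0, h1, h2⟩ := hS n hn
    exact ⟨by simpa using h0, by simpa using h1, by simpa [abs_le] using h2⟩
  · refine le_trans (le_of_eq ?_) (hb n hn)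
    simp [stageCost]

/-! ### Turning -/

/-- An excess of the first stage cost which is compensated by the second one. -/
def excess (E : ℝ) (n : ℕ) : ℝ := if n = 0 then E else if n = 1 then -E else 0

theorem neg_le_excess {E : ℝ} (hE : 0 ≤ E) (n : ℕ) : -E ≤ excess E n := by
  unfold excess
  split_ifs
  · linarith
  · exact le_rfl
  · linarith

theorem sum_excess (E : ℝ) {i : ℕ} (hi : 2 ≤ i) : ∑ n ∈ Finset.range i, excess E n = 0 := by
  induction i, hi using Nat.le_induction with
  | base => simp [Finset.sum_range_succ, excess]
  | succ n hn ih =>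
    rw [Finset.sum_range_succ, ih, excess, if_neg (by omega), if_neg (by omega), add_zero]

/-- Angles that decrease in modulus fast enough, in `k` steps, to pay for the angular speed. -/
def Shrinks (k : ℕ) (a : ℕ → ℝ) (e : ℝ) : Prop :=
  0 ≤ e ∧ (∀ n < k, (a (n + 1) - a n) ^ 4 * (k : ℝ) ^ 3 ≤ e) ∧
    ∀ n, 1 ≤ n → n ≤ k → a n ^ 4 ≤ a 0 ^ 4 - e

theorem shrinks_const (k : ℕ) (θ : ℝ) : Shrinks k (fun _ => θ) 0 := by
  refine ⟨le_rfl, fun n _ => by simp, fun n _ _ => by simp⟩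

theorem Shrinks.neg {k : ℕ} {a : ℕ → ℝ} {e : ℝ} (h : Shrinks k a e) :
    Shrinks k (fun n => -a n) e := by
  refine ⟨h.1, fun n hn => ?_, fun n h1 h2 => ?_⟩
  · have := h.2.1 n hn
    rwa [show -a (n + 1) - -a n = -(a (n + 1) - a n) by ring,
      Even.neg_pow (by decide : Even 4)]
  · simpa [Even.neg_pow (by decide : Even 4)] using h.2.2 n h1 h2

theorem Shrinks.congr {k : ℕ} {a a' : ℕ → ℝ} {e : ℝ} (h : Shrinks k a e)
    (ha : ∀ n ≤ k, a n = a' n) : Shrinks k a' e := by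
  refine ⟨h.1, fun n hn => ?_, fun n h1 h2 => ?_⟩
  · rw [← ha n hn.le, ← ha (n + 1) hn]
    exact h.2.1 n hn
  · rw [← ha n h2, ← ha 0 (Nat.zero_le k)]
    exact h.2.2 n h1 h2

/-- For angles `A` in `[0, θ]` one has `A⁴ ≤ θ³ A`, so interpolation makes the fourth power drop by
`θ³ (θ - θ') / k` already in the first step. The increments contribute `(θ - θ')⁴ / k`, which is no
larger. -/
theorem shrinks_linear {k : ℕ} (hk : 1 ≤ k) {θ θ' : ℝ} (h0 : 0 ≤ θ') (h1 : θ' ≤ θ) :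
    Shrinks k (fun n => θ + (θ' - θ) * (n / k)) (θ ^ 3 * (θ - θ') / k) := by
  have hk0 : (1 : ℝ) ≤ k := Nat.one_le_cast.2 hk
  have hd : 0 ≤ θ - θ' := by linarith
  have hθ : 0 ≤ θ := by linarith
  refine ⟨by positivity, fun n _ => ?_, fun n hn hnk => ?_⟩
  · have : (θ - θ') ^ 3 ≤ θ ^ 3 := by gcongr; linarith
    calc _ = (θ - θ') ^ 3 * (θ - θ') / k := by
          push_cast
          field_simp
          ring
      _ ≤ _ := by gcongr
  · have hn' : (n : ℝ) ≤ k := Nat.cast_le.2 hnk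
    have hn1 : (1 : ℝ) ≤ n := Nat.one_le_cast.2 hn
    set t : ℝ := n / k with ht
    have ht1 : t ≤ 1 := (div_le_one (by linarith)).2 hn'
    have htk : 1 / k ≤ t := by
      rw [ht]
      gcongr
    have hA0 : 0 ≤ θ + (θ' - θ) * t := by nlinarith
    have ht0 : 0 ≤ t := le_trans (by positivity) htk
    have hA1 : θ + (θ' - θ) * t ≤ θ := by nlinarith
    have hA3 : (θ + (θ' - θ) * t) ^ 3 ≤ θ ^ 3 := by gcongr
    simp only [Nat.cast_zero, zero_div, mul_zero, add_zero]
    calc (θ + (θ' - θ) * t) ^ 4 = (θ + (θ' - θ) * t) ^ 3 * (θ + (θ' - θ) * t) := by ring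
      _ ≤ θ ^ 3 * (θ + (θ' - θ) * t) := by gcongr
      _ = θ ^ 4 - θ ^ 3 * (θ - θ') * t := by ring
      _ ≤ θ ^ 4 - θ ^ 3 * (θ - θ') * (1 / k) := by gcongr
      _ = _ := by ring

theorem turn_input_le {p : Params} (hr2 : p.r2 ≤ p.q3 * p.δ / 2) (d : ℝ) :
    p.r2 * (d / p.δ) ^ 4 ≤ p.q3 * (d ^ 4 * (1 / (2 * p.δ ^ 3))) := by
  have hδ := p.δ_pos
  have hd : 0 ≤ (d / p.δ) ^ 4 := by positivity
  calc p.r2 * (d / p.δ) ^ 4 ≤ p.q3 * p.δ / 2 * (d / p.δ) ^ 4 := by gcongr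
    _ = _ := by field_simp

/-- Because `r₂ ≤ q₃ δ / 2` and `k δ ≥ 1`, the angular speed costs at most `q₃ e / 2` per step, half
of what the angle saves from step one on. Only step zero exceeds the initial cost, and step one has
the same amount to spare. -/
theorem Shrinks.turn_cost_le {p : Params} (hr2 : p.r2 ≤ p.q3 * p.δ / 2) {k : ℕ}
    (hk : 1 ≤ k * p.δ) {a : ℕ → ℝ} {e : ℝ} (h : Shrinks k a e) {n : ℕ} (hn : n < k) :
    p.q3 * a n ^ 4 + p.r2 * ((a (n + 1) - a n) / p.δ) ^ 4 ≤
      p.q3 * a 0 ^ 4 + excess (p.q3 * e / 2) n := by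
  have hδ := p.δ_pos
  have hq3 := p.q3_pos
  have h1 := turn_input_le hr2 (a (n + 1) - a n)
  have h2 : 1 / (2 * p.δ ^ 3) ≤ (k : ℝ) ^ 3 / 2 := by
    rw [div_le_div_iff₀ (by positivity) (by norm_num)]
    have : 1 ≤ (k * p.δ) ^ 3 := one_le_pow₀ hk
    nlinarith
  have h3 : p.q3 * ((a (n + 1) - a n) ^ 4 * (1 / (2 * p.δ ^ 3))) ≤ p.q3 * (e / 2) := by
    gcongr
    have h4 := h.2.1 n hn
    have : 0 ≤ (a (n + 1) - a n) ^ 4 := by positivity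
    nlinarith
  rcases Nat.eq_zero_or_pos n with rfl | hn0
  · simp only [excess, if_true]
    linarith
  · have h4 := h.2.2 n hn0 hn.le
    have h5 := neg_le_excess (E := p.q3 * e / 2) (by have := h.1; positivity) n
    have := mul_le_mul_of_nonneg_left h4 hq3.le
    linarith

/-! ### Value functions from maneuvers -/

/-- The excess cancels in sums over at least two steps; horizon one, where it would remain, is
settled by resting since `c 0 = 1`. -/
theorem value_le_accumulated {p : Params} {Θ : Set ℝ} {z : State} (hz : z ∈ stateSet p Θ)
    {c : ℕ → ℝ} {L : ℕ} (hc : ∀ n, 0 ≤ c n) (hL : ∀ n, L ≤ n → c n = 0) (hc0 : c 0 = 1)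
    {σ : ℕ → ℕ} (hσ : Function.Injective σ) (hσ0 : σ 0 = 0) {E : ℝ} {u : ℕ → Input}
    (hu : AdmissibleInf p Θ z u)
    (hb : ∀ n, stageCost p (traj p u z n) (u n) ≤ c (σ n) * restCost p z + excess E n)
    {i : ℕ} (hi : 1 ≤ i) :
    value p Θ i z ≤ ENNReal.ofReal (accumulated c L i * minStageCost p Θ z) := by
  rcases hi.eq_or_lt with rfl | hi2
  · rw [accumulated_one, hc0]
    simpa using value_le_rest hz 1
  · refine (value_le_cost (hu i hi)).trans (ENNReal.ofReal_le_ofReal ?_)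
    rw [minStageCost_eq hz]
    calc cost p i z u ≤ ∑ n ∈ Finset.range i, (c (σ n) * restCost p z + excess E n) :=
          Finset.sum_le_sum fun n _ => hb n
      _ = (∑ n ∈ Finset.range i, c (σ n)) * restCost p z := by
          rw [Finset.sum_add_distrib, sum_excess E hi2, add_zero, Finset.sum_mul]
      _ ≤ _ := by
          gcongr
          · exact restCost_nonneg p z
          · exact sum_le_accumulated hc hL hσ hσ0 i

/-! ### The curved maneuver -/

theorem arctan_le_of_nonneg {t : ℝ} (ht : 0 ≤ t) : Real.arctan t ≤ t := by
  rcases ht.eq_or_lt with rfl | h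
  · simp
  · have h1 := Real.lt_tan (Real.arctan_pos.2 h) (Real.arctan_lt_pi_div_two t)
    rw [Real.tan_arctan] at h1
    exact h1.le

/-- The curved maneuver from `(0, y, 0)`: it consists of arcs of angle `a` and radius `R`, which
extend over the length `X` in the direction of `x`. -/
structure CurveData (p : Params) (s y a R X : ℝ) : Prop where
  y_pos : 0 < y
  y_le : y ≤ p.ybar
  a_pos : 0 < a
  a_le : a ≤ Real.pi / 2
  a_le_wbar : a ≤ p.wbar
  R_pos : 0 < R
  speed_le : R * a ≤ p.vbar
  X_eq : R * Real.sin a = X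
  Y_eq : R * (1 - Real.cos a) = y / 4
  X_le : 2 * X ≤ p.xbar
  X_pow_le : X ^ 4 ≤ speedConst p s * y ^ 2
  speed_pow_le : (R * a) ^ 4 ≤ speedConst p s * y ^ 2
  a_pow_le : a ^ 4 ≤ y ^ 2

/-- With `w = √(y + 1)` and `tan a = √y` one has `cos a = 1 / w` and `sin a = √y / w`. The
requirement that an arc descend by `y / 4` determines the radius `w (w + 1) / 4`, and `curveSpeed y`
is radius times angle. -/
theorem exists_curveData {p : Params} {s : ℝ} (hfit : CurveFits p s) {y : ℝ} (hy : 0 < y)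
    (hyb : y ≤ p.ybar) (hys : p.q2 * y ^ 2 < s) : ∃ a R X, CurveData p s y a R X := by
  obtain ⟨h1, h2, h3⟩ := hfit y hy.le hyb hys
  set q := √y with hq
  set w := √(y + 1) with hw
  set a := Real.arctan q with ha
  have hq0 : 0 < q := Real.sqrt_pos.2 hy
  have hqq : q ^ 2 = y := Real.sq_sqrt hy.le
  have hww : w ^ 2 = y + 1 := Real.sq_sqrt (by linarith)
  have hw0 : 0 < w := Real.sqrt_pos.2 (by linarith)
  have hw1 : 1 < w := by nlinarith
  have ha0 : 0 < a := Real.arctan_pos.2 hq0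
  have haq : a ≤ q := arctan_le_of_nonneg hq0.le
  have hcos : Real.cos a = 1 / w := by rw [ha, Real.cos_arctan, hqq, add_comm]
  have hsin : Real.sin a = q / w := by rw [ha, Real.sin_arctan, hqq, add_comm 1 y]
  have hne : 4 - 4 / w ≠ 0 := by
    have : 4 / w < 4 := (div_lt_iff₀ hw0).2 (by linarith)
    linarith
  have hspeed : curveSpeed y = w * (w + 1) / 4 * a := by
    change y * a / (4 - 4 / w) = _
    rw [div_eq_iff hne, show y = w ^ 2 - 1 by linarith]
    field_simp
    ring
  have hX : Real.sin a * curveSpeed y / a = q * (w + 1) / 4 := by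
    rw [hspeed, hsin]
    field_simp
  -- In terms of `w` this is `w² + w ≤ √2 (w² + 1/2)`, a quadratic inequality with negative
  -- discriminant. Its right-hand side has fourth power `y² (y + 3/2)⁴ / 64`, the form of
  -- `speedConst`.
  have hbound : q * (w * (w + 1) / 4) ≤ q * ((y + 3 / 2) / (2 * √2)) := by
    have hr : √2 ^ 2 = 2 := Real.sq_sqrt (by norm_num)
    have hr0 : 0 < √2 := by positivity
    have hr1 : 1.41 < √2 := Real.lt_sqrt_of_sq_lt (by norm_num)
    have hr2 : √2 < 1.5 := (Real.sqrt_lt' (by norm_num)).2 (by norm_num)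
    refine mul_le_mul_of_nonneg_left ?_ hq0.le
    rw [div_le_div_iff₀ (by norm_num) (by positivity)]
    have h1 : w ^ 2 + w ≤ √2 * (w ^ 2 + 1 / 2) := by
      nlinarith [sq_nonneg (w - 1.2),
        mul_nonneg (sub_nonneg.2 hr1.le) (by positivity : (0 : ℝ) ≤ w ^ 2 + 1 / 2)]
    have h2 := mul_le_mul_of_nonneg_left h1 hr0.le
    nlinarith
  have hpow : ∀ t, 0 ≤ t → t ≤ q * (w * (w + 1) / 4) → t ^ 4 ≤ speedConst p s * y ^ 2 := by
    intro t ht0 ht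
    have hr4 : √2 ^ 4 = 4 := by
      rw [show √2 ^ 4 = (√2 ^ 2) ^ 2 by ring, Real.sq_sqrt (by norm_num)]
      norm_num
    have hyY : y ≤ √(s / p.q2) := by
      refine Real.le_sqrt_of_sq_le ?_
      rw [le_div_iff₀ p.q2_pos]
      linarith
    calc t ^ 4 ≤ (q * ((y + 3 / 2) / (2 * √2))) ^ 4 := by
          gcongr
          exact ht.trans hbound
      _ = (y + 3 / 2) ^ 4 / 64 * y ^ 2 := by
          rw [mul_pow, div_pow, mul_pow, hr4, ← hqq]
          ring
      _ ≤ _ := by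
          unfold speedConst
          gcongr
  refine ⟨a, w * (w + 1) / 4, q * (w + 1) / 4, hy, hyb, ha0,
    (Real.arctan_lt_pi_div_two q).le, h1, by positivity, hspeed ▸ h2, ?_, ?_, ?_, ?_, ?_, ?_⟩
  · rw [hsin]
    field_simp
  · rw [hcos, show y = w ^ 2 - 1 by linarith]
    field_simp
    ring
  · rw [← hX]
    exact h3
  · refine hpow _ (by positivity) ?_
    have : q * (w + 1) ≤ w * (q * (w + 1)) := le_mul_of_one_le_left (by positivity) hw1.le
    linarith
  · refine hpow _ (by positivity) ?_
    rw [mul_comm q]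
    gcongr
  · rw [← hqq, ← pow_mul]
    gcongr

/-- A bound of the stage costs on an arc, relative to `y ^ 2`. -/
def arcCoeff (p : Params) (s cx cy cθ : ℝ) : ℝ :=
  p.q1 * cx ^ 4 * speedConst p s + p.q2 * cy ^ 2 + p.q3 * cθ ^ 4 + p.r1 * speedConst p s + p.r2

theorem CurveData.cost_le {p : Params} {s y a R X : ℝ} (h : CurveData p s y a R X)
    {cx cy cθ x' y' θ' V ω : ℝ} (hx : |x'| ≤ cx * X) (hy : |y'| ≤ cy * y) (hθ : |θ'| ≤ cθ * a)
    (hV : |V| = R * a) (hω : |ω| = a) :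
    p.q1 * x' ^ 4 + p.q2 * y' ^ 2 + p.q3 * θ' ^ 4 + p.r1 * V ^ 4 + p.r2 * ω ^ 4 ≤
      arcCoeff p s cx cy cθ * y ^ 2 := by
  have := p.q1_pos; have := p.q2_pos; have := p.q3_pos; have := p.r1_pos; have := p.r2_pos
  have e4 : Even 4 := by decide
  have h1 : x' ^ 4 ≤ cx ^ 4 * (speedConst p s * y ^ 2) := by
    rw [← e4.pow_abs]
    calc |x'| ^ 4 ≤ (cx * X) ^ 4 := by gcongr
      _ = cx ^ 4 * X ^ 4 := by ring
      _ ≤ _ := by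
        gcongr
        exact h.X_pow_le
  have h2 : y' ^ 2 ≤ cy ^ 2 * y ^ 2 := by
    rw [← sq_abs, ← mul_pow]
    gcongr
  have h3 : θ' ^ 4 ≤ cθ ^ 4 * y ^ 2 := by
    rw [← e4.pow_abs]
    calc |θ'| ^ 4 ≤ (cθ * a) ^ 4 := by gcongr
      _ = cθ ^ 4 * a ^ 4 := by ring
      _ ≤ _ := by
        gcongr
        exact h.a_pow_le
  have h4 : V ^ 4 ≤ speedConst p s * y ^ 2 := by
    rw [← e4.pow_abs, hV]
    exact h.speed_pow_le
  have h5 : ω ^ 4 ≤ y ^ 2 := by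
    rw [← e4.pow_abs, hω]
    exact h.a_pow_le
  calc _ ≤ p.q1 * (cx ^ 4 * (speedConst p s * y ^ 2)) + p.q2 * (cy ^ 2 * y ^ 2)
        + p.q3 * (cθ ^ 4 * y ^ 2) + p.r1 * (speedConst p s * y ^ 2) + p.r2 * y ^ 2 := by gcongr
    _ = _ := by
      unfold arcCoeff
      ring

/-- The first step is estimated with separate constants `cx0`, `cθ0`, because the coefficients are
smaller where a phase begins with a small displacement or orientation. The bounds on `cx` and `cy`
ensure feasibility through `2 X ≤ x̄` and `y ≤ ȳ`. -/
theorem CurveData.maneuver_phase {p : Params} {s y a R X : ℝ} (h : CurveData p s y a R X)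
    {cx cy cx0 cθ0 x' y' θ' R' ω : ℝ} {b : ℕ → ℝ} (hR : |R'| = R) (hω : |ω| = a)
    (hcx : cx ≤ 2) (hcy : cy ≤ 1) (hx0 : |x'| ≤ cx0 * X) (hθ0 : |θ'| ≤ cθ0 * a)
    (hpos : ∀ t, 0 ≤ t → t ≤ 1 → |x' + R' * (Real.sin (θ' + t * ω) - Real.sin θ')| ≤ cx * X ∧
      |y' + R' * (Real.cos θ' - Real.cos (θ' + t * ω))| ≤ cy * y ∧ |θ' + t * ω| ≤ a)
    (hb0 : arcCoeff p s cx0 cy cθ0 * y ^ 2 ≤ b 0)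
    (hb : ∀ n < p.m, n ≠ 0 → arcCoeff p s cx cy 1 * y ^ 2 ≤ b n) :
    Maneuver p !₂[x', y', θ'] !₂[x' + R' * (Real.sin (θ' + ω) - Real.sin θ'),
      y' + R' * (Real.cos θ' - Real.cos (θ' + ω)), θ' + ω] p.m b := by
  have hX : 0 ≤ X := by
    rw [← h.X_eq]
    exact mul_nonneg h.R_pos.le
      (Real.sin_nonneg_of_nonneg_of_le_pi h.a_pos.le (by linarith [h.a_le, Real.pi_pos]))
  have hδ := p.δ_pos
  have hpos' : ∀ n ≤ p.m, _ := fun n hn => hpos (n * p.δ) (by positivity) (by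
    rw [← p.δ_mul_m, mul_comm p.δ]
    gcongr)
  have hV : |R' * ω| = R * a := by rw [abs_mul, hR, hω]
  refine maneuver_arc (hV.trans_le h.speed_le) (hω.trans_le h.a_le_wbar)
    (fun n hn => ⟨?_, ?_, ?_⟩) fun n hn => ?_
  · exact (hpos' n hn).1.trans (by nlinarith [h.X_le])
  · exact (hpos' n hn).2.1.trans (by nlinarith [h.y_le, h.y_pos])
  · exact (hpos' n hn).2.2.trans (by linarith [h.a_le, Real.pi_pos])
  · rcases eq_or_ne n 0 with rfl | hn0
    · refine le_trans ?_ hb0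
      have h0 := hpos 0 le_rfl zero_le_one
      simp only [zero_mul, add_zero, sub_self, mul_zero, Nat.cast_zero] at h0 ⊢
      exact h.cost_le hx0 h0.2.1 hθ0 hV hω
    · refine le_trans ?_ (hb n hn hn0)
      obtain ⟨e1, e2, e3⟩ := hpos' n hn.le
      exact h.cost_le e1 e2 (by rwa [one_mul]) hV hω

theorem CurveData.arc_bounds {p : Params} {s y a R X : ℝ} (h : CurveData p s y a R X) {t : ℝ}
    (h0 : 0 ≤ t) (h1 : t ≤ a) : 0 ≤ R * Real.sin t ∧ R * Real.sin t ≤ X ∧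
      0 ≤ R * (1 - Real.cos t) ∧ R * (1 - Real.cos t) ≤ y / 4 := by
  have ha := h.a_le
  have hπ := Real.pi_pos
  have hR := h.R_pos
  rw [← h.X_eq, ← h.Y_eq]
  refine ⟨mul_nonneg hR.le (Real.sin_nonneg_of_nonneg_of_le_pi h0 (by linarith)),
    mul_le_mul_of_nonneg_left (Real.sin_le_sin_of_le_of_le_pi_div_two (by linarith) ha h1) hR.le,
    mul_nonneg hR.le (by linarith [Real.cos_le_one t]),
    mul_le_mul_of_nonneg_left ?_ hR.le⟩
  linarith [Real.cos_le_cos_of_nonneg_of_le_pi h0 (by linarith) h1]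

/-- The coefficients of the curved maneuver. -/
def curveCoeff (p : Params) (s : ℝ) (j : ℕ) : ℝ :=
  phaseCoeff p s (j / p.m) + if j % p.m = 0 then 0 else phaseExtra p s (j / p.m)

theorem curveCoeff_eq (p : Params) (s : ℝ) {j i n : ℕ} (hj : j = i * p.m + n) (hn : n < p.m) :
    curveCoeff p s j = phaseCoeff p s i + if n = 0 then 0 else phaseExtra p s i := by
  have h1 : j / p.m = i := by
    rw [hj, mul_comm, Nat.mul_add_div p.m_pos, Nat.div_eq_of_lt hn, add_zero]
  have h2 : j % p.m = n := by
    rw [hj, Nat.mul_add_mod_self_right, Nat.mod_eq_of_lt hn]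
  rw [curveCoeff, h1, h2]

/-- Each arc lowers the `y`-coordinate by `y / 4`. Two arcs driven forwards, first to heading `-a`
and back to `0`, shift `x` by `2 X`; two arcs driven backwards, to heading `a` and back to `0`, undo
this shift. The signs of `R'` and `ω` below encode this, the speed being their product. -/
theorem CurveData.maneuver {p : Params} {s y a R X : ℝ} (h : CurveData p s y a R X) :
    Maneuver p !₂[0, y, 0] !₂[0, 0, 0] (p.m + p.m + p.m + p.m)
      fun n => curveCoeff p s n * (p.q2 * y ^ 2) := by
  have hq2 := p.q2_pos
  have ha := h.a_pos
  have hy := h.y_pos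
  have haR : |R| = R := abs_of_pos h.R_pos
  have haR' : |-R| = R := by rw [abs_neg, haR]
  have haa : |a| = a := abs_of_pos ha
  have haa' : |-a| = a := by rw [abs_neg, haa]
  have hX := h.X_eq
  have hY := h.Y_eq
  have hX0 : 0 ≤ X := by
    have := h.arc_bounds le_rfl ha.le
    linarith [this.1]
  have h0 : Maneuver p !₂[0, y, 0] !₂[X, 3 * y / 4, -a] p.m
      fun n => curveCoeff p s n * (p.q2 * y ^ 2) := by
    convert h.maneuver_phase (x' := 0) (y' := y) (θ' := 0) (R' := -R) (ω := -a) (cx := 1) (cy := 1)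
      (cx0 := 0) (cθ0 := 0) haR' haa' (by norm_num) (by norm_num) (by simp) (by simp)
      (fun t ht0 ht1 => ?_) ?_ (fun n hn hn0 => ?_) using 2
    · simp only [zero_add, Real.sin_neg, Real.cos_neg, Real.sin_zero, Real.cos_zero]
      congr 2
      · linarith
      · linarith
    · have := h.arc_bounds (t := t * a) (by positivity) (by nlinarith)
      simp only [zero_add, mul_neg, Real.sin_neg, Real.cos_neg, Real.sin_zero, Real.cos_zero,
        abs_le]
      refine ⟨⟨?_, ?_⟩, ⟨?_, ?_⟩, ?_, ?_⟩ <;> nlinarith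
    · rw [curveCoeff_eq p s (i := 0) (n := 0) (by ring) p.m_pos]
      refine le_of_eq ?_
      simp only [arcCoeff, phaseCoeff, if_true]
      field_simp
      ring
    · rw [curveCoeff_eq p s (i := 0) (n := n) (by ring) hn, if_neg hn0]
      refine le_of_eq ?_
      simp only [arcCoeff, phaseCoeff, phaseExtra]
      field_simp
      ring
  have h1 : Maneuver p !₂[X, 3 * y / 4, -a] !₂[2 * X, y / 2, 0] p.m
      fun n => curveCoeff p s (p.m + n) * (p.q2 * y ^ 2) := by
    convert h.maneuver_phase (x' := X) (y' := 3 * y / 4) (θ' := -a) (R' := R) (ω := a) (cx := 2)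
      (cy := 3 / 4) (cx0 := 1) (cθ0 := 1) haR haa (by norm_num) (by norm_num)
      (by rw [abs_of_nonneg hX0, one_mul]) (by rw [haa', one_mul])
      (fun t ht0 ht1 => ?_) ?_ (fun n hn hn0 => ?_) using 2
    · simp only [neg_add_cancel, Real.sin_neg, Real.cos_neg, Real.sin_zero, Real.cos_zero]
      congr 2
      · linarith
      · linarith
    · have := h.arc_bounds (t := a - t * a) (by nlinarith) (by nlinarith)
      rw [show -a + t * a = -(a - t * a) by ring]
      simp only [Real.sin_neg, Real.cos_neg, abs_le]
      refine ⟨⟨?_, ?_⟩, ⟨?_, ?_⟩, ?_, ?_⟩ <;> nlinarith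
    · rw [curveCoeff_eq p s (i := 1) (n := 0) (by ring) p.m_pos]
      refine le_of_eq ?_
      simp only [arcCoeff, phaseCoeff, if_true]
      field_simp
      ring
    · rw [curveCoeff_eq p s (i := 1) (n := n) (by ring) hn, if_neg hn0]
      refine le_of_eq ?_
      simp only [arcCoeff, phaseCoeff, phaseExtra]
      field_simp
      ring
  have h2 : Maneuver p !₂[2 * X, y / 2, 0] !₂[X, y / 4, a] p.m
      fun n => curveCoeff p s (p.m + p.m + n) * (p.q2 * y ^ 2) := by
    convert h.maneuver_phase (x' := 2 * X) (y' := y / 2) (θ' := 0) (R' := -R) (ω := a) (cx := 2)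
      (cy := 1 / 2) (cx0 := 2) (cθ0 := 0) haR' haa (by norm_num) (by norm_num)
      (by rw [abs_of_nonneg (by linarith)]) (by simp)
      (fun t ht0 ht1 => ?_) ?_ (fun n hn hn0 => ?_) using 2
    · simp only [zero_add, Real.sin_zero, Real.cos_zero]
      congr 2
      · linarith
      · linarith
    · have := h.arc_bounds (t := t * a) (by positivity) (by nlinarith)
      simp only [zero_add, Real.sin_zero, Real.cos_zero, abs_le]
      refine ⟨⟨?_, ?_⟩, ⟨?_, ?_⟩, ?_, ?_⟩ <;> nlinarith
    · rw [curveCoeff_eq p s (i := 2) (n := 0) (by ring) p.m_pos]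
      refine le_of_eq ?_
      simp only [arcCoeff, phaseCoeff, if_true]
      field_simp
      ring
    · rw [curveCoeff_eq p s (i := 2) (n := n) (by ring) hn, if_neg hn0]
      refine le_of_eq ?_
      simp only [arcCoeff, phaseCoeff, phaseExtra]
      field_simp
      ring
  have h3 : Maneuver p !₂[X, y / 4, a] !₂[0, 0, 0] p.m
      fun n => curveCoeff p s (p.m + p.m + p.m + n) * (p.q2 * y ^ 2) := by
    convert h.maneuver_phase (x' := X) (y' := y / 4) (θ' := a) (R' := R) (ω := -a) (cx := 1)
      (cy := 1 / 4) (cx0 := 1) (cθ0 := 1) haR haa' (by norm_num) (by norm_num)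
      (by rw [abs_of_nonneg hX0, one_mul]) (by rw [haa, one_mul])
      (fun t ht0 ht1 => ?_) ?_ (fun n hn hn0 => ?_) using 2
    · simp only [add_neg_cancel, Real.sin_zero, Real.cos_zero]
      congr 2
      · linarith
      · linarith
    · have := h.arc_bounds (t := a - t * a) (by nlinarith) (by nlinarith)
      rw [show a + t * -a = a - t * a by ring]
      simp only [abs_le]
      refine ⟨⟨?_, ?_⟩, ⟨?_, ?_⟩, ?_, ?_⟩ <;> nlinarith
    · rw [curveCoeff_eq p s (i := 3) (n := 0) (by ring) p.m_pos]
      refine le_of_eq ?_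
      simp only [arcCoeff, phaseCoeff, if_true]
      field_simp
      ring
    · rw [curveCoeff_eq p s (i := 3) (n := n) (by ring) hn, if_neg hn0]
      refine le_of_eq ?_
      simp only [arcCoeff, phaseCoeff, phaseExtra]
      field_simp
      ring
  exact ((h0.append h1).append h2).append h3

theorem curveCoeff_nonneg (p : Params) (s : ℝ) (j : ℕ) : 0 ≤ curveCoeff p s j := by
  unfold curveCoeff
  split_ifs
  · exact add_nonneg (phaseCoeff_nonneg _ _ _) le_rfl
  · exact add_nonneg (phaseCoeff_nonneg _ _ _) (phaseExtra_nonneg _ _ _)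

theorem maneuver_curve {p : Params} {s : ℝ} (hfit : CurveFits p s) {y : ℝ} (hyb : |y| ≤ p.ybar)
    (hys : p.q2 * y ^ 2 < s) : Maneuver p !₂[0, y, 0] !₂[0, 0, 0] (4 * p.m)
      fun n => curveCoeff p s n * (p.q2 * y ^ 2) := by
  have e : 4 * p.m = p.m + p.m + p.m + p.m := by ring
  rw [e]
  rcases lt_trichotomy y 0 with h | rfl | h
  · refine Maneuver.of_reflect ?_
    rw [abs_of_neg h] at hyb
    obtain ⟨a, R, X, hd⟩ := exists_curveData hfit (y := -y) (by linarith) hyb (by rwa [neg_sq])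
    convert hd.maneuver using 2
    · simp [reflect]
    · simp [reflect]
    · rw [neg_sq]
  · refine maneuver_turn (a := fun _ => 0) (by simpa using p.xbar_pos.le) hyb
      (fun _ _ => by simpa using Real.pi_pos.le)
      (fun _ _ => by simpa using mul_nonneg p.wbar_pos.le p.δ_pos.le) fun _ _ => by simp
  · obtain ⟨a, R, X, hd⟩ := exists_curveData hfit h ((le_abs_self y).trans hyb) hys
    exact hd.maneuver

/-! ### Maneuvers near the origin -/

theorem Shrinks.abs_le {k : ℕ} {a : ℕ → ℝ} {e : ℝ} (h : Shrinks k a e) {n : ℕ} (hn : n ≤ k) :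
    |a n| ≤ |a 0| := by
  rcases Nat.eq_zero_or_pos n with rfl | h0
  · exact le_rfl
  · have h1 := h.2.2 n h0 hn
    have h2 := h.1
    refine le_of_pow_le_pow_left₀ (n := 4) (by norm_num) (abs_nonneg _) ?_
    rw [Even.pow_abs (by decide), Even.pow_abs (by decide)]
    linarith

theorem Shrinks.le_pow {k : ℕ} (hk : 1 ≤ k) {a : ℕ → ℝ} {e : ℝ} (h : Shrinks k a e) :
    e ≤ a 0 ^ 4 := by
  have h1 := h.2.2 k hk le_rfl
  have : 0 ≤ a k ^ 4 := by positivity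
  linarith

theorem exists_shrinks {k : ℕ} (hk : 1 ≤ k) {θ θ' : ℝ}
    (h : (0 ≤ θ' ∧ θ' ≤ θ) ∨ (θ ≤ θ' ∧ θ' ≤ 0)) :
    ∃ e, Shrinks k (fun n => θ + (θ' - θ) * (n / k)) e := by
  rcases h with h | h
  · exact ⟨_, shrinks_linear hk h.1 h.2⟩
  · refine ⟨_, (shrinks_linear hk (neg_nonneg.2 h.2) (neg_le_neg h.1)).neg.congr fun n _ => ?_⟩
    ring

theorem abs_le_nearRadius {p : Params} {s x : ℝ} (hs : 0 < s) (hx : p.q1 * x ^ 4 ≤ s) :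
    |x| ≤ nearRadius p s := by
  refine le_of_pow_le_pow_left₀ (n := 4) (by norm_num) (nearRadius_pos hs).le ?_
  rw [Even.pow_abs (by decide)]
  rw [← nearRadius_pow hs] at hx
  exact le_of_mul_le_mul_left hx p.q1_pos

theorem coeffNear_wait (p : Params) (s : ℝ) {n : ℕ} (hn : n < turnNear p) :
    coeffNear p s n = 1 := by
  simp only [coeffNear]
  rw [if_pos hn]

theorem coeffNear_drive (p : Params) (s : ℝ) {i : ℕ} (hi : i < driveNear p s) :
    coeffNear p s (turnNear p + i) = if i = 0 then
      1 + 1 / (2 * (driveNear p s : ℝ) * ((driveNear p s : ℝ) * p.δ) ^ 3) else 1 := by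
  simp only [coeffNear]
  rw [if_neg (by omega)]
  split_ifs <;> first | rfl | omega

theorem coeffNear_curve (p : Params) {s : ℝ} (hs : 0 < s) {i : ℕ} (hi : i < 4 * p.m) :
    coeffNear p s (turnNear p + driveNear p s + i) = curveCoeff p s i := by
  have := (driveNear_spec p hs).2.2
  simp only [coeffNear]
  rw [if_neg (by omega), if_neg (by omega), if_neg (by omega), if_pos (by omega),
    Nat.add_sub_cancel_left]
  rfl

/-- After the first step at least the fraction `1 / l` of the `x`-cost has disappeared, and this
exceeds the cost of the speed. Only the first step needs an extra coefficient. -/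
theorem drive_near_cost_le {p : Params} (hr1 : p.r1 ≤ p.q1 * p.δ / 2) {l : ℕ} (hl : 1 ≤ l)
    (hlδ : 1 ≤ l * p.δ) (x : ℝ) {i : ℕ} (hi : i < l) :
    p.q1 * (((l : ℝ) - i) / l * x) ^ 4 + p.r1 * (x / (l * p.δ)) ^ 4 ≤
      (if i = 0 then 1 + 1 / (2 * (l : ℝ) * ((l : ℝ) * p.δ) ^ 3) else 1) * (p.q1 * x ^ 4) := by
  have hδ := p.δ_pos
  have hq1 := p.q1_pos
  have hl0 : (0 : ℝ) < l := Nat.cast_pos.2 hl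
  have h1 : p.r1 * (x / (l * p.δ)) ^ 4 ≤
      1 / (2 * (l : ℝ) * ((l : ℝ) * p.δ) ^ 3) * (p.q1 * x ^ 4) := by
    have : 0 ≤ (x / (l * p.δ)) ^ 4 := by positivity
    calc _ ≤ p.q1 * p.δ / 2 * (x / (l * p.δ)) ^ 4 := by gcongr
      _ = _ := by field_simp
  split_ifs with h
  · subst h
    simp only [Nat.cast_zero, sub_zero, div_self hl0.ne', one_mul]
    linarith
  · have hi1 : (1 : ℝ) ≤ i := Nat.one_le_cast.2 (Nat.one_le_iff_ne_zero.2 h)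
    have hil : (i : ℝ) ≤ l := Nat.cast_le.2 hi.le
    have ht0 : 0 ≤ ((l : ℝ) - i) / l := div_nonneg (by linarith) hl0.le
    have ht1 : ((l : ℝ) - i) / l ≤ 1 - 1 / l := by
      rw [sub_div, div_self hl0.ne']
      gcongr
    have hl1 : 0 < 1 / (l : ℝ) := by positivity
    have ht4 : (((l : ℝ) - i) / l) ^ 4 ≤ 1 - 1 / l :=
      (pow_le_of_le_one ht0 (by linarith) (by norm_num)).trans ht1
    have h2 : 1 / (2 * (l : ℝ) * ((l : ℝ) * p.δ) ^ 3) ≤ 1 / l := by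
      have h3 : 1 ≤ ((l : ℝ) * p.δ) ^ 3 := one_le_pow₀ hlδ
      gcongr
      nlinarith
    have hx : 0 ≤ p.q1 * x ^ 4 := by positivity
    calc _ ≤ (((l : ℝ) - i) / l) ^ 4 * (p.q1 * x ^ 4)
        + 1 / (2 * (l : ℝ) * ((l : ℝ) * p.δ) ^ 3) * (p.q1 * x ^ 4) := by
          rw [mul_pow]
          linarith
      _ ≤ (1 - 1 / l) * (p.q1 * x ^ 4) + 1 / l * (p.q1 * x ^ 4) := by gcongr
      _ = _ := by ring

theorem maneuver_near {p : Params} {Θ : Set ℝ} {s : ℝ} (hs : 0 < s)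
    (hr2 : p.r2 ≤ p.q3 * p.δ / 2) (hr1 : p.r1 ≤ p.q1 * p.δ / 2) (hfit : CurveFits p s)
    {z : State} (hz : z ∈ nearSet p Θ s) (hθ : |z 2| ≤ Real.pi) :
    ∃ E, (z 2 = 0 → E = 0) ∧ Maneuver p z !₂[0, 0, 0] (lengthNear p s)
      fun n => coeffNear p s n * restCost p z + excess E n := by
  obtain ⟨hkπ, hkδ, hk1⟩ := turnNear_spec p
  obtain ⟨hlr, hlδ, hl1⟩ := driveNear_spec p hs
  have hδ := p.δ_pos
  have hq1 := p.q1_pos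
  have hq2 := p.q2_pos
  have hq3 := p.q3_pos
  have hk0 : (0 : ℝ) < turnNear p := Nat.cast_pos.2 hk1
  have hl0 : (0 : ℝ) < driveNear p s := Nat.cast_pos.2 hl1
  obtain ⟨e, he⟩ := exists_shrinks hk1 (θ := z 2) (θ' := 0)
    ((le_total 0 (z 2)).imp (fun h => ⟨le_rfl, h⟩) fun h => ⟨h, le_rfl⟩)
  set a : ℕ → ℝ := fun n => z 2 + (0 - z 2) * (n / turnNear p) with ha
  have ha0 : a 0 = z 2 := by simp [ha]
  have hak : a (turnNear p) = 0 := by simp [ha, div_self hk0.ne']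
  have he4 : e ≤ z 2 ^ 4 := ha0 ▸ he.le_pow hk1
  have hE0 : 0 ≤ p.q3 * e / 2 := by
    have := he.1
    positivity
  -- If the turn takes a single step, the negative excess falls on the first driving step. It is
  -- absorbed there by the orientation term of `ℓ*`, which is unused at heading zero.
  have hEB : p.q3 * e / 2 ≤ p.q3 * z 2 ^ 4 := by nlinarith [he.1]
  have hA : 0 ≤ p.q1 * z 0 ^ 4 := by positivity
  have hA2 : 0 ≤ p.q2 * z 1 ^ 2 := by positivity
  have hB : 0 ≤ p.q3 * z 2 ^ 4 := by positivity
  have hnear : p.q1 * z 0 ^ 4 + p.q2 * z 1 ^ 2 < s := hz.2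
  refine ⟨p.q3 * e / 2, fun h => ?_, ?_⟩
  · rw [h] at he4
    have : e = 0 := le_antisymm (by simpa using he4) he.1
    simp [this]
  have h1 : Maneuver p z !₂[z 0, z 1, 0] (turnNear p)
      fun n => coeffNear p s n * restCost p z + excess (p.q3 * e / 2) n := by
    have := maneuver_turn (p := p) (x := z 0) (y := z 1) (a := a) (L := turnNear p)
      (b := fun n => coeffNear p s n * restCost p z + excess (p.q3 * e / 2) n) hz.1.1 hz.1.2.1
      (fun n hn => (he.abs_le hn).trans (ha0 ▸ hθ)) (fun n hn => ?_) (fun n hn => ?_)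
    · rwa [ha0, hak, ← eq_vec] at this
    · have e1 : a (n + 1) - a n = -z 2 / turnNear p := by
        simp only [ha]
        push_cast
        ring
      rw [e1, abs_div, abs_neg, abs_of_pos hk0, div_le_iff₀ hk0]
      calc |z 2| ≤ turnNear p * (min p.wbar Real.pi * p.δ) := hθ.trans hkπ
        _ ≤ turnNear p * (p.wbar * p.δ) := by
          gcongr
          exact min_le_left _ _
        _ = _ := by ring
    · have := he.turn_cost_le hr2 hkδ hn
      rw [ha0] at this
      rw [coeffNear_wait p s hn, one_mul, restCost]
      linarith
  have h2 : Maneuver p !₂[z 0, z 1, 0] !₂[0, z 1, 0] (driveNear p s)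
      fun n => coeffNear p s (turnNear p + n) * restCost p z
        + excess (p.q3 * e / 2) (turnNear p + n) := by
    have := maneuver_drive (p := p) (x := 0) (y := z 1) (r := z 0) (ψ := 0) (l := driveNear p s)
      (b := fun n => coeffNear p s (turnNear p + n) * restCost p z
        + excess (p.q3 * e / 2) (turnNear p + n)) hl1 (by simpa using p.xbar_pos.le)
      hz.1.2.1 (by simpa using hz.1.1) (by simpa using hz.1.2.1) (by simpa using Real.pi_pos.le)
      ?_ (fun n hn => ?_)
    · simpa using this
    · calc |z 0| ≤ driveNear p s * (min p.vbar (nearRadius p s) * p.δ) :=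
            (abs_le_nearRadius hs (by linarith)).trans hlr
        _ ≤ _ := by
          gcongr
          exact min_le_left _ _
    · have e1 := drive_near_cost_le hr1 hl1 hlδ (z 0) hn
      have e2 := neg_le_excess hE0 (turnNear p + n)
      have e3 : 1 ≤ coeffNear p s (turnNear p + n) := by
        rw [coeffNear_drive p s hn]
        split_ifs
        · have : 0 ≤ 1 / (2 * (driveNear p s : ℝ) * ((driveNear p s : ℝ) * p.δ) ^ 3) := by
            positivity
          linarith
        · exact le_rfl
      rw [← coeffNear_drive p s hn] at e1
      simp only [Real.cos_zero, Real.sin_zero, mul_one, mul_zero, add_zero, zero_add, restCost]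
      nlinarith
  have h3 : Maneuver p !₂[0, z 1, 0] !₂[0, 0, 0] (4 * p.m)
      fun n => coeffNear p s (turnNear p + driveNear p s + n) * restCost p z
        + excess (p.q3 * e / 2) (turnNear p + driveNear p s + n) := by
    refine (maneuver_curve hfit hz.1.2.1 (by linarith)).mono fun n hn => ?_
    rw [coeffNear_curve p hs hn, excess, if_neg (by omega), if_neg (by omega), add_zero]
    refine mul_le_mul_of_nonneg_left ?_ (curveCoeff_nonneg p s n)
    unfold restCost
    linarith
  exact (h1.append h2).append h3

/-! ### Plans for the orientation -/

/-- A turn to the angle `φ` in `2k` steps: the first `k` steps shrink the angle, and afterwards the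
angle is bounded by its value after `k` steps or by the `i`-th step of a turn by 90 degrees. -/
def TurnPlan (k : ℕ) (θ φ : ℝ) (a : ℕ → ℝ) (e : ℝ) : Prop :=
  Shrinks k a e ∧ a 0 = θ ∧ a (2 * k) = φ ∧
    (∀ n < 2 * k, |a (n + 1) - a n| ≤ Real.pi / 2 / k) ∧
    ∀ i ≤ k, |a (k + i)| ≤ max |a k| (Real.pi / 2 * i / k)

theorem TurnPlan.neg {k : ℕ} {θ φ : ℝ} {a : ℕ → ℝ} {e : ℝ} (h : TurnPlan k θ φ a e) :
    TurnPlan k (-θ) (-φ) (fun n => -a n) e := by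
  obtain ⟨h1, h2, h3, h4, h5⟩ := h
  refine ⟨h1.neg, congrArg Neg.neg h2, congrArg Neg.neg h3, fun n hn => ?_, fun i hi => ?_⟩
  · rw [show -a (n + 1) - -a n = -(a (n + 1) - a n) by ring, abs_neg]
    exact h4 n hn
  · rw [abs_neg, abs_neg]
    exact h5 i hi

/-- Linear turns from `θ` to `θ'` and on to `φ`. If `θ' ≤ 0`, the second turn stays between `θ'` and
the reference turn `φ i / k`; if `φ ≤ θ'`, it decreases and is bounded by `θ'`. -/
theorem turnPlan_via {k : ℕ} (hk : 1 ≤ k) {θ θ' φ : ℝ}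
    (h : (0 ≤ θ' ∧ θ' ≤ θ) ∨ (θ ≤ θ' ∧ θ' ≤ 0)) (h' : θ' ≤ 0 ∨ φ ≤ θ') (hφ0 : 0 ≤ φ)
    (hφ : φ ≤ Real.pi / 2) (h1 : |θ - θ'| ≤ Real.pi / 2) (h2 : |φ - θ'| ≤ Real.pi / 2) :
    ∃ a e, TurnPlan k θ φ a e := by
  have hk0 : (0 : ℝ) < k := Nat.cast_pos.2 hk
  obtain ⟨e, he⟩ := exists_shrinks hk h
  set a : ℕ → ℝ := fun n =>
    if n ≤ k then θ + (θ' - θ) * (n / k) else θ' + (φ - θ') * (((n : ℝ) - k) / k) with ha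
  have ha1 : ∀ n ≤ k, a n = θ + (θ' - θ) * (n / k) := fun n hn => by simp [ha, hn]
  have ha2 : ∀ i, a (k + i) = θ' + (φ - θ') * (i / k) := fun i => by
    rcases Nat.eq_zero_or_pos i with rfl | hi
    · simp [ha, div_self hk0.ne']
    · simp [ha, hi.ne']
  have hak : a k = θ' := by simpa using ha2 0
  refine ⟨a, e, he.congr fun n hn => (ha1 n hn).symm, by simp [ha], ?_, fun n hn => ?_,
    fun i hi => ?_⟩
  · rw [two_mul, ha2, div_self hk0.ne']
    ring
  · rcases lt_or_ge n k with hnk | hnk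
    · rw [ha1 n hnk.le, ha1 (n + 1) hnk]
      push_cast
      rw [show θ + (θ' - θ) * ((n + 1) / k) - (θ + (θ' - θ) * (n / k)) = (θ' - θ) / k by ring,
        abs_div, abs_of_pos hk0, abs_sub_comm]
      gcongr
    · obtain ⟨i, rfl⟩ := Nat.exists_eq_add_of_le hnk
      rw [add_assoc, ha2, ha2]
      push_cast
      rw [show θ' + (φ - θ') * ((i + 1) / k) - (θ' + (φ - θ') * (i / k)) = (φ - θ') / k by ring,
        abs_div, abs_of_pos hk0]
      gcongr
  · rw [ha2, hak, mul_div_assoc]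
    have hik : (i : ℝ) ≤ k := Nat.cast_le.2 hi
    set t : ℝ := i / k with ht
    have ht0 : 0 ≤ t := by positivity
    have ht1 : t ≤ 1 := (div_le_one hk0).2 hik
    rcases h' with h' | h'
    · rw [abs_of_nonpos h', abs_le]
      constructor
      · have := le_max_left (-θ') (Real.pi / 2 * t)
        nlinarith
      · refine le_trans ?_ (le_max_right _ _)
        nlinarith
    · refine le_trans ?_ (le_max_left _ _)
      rw [abs_of_nonneg (hφ0.trans h'), abs_le]
      constructor <;> nlinarith

/-- Here the orientation must grow, so nothing can be saved by shrinking: it stays at `θ` until the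
reference turn `φ i / k` overtakes it, whence the maximum. -/
theorem turnPlan_wait {k : ℕ} (hk : 1 ≤ k) {θ φ : ℝ} (hθ : 0 ≤ θ) (hφ : θ ≤ φ)
    (hφ' : φ ≤ Real.pi / 2) : ∃ a e, TurnPlan k θ φ a e := by
  have hk0 : (0 : ℝ) < k := Nat.cast_pos.2 hk
  have hφ0 : 0 ≤ φ := hθ.trans hφ
  set a : ℕ → ℝ := fun n => max θ (φ * (((n : ℝ) - k) / k)) with ha
  have ha1 : ∀ n ≤ k, θ = a n := fun n hn => by
    have : (n : ℝ) ≤ k := Nat.cast_le.2 hn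
    have : ((n : ℝ) - k) / k ≤ 0 := div_nonpos_of_nonpos_of_nonneg (by linarith) hk0.le
    exact (max_eq_left (by nlinarith)).symm
  have ha2 : ∀ i, a (k + i) = max θ (φ * (i / k)) := fun i => by simp [ha]
  refine ⟨a, 0, (shrinks_const k θ).congr ha1, (ha1 0 (Nat.zero_le k)).symm, ?_, fun n _ => ?_,
    fun i _ => ?_⟩
  · rw [two_mul, ha2, div_self hk0.ne', mul_one, max_eq_right hφ]
  · simp only [ha, max_comm θ]
    refine (abs_max_sub_max_le_abs _ _ _).trans ?_
    push_cast
    rw [show φ * ((n + 1 - k) / k) - φ * ((n - k) / k) = φ / k by ring, abs_div, abs_of_pos hk0,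
      abs_of_nonneg hφ0]
    gcongr
  · rw [ha2, ← ha1 k le_rfl, abs_of_nonneg hθ, abs_of_nonneg (hθ.trans (le_max_left _ _)),
      mul_div_assoc]
    gcongr

/-- By reflection `φ ≥ 0`. The intermediate angle goes as far towards `φ` (for `θ > φ`) or towards
`0` (for `θ < 0`) as 90 degrees permit. The second turn then also needs at most 90 degrees; for `θ <
0` this is where `|θ| + |φ| ≤ π` enters. -/
theorem exists_turnPlan {k : ℕ} (hk : 1 ≤ k) {θ φ : ℝ} (hθ : |θ| ≤ Real.pi)
    (hφ : |φ| ≤ Real.pi / 2) (h : 0 ≤ φ * θ ∨ |θ| + |φ| ≤ Real.pi) :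
    ∃ a e, TurnPlan k θ φ a e := by
  wlog hφ0 : 0 ≤ φ generalizing θ φ
  · obtain ⟨a, e, ha⟩ := this (θ := -θ) (φ := -φ) (by rwa [abs_neg]) (by rwa [abs_neg])
      (by rwa [neg_mul_neg, abs_neg, abs_neg]) (by linarith)
    have := ha.neg
    rw [neg_neg, neg_neg] at this
    exact ⟨_, _, this⟩
  have hπ := Real.pi_pos
  rw [abs_of_nonneg hφ0] at hφ h
  rcases le_or_gt 0 θ with hθ0 | hθ0
  · rw [abs_of_nonneg hθ0] at hθ
    rcases le_or_gt θ φ with h1 | h1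
    · exact turnPlan_wait hk hθ0 h1 hφ
    · have e1 := le_max_left φ (θ - Real.pi / 2)
      have e2 := le_max_right φ (θ - Real.pi / 2)
      have e3 : max φ (θ - Real.pi / 2) ≤ θ := max_le h1.le (by linarith)
      have e4 : max φ (θ - Real.pi / 2) ≤ φ + Real.pi / 2 := max_le (by linarith) (by linarith)
      exact turnPlan_via hk (Or.inl ⟨hφ0.trans e1, e3⟩) (Or.inr e1) hφ0 hφ
        (abs_le.2 ⟨by linarith, by linarith⟩) (abs_le.2 ⟨by linarith, by linarith⟩)
  · rw [abs_of_neg hθ0] at hθ h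
    have h' : -θ + φ ≤ Real.pi := by
      rcases h with h | h
      · nlinarith
      · exact h
    have e1 := min_le_left 0 (θ + Real.pi / 2)
    have e2 := min_le_right 0 (θ + Real.pi / 2)
    have e3 : θ ≤ min 0 (θ + Real.pi / 2) := le_min hθ0.le (by linarith)
    have e4 : φ - Real.pi / 2 ≤ min 0 (θ + Real.pi / 2) := le_min (by linarith) (by linarith)
    exact turnPlan_via hk (Or.inr ⟨e3, e1⟩) (Or.inl e1) hφ0 hφ
      (abs_le.2 ⟨by linarith, by linarith⟩) (abs_le.2 ⟨by linarith, by linarith⟩)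

/-! ### Polar coordinates with heading in `[-π/2, π/2]` -/

theorem polar_arctan {x : ℝ} (hx : x ≠ 0) (y : ℝ) :
    x = x * √(1 + (y / x) ^ 2) * Real.cos (Real.arctan (y / x)) ∧
      y = x * √(1 + (y / x) ^ 2) * Real.sin (Real.arctan (y / x)) := by
  have h : 0 < √(1 + (y / x) ^ 2) := by positivity
  rw [Real.cos_arctan, Real.sin_arctan]
  constructor <;> field_simp

theorem arctan_nonpos {t : ℝ} (ht : t ≤ 0) : Real.arctan t ≤ 0 :=
  Real.arctan_zero ▸ Real.arctan_mono ht

theorem abs_arctan (t : ℝ) : |Real.arctan t| = Real.arctan |t| := by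
  rcases le_total 0 t with h | h
  · rw [abs_of_nonneg h, abs_of_nonneg (Real.arctan_nonneg.2 h)]
  · rw [abs_of_nonpos h, abs_of_nonpos (arctan_nonpos h), Real.arctan_neg]

theorem exists_polar (x y : ℝ) :
    ∃ r φ, |φ| ≤ Real.pi / 2 ∧ x = r * Real.cos φ ∧ y = r * Real.sin φ := by
  by_cases hx : x = 0
  · exact ⟨y, Real.pi / 2, by rw [abs_of_pos (by positivity)], by simp [hx], by simp⟩
  · exact ⟨_, _, abs_le.2 ⟨(Real.neg_pi_div_two_lt_arctan _).le,
      (Real.arctan_lt_pi_div_two _).le⟩, polar_arctan hx y⟩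

theorem exists_polar_of_front {x y θ : ℝ}
    (h : 0 ≤ x * y * θ ∨ |θ| + Real.arctan (|y| / |x|) ≤ Real.pi) :
    ∃ r φ, |φ| ≤ Real.pi / 2 ∧ x = r * Real.cos φ ∧ y = r * Real.sin φ ∧
      (0 ≤ φ * θ ∨ |θ| + |φ| ≤ Real.pi) := by
  have hπ : |Real.pi / 2| ≤ Real.pi / 2 := by rw [abs_of_pos (by positivity)]
  -- On the `y`-axis the product `x y θ` vanishes, so the hypothesis carries no information; but
  -- both headings `± π / 2` are available, and the one with the sign of `θ` is taken.
  by_cases hx : x = 0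
  · rcases le_total 0 θ with hθ | hθ
    · exact ⟨y, Real.pi / 2, hπ, by simp [hx], by simp, Or.inl (by positivity)⟩
    · refine ⟨-y, -(Real.pi / 2), by rwa [abs_neg], by simp [hx], by simp, Or.inl ?_⟩
      nlinarith [Real.pi_pos]
  · refine ⟨_, _, abs_le.2 ⟨(Real.neg_pi_div_two_lt_arctan _).le,
      (Real.arctan_lt_pi_div_two _).le⟩, (polar_arctan hx y).1, (polar_arctan hx y).2, ?_⟩
    refine h.imp (fun h => ?_) fun h => ?_
    · have h1 : 0 ≤ y / x * θ := by
        have : y / x * θ = x * y * θ / x ^ 2 := by field_simp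
        rw [this]
        positivity
      rcases lt_trichotomy (y / x) 0 with h2 | h2 | h2
      · exact mul_nonneg_of_nonpos_of_nonpos (arctan_nonpos h2.le)
          (nonpos_of_mul_nonneg_right h1 h2)
      · simp [h2]
      · exact mul_nonneg (Real.arctan_nonneg.2 h2.le) (nonneg_of_mul_nonneg_right h1 h2)
    · rwa [abs_arctan, abs_div]

/-! ### Maneuvers away from the origin -/

theorem far_le {p : Params} {Θ : Set ℝ} {s : ℝ} {z : State} (hz : z ∈ farSet p Θ s) :
    s ≤ p.q1 * z 0 ^ 4 + p.q2 * z 1 ^ 2 :=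
  not_lt.1 fun h => hz.2 ⟨hz.1, h⟩

/-- The coefficient of a turning step. -/
def turnTerm (p : Params) (s w : ℝ) : ℝ :=
  p.q3 * Real.pi ^ 4 / (16 * (turnFar p : ℝ) ^ 4 * s) * (w + 1 / (2 * p.δ ^ 3))

theorem coeffFarWith_wait (d : ℕ → ℝ) (p : Params) (s : ℝ) {n : ℕ} (hn : n < turnFar p) :
    coeffFarWith d p s n = 1 := by
  simp only [coeffFarWith]
  rw [if_pos hn]

theorem coeffFarWith_turn (d : ℕ → ℝ) (p : Params) (s : ℝ) {i : ℕ} (hi : i < turnFar p) :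
    coeffFarWith d p s (turnFar p + i) = 1 + turnTerm p s ((i : ℝ) ^ 4) := by
  simp only [coeffFarWith]
  rw [if_neg (by omega), if_pos (by omega), Nat.add_sub_cancel_left]
  rfl

theorem coeffFarWith_drive (d : ℕ → ℝ) (p : Params) (s : ℝ) {i : ℕ} (hi : i < driveFar p) :
    coeffFarWith d p s (2 * turnFar p + i) = d i := by
  simp only [coeffFarWith]
  rw [if_neg (by omega), if_neg (by omega), if_pos (by omega), Nat.add_sub_cancel_left]

theorem coeffFarWith_turnBack (d : ℕ → ℝ) (p : Params) (s : ℝ) {i : ℕ} (hi : i < turnFar p) :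
    coeffFarWith d p s (2 * turnFar p + driveFar p + i) =
      turnTerm p s (((turnFar p : ℝ) - i) ^ 4) := by
  simp only [coeffFarWith]
  rw [if_neg (by omega), if_neg (by omega), if_neg (by omega), if_pos (by omega),
    Nat.add_sub_cancel_left]
  rfl

/-- Comparison with a uniform turn by 90 degrees, `τ` steps away from orientation zero. Away from
the origin `ℓ* ≥ s`, which converts absolute costs into multiples of `ℓ*`. -/
theorem turn_cost_far_le {p : Params} {s C : ℝ} (hs : 0 < s) (hsC : s ≤ C)
    (hr2 : p.r2 ≤ p.q3 * p.δ / 2) {b d τ : ℝ} (hb : |b| ≤ Real.pi / 2 * τ / turnFar p)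
    (hd : |d| ≤ Real.pi / 2 / turnFar p) :
    p.q3 * b ^ 4 + p.r2 * (d / p.δ) ^ 4 ≤ turnTerm p s (τ ^ 4) * C := by
  have hk := (turnFar_spec p).2.2
  have hk0 : (0 : ℝ) < turnFar p := Nat.cast_pos.2 hk
  have hδ := p.δ_pos
  have hq3 := p.q3_pos
  have h4 : Even 4 := by decide
  have hb4 : b ^ 4 ≤ (Real.pi / 2 * τ / turnFar p) ^ 4 := by
    rw [← h4.pow_abs]
    gcongr
  have hd4 : d ^ 4 ≤ (Real.pi / 2 / turnFar p) ^ 4 := by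
    rw [← h4.pow_abs]
    gcongr
  have hτ : 0 ≤ τ ^ 4 := by positivity
  have h0 : 0 ≤ turnTerm p s (τ ^ 4) := by
    unfold turnTerm
    positivity
  calc p.q3 * b ^ 4 + p.r2 * (d / p.δ) ^ 4
      ≤ p.q3 * b ^ 4 + p.q3 * (d ^ 4 * (1 / (2 * p.δ ^ 3))) := by
        linarith [turn_input_le hr2 d]
    _ ≤ p.q3 * (Real.pi / 2 * τ / turnFar p) ^ 4
        + p.q3 * ((Real.pi / 2 / turnFar p) ^ 4 * (1 / (2 * p.δ ^ 3))) := by gcongr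
    _ = turnTerm p s (τ ^ 4) * s := by
        unfold turnTerm
        field_simp
        ring
    _ ≤ _ := by gcongr

theorem turn_speed_far {p : Params} {d : ℝ} (hd : |d| ≤ Real.pi / 2 / turnFar p) :
    |d| ≤ p.wbar * p.δ := by
  obtain ⟨h1, -, hk⟩ := turnFar_spec p
  have hk0 : (0 : ℝ) < turnFar p := Nat.cast_pos.2 hk
  have hδ := p.δ_pos
  refine hd.trans ((div_le_iff₀ hk0).2 (h1.trans ?_))
  calc _ ≤ turnFar p * (p.wbar * p.δ) := by
        gcongr
        exact min_le_left _ _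
    _ = _ := by ring

theorem abs_radius {x y r φ : ℝ} (hx : x = r * Real.cos φ) (hy : y = r * Real.sin φ) :
    |r| = √(x ^ 2 + y ^ 2) := by
  rw [← Real.sqrt_sq_eq_abs]
  congr 1
  rw [hx, hy]
  nlinarith [Real.sin_sq_add_cos_sq φ]

/-- Since the remaining fraction `t` is at most one, `t⁴ ≤ t²`, and a common factor `t²` serves both
position terms. -/
theorem maneuver_drive_far {p : Params} {x y r ψ : ℝ} {b : ℕ → ℝ} (hx : |x| ≤ p.xbar)
    (hy : |y| ≤ p.ybar) (hψ : |ψ| ≤ Real.pi) (hxr : x = r * Real.cos ψ)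
    (hyr : y = r * Real.sin ψ)
    (hb : ∀ n < driveFar p, remaining p n ^ 2 * (p.q1 * x ^ 4 + p.q2 * y ^ 2) + p.q3 * ψ ^ 4
      + p.r1 * p.vbar ^ 4 ≤ b n) :
    Maneuver p !₂[x, y, ψ] !₂[0, 0, ψ] (driveFar p) b := by
  obtain ⟨hl, hl1⟩ := driveFar_spec p
  have hl0 : (0 : ℝ) < driveFar p := Nat.cast_pos.2 hl1
  have hδ := p.δ_pos
  have hq1 := p.q1_pos
  have hr1 := p.r1_pos
  have hr : |r| ≤ driveFar p * (p.vbar * p.δ) := by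
    rw [abs_radius hxr hyr]
    refine (Real.sqrt_le_sqrt ?_).trans hl
    rw [← sq_abs x, ← sq_abs y]
    gcongr
  have hv : (r / (driveFar p * p.δ)) ^ 4 ≤ p.vbar ^ 4 := by
    rw [← Even.pow_abs (by decide : Even 4), abs_div, abs_of_pos (mul_pos hl0 hδ)]
    gcongr
    rw [div_le_iff₀ (by positivity)]
    linarith
  have := maneuver_drive (p := p) (x := 0) (y := 0) (r := r) (ψ := ψ) (l := driveFar p) (b := b)
    hl1 (by simpa using p.xbar_pos.le) (by simpa using p.ybar_pos.le) (by rwa [zero_add, ← hxr])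
    (by rwa [zero_add, ← hyr]) hψ hr fun n hn => ?_
  · rwa [zero_add, zero_add, ← hxr, ← hyr] at this
  · refine le_trans ?_ (hb n hn)
    rw [zero_add, zero_add, ← hxr, ← hyr]
    change p.q1 * (remaining p n * x) ^ 4 + p.q2 * (remaining p n * y) ^ 2 + _ + _ ≤ _
    have hn' : (n : ℝ) ≤ driveFar p := Nat.cast_le.2 hn.le
    have ht0 : 0 ≤ remaining p n := div_nonneg (by linarith) hl0.le
    have ht1 : remaining p n ≤ 1 :=
      (div_le_one hl0).2 (by linarith [(Nat.cast_nonneg n : (0 : ℝ) ≤ n)])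
    have ht : remaining p n ^ 4 ≤ remaining p n ^ 2 :=
      pow_le_pow_of_le_one ht0 ht1 (by norm_num)
    have hx4 : 0 ≤ p.q1 * x ^ 4 := by positivity
    have h1 : p.q1 * (remaining p n * x) ^ 4 ≤ remaining p n ^ 2 * (p.q1 * x ^ 4) := by
      calc _ = remaining p n ^ 4 * (p.q1 * x ^ 4) := by ring
        _ ≤ _ := by gcongr
    have h2 : p.r1 * (r / (driveFar p * p.δ)) ^ 4 ≤ p.r1 * p.vbar ^ 4 := by gcongr
    linarith

/-- During the second turn, the fourth power of the angle is at most the sum of its value after `k`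
steps, covered by the orientation term of `ℓ*`, and that of the reference turn, covered by the
turning coefficient. -/
theorem maneuver_far_front {p : Params} {Θ : Set ℝ} {s : ℝ} (hs : 0 < s)
    (hr2 : p.r2 ≤ p.q3 * p.δ / 2) {z : State} (hz : z ∈ farSet p Θ s) (hθ : |z 2| ≤ Real.pi)
    {r φ : ℝ} (hφ : |φ| ≤ Real.pi / 2) (hx : z 0 = r * Real.cos φ) (hy : z 1 = r * Real.sin φ)
    (hfront : 0 ≤ φ * z 2 ∨ |z 2| + |φ| ≤ Real.pi) :
    ∃ E, (z 2 = 0 → E = 0) ∧ Maneuver p z !₂[0, 0, 0] (lengthFar p)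
      fun n => coeffFarFront p s n * restCost p z + excess E n := by
  obtain ⟨-, hkδ, hk1⟩ := turnFar_spec p
  have hk0 : (0 : ℝ) < turnFar p := Nat.cast_pos.2 hk1
  have hl1 := (driveFar_spec p).2
  have hπ := Real.pi_pos
  have hq3 := p.q3_pos
  have hr1 := p.r1_pos
  have hfar := far_le hz
  have hB : 0 ≤ p.q3 * z 2 ^ 4 := by positivity
  have hsC : s ≤ restCost p z := by
    unfold restCost
    linarith
  have hC0 : 0 ≤ restCost p z := hs.le.trans hsC
  obtain ⟨a, e, ha, ha0, ha2, hd, hmax⟩ := exists_turnPlan hk1 hθ hφ hfront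
  have he4 : e ≤ z 2 ^ 4 := ha0 ▸ ha.le_pow hk1
  have hE0 : 0 ≤ p.q3 * e / 2 := by
    have := ha.1
    positivity
  refine ⟨p.q3 * e / 2, fun h => ?_, ?_⟩
  · rw [h] at he4
    have : e = 0 := le_antisymm (by simpa using he4) ha.1
    simp [this]
  have hexc : ∀ n, 2 ≤ n → excess (p.q3 * e / 2) n = 0 := fun n hn => by
    rw [excess, if_neg (by omega), if_neg (by omega)]
  set b : ℕ → ℝ := fun n => coeffFarFront p s n * restCost p z + excess (p.q3 * e / 2) n with hb
  have h1 : Maneuver p z !₂[z 0, z 1, φ] (2 * turnFar p) b := by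
    have := maneuver_turn (p := p) (x := z 0) (y := z 1) (a := a) (L := 2 * turnFar p) (b := b)
      hz.1.1 hz.1.2.1 (fun n hn => ?_) (fun n hn => turn_speed_far (hd n hn)) (fun n hn => ?_)
    · rwa [ha0, ha2, ← eq_vec] at this
    · rcases le_total n (turnFar p) with h | h
      · exact (ha.abs_le h).trans (ha0 ▸ hθ)
      · obtain ⟨i, rfl⟩ := Nat.exists_eq_add_of_le h
        have hi : i ≤ turnFar p := by omega
        refine (hmax i hi).trans (max_le ((ha.abs_le le_rfl).trans (ha0 ▸ hθ)) ?_)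
        have : (i : ℝ) ≤ turnFar p := Nat.cast_le.2 hi
        rw [div_le_iff₀ hk0]
        nlinarith
    · rcases lt_or_ge n (turnFar p) with h | h
      · have := ha.turn_cost_le hr2 hkδ h
        rw [ha0] at this
        simp only [hb, coeffFarFront, coeffFarWith_wait _ p s h, one_mul]
        unfold restCost
        linarith
      · obtain ⟨i, rfl⟩ := Nat.exists_eq_add_of_le h
        have hi : i < turnFar p := by omega
        have h4 : Even 4 := by decide
        have e1 : a (turnFar p + i) ^ 4 ≤
            a (turnFar p) ^ 4 + (Real.pi / 2 * i / turnFar p) ^ 4 := by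
          rw [← h4.pow_abs, ← h4.pow_abs (a (turnFar p))]
          have hp1 : 0 ≤ |a (turnFar p)| ^ 4 := by positivity
          have hp2 : 0 ≤ (Real.pi / 2 * i / turnFar p) ^ 4 := by positivity
          rcases le_max_iff.1 (hmax i hi.le) with h' | h'
          · have := pow_le_pow_left₀ (abs_nonneg _) h' 4
            linarith
          · have := pow_le_pow_left₀ (abs_nonneg _) h' 4
            linarith
        have e2 := ha.2.2 (turnFar p) hk1 le_rfl
        rw [ha0] at e2
        have e3 := turn_cost_far_le (b := Real.pi / 2 * i / turnFar p)
          (d := a (turnFar p + i + 1) - a (turnFar p + i)) (τ := i) hs hsC hr2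
          (by rw [abs_of_nonneg (by positivity)]) (hd _ hn)
        have e4 := neg_le_excess hE0 (turnFar p + i)
        have e5 := mul_le_mul_of_nonneg_left (e1.trans (add_le_add_left e2 _)) hq3.le
        have he := ha.1
        simp only [hb, coeffFarFront, coeffFarWith_turn _ p s hi]
        rw [add_mul, one_mul]
        nth_rw 1 [restCost]
        nlinarith
  have h2 : Maneuver p !₂[z 0, z 1, φ] !₂[0, 0, φ] (driveFar p)
      fun n => b (2 * turnFar p + n) := by
    refine maneuver_drive_far hz.1.1 hz.1.2.1 (hφ.trans (by linarith)) hx hy fun n hn => ?_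
    simp only [hb, coeffFarFront, coeffFarWith_drive _ p s hn,
      hexc _ (by omega : 2 ≤ 2 * turnFar p + n), add_zero, driveCoeffFront]
    have e1 : φ ^ 4 ≤ (Real.pi / 2) ^ 4 := by
      rw [← Even.pow_abs (by decide : Even 4)]
      gcongr
    have e2 : p.q3 * φ ^ 4 + p.r1 * p.vbar ^ 4 ≤
        (p.q3 * (Real.pi / 2) ^ 4 + p.r1 * p.vbar ^ 4) / s * restCost p z := by
      have hv := p.vbar_pos
      calc _ ≤ p.q3 * (Real.pi / 2) ^ 4 + p.r1 * p.vbar ^ 4 := by gcongr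
        _ = (p.q3 * (Real.pi / 2) ^ 4 + p.r1 * p.vbar ^ 4) / s * s := by field_simp
        _ ≤ _ := by gcongr
    have e3 : remaining p n ^ 2 * (p.q1 * z 0 ^ 4 + p.q2 * z 1 ^ 2) ≤
        remaining p n ^ 2 * restCost p z := by
      gcongr
      unfold restCost
      linarith
    rw [add_mul]
    linarith
  have h3 : Maneuver p !₂[0, 0, φ] !₂[0, 0, 0] (turnFar p)
      fun n => b (2 * turnFar p + driveFar p + n) := by
    have := maneuver_turn (p := p) (x := 0) (y := 0)
      (a := fun n => φ * (((turnFar p : ℝ) - n) / turnFar p))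
      (L := turnFar p) (b := fun n => b (2 * turnFar p + driveFar p + n))
      (by simpa using p.xbar_pos.le) (by simpa using p.ybar_pos.le) (fun n hn => ?_)
      (fun n hn => ?_) (fun n hn => ?_)
    · simpa [div_self hk0.ne'] using this
    · have h0 : (n : ℝ) ≤ turnFar p := Nat.cast_le.2 hn
      have h0' : (0 : ℝ) ≤ n := Nat.cast_nonneg n
      rw [abs_mul, abs_div, abs_of_pos hk0, abs_of_nonneg (a := (turnFar p : ℝ) - n) (by linarith)]
      have : ((turnFar p : ℝ) - n) / turnFar p ≤ 1 := (div_le_one hk0).2 (by linarith)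
      have h1 : 0 ≤ ((turnFar p : ℝ) - n) / turnFar p := div_nonneg (by linarith) hk0.le
      nlinarith [abs_nonneg φ]
    · have hd' : φ * (((turnFar p : ℝ) - (n + 1 : ℕ)) / turnFar p)
          - φ * (((turnFar p : ℝ) - n) / turnFar p) = -φ / turnFar p := by
        push_cast
        ring
      refine turn_speed_far ?_
      rw [hd', abs_div, abs_neg, abs_of_pos hk0]
      gcongr
    · have hd' : φ * (((turnFar p : ℝ) - (n + 1 : ℕ)) / turnFar p)
          - φ * (((turnFar p : ℝ) - n) / turnFar p) = -φ / turnFar p := by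
        push_cast
        ring
      have h0 : (n : ℝ) ≤ turnFar p := Nat.cast_le.2 hn.le
      simp only [hb, coeffFarFront, coeffFarWith_turnBack _ p s hn,
        hexc _ (by omega : 2 ≤ 2 * turnFar p + driveFar p + n), add_zero]
      rw [hd']
      have := turn_cost_far_le (b := φ * (((turnFar p : ℝ) - n) / turnFar p))
        (d := -φ / turnFar p) (τ := (turnFar p : ℝ) - n) hs hsC hr2
        (by
          rw [abs_mul, abs_div, abs_of_pos hk0, abs_of_nonneg (a := (turnFar p : ℝ) - n)
            (by linarith), mul_div_assoc]
          have : 0 ≤ ((turnFar p : ℝ) - n) / turnFar p := div_nonneg (by linarith) hk0.le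
          gcongr)
        (by
          rw [abs_div, abs_neg, abs_of_pos hk0]
          gcongr)
      simpa using this
  have h := (h1.append h2).append h3
  rwa [show 2 * turnFar p + driveFar p + turnFar p = lengthFar p by
    unfold lengthFar
    ring] at h

/-- The order in which the coefficients are used by the maneuver that turns away from the origin:
turn, drive, turn. -/
def reorder (k l n : ℕ) : ℕ :=
  if n < k then n else if n < k + l then n + k else if n < 2 * k + l then n - l else n

theorem reorder_injective (k l : ℕ) : Function.Injective (reorder k l) := by
  intro a b h
  unfold reorder at h
  split_ifs at h <;> omega

/-- Turning to `ψ` shrinks the angle and needs only `k` steps. The drive then takes place at an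
orientation of modulus possibly above `π / 2`, whose cost is already contained in `ℓ*`. The way back
to zero may use `2k` steps, so 90 degrees per `k` steps suffice again. -/
theorem maneuver_far_back {p : Params} {Θ : Set ℝ} {s : ℝ} (hs : 0 < s)
    (hr2 : p.r2 ≤ p.q3 * p.δ / 2) {z : State} (hz : z ∈ farSet p Θ s) (hθ : |z 2| ≤ Real.pi)
    {r ψ : ℝ} (hψ : (0 ≤ ψ ∧ ψ ≤ z 2) ∨ (z 2 ≤ ψ ∧ ψ ≤ 0)) (hd : |ψ - z 2| ≤ Real.pi / 2)
    (hx : z 0 = r * Real.cos ψ) (hy : z 1 = r * Real.sin ψ) :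
    ∃ E, Maneuver p z !₂[0, 0, 0] (lengthFar p)
      fun n => coeffFar p s (reorder (turnFar p) (driveFar p) n) * restCost p z + excess E n := by
  obtain ⟨-, hkδ, hk1⟩ := turnFar_spec p
  have hk0 : (0 : ℝ) < turnFar p := Nat.cast_pos.2 hk1
  have hl1 := (driveFar_spec p).2
  have hπ := Real.pi_pos
  have hq3 := p.q3_pos
  have hr1 := p.r1_pos
  have hfar := far_le hz
  have hB : 0 ≤ p.q3 * z 2 ^ 4 := by positivity
  have hsC : s ≤ restCost p z := by
    unfold restCost
    linarith
  have hC0 : 0 ≤ restCost p z := hs.le.trans hsC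
  obtain ⟨e, ha⟩ := exists_shrinks hk1 hψ
  set a : ℕ → ℝ := fun n => z 2 + (ψ - z 2) * (n / turnFar p) with haa
  have ha0 : a 0 = z 2 := by simp [haa]
  have hak : a (turnFar p) = ψ := by simp [haa, div_self hk0.ne']
  have hE0 : 0 ≤ p.q3 * e / 2 := by
    have := ha.1
    positivity
  have hψ4 : ψ ^ 4 ≤ z 2 ^ 4 - e := by
    have := ha.2.2 _ hk1 le_rfl
    rwa [hak, ha0] at this
  have hψθ : |ψ| ≤ |z 2| := by
    have := ha.abs_le le_rfl
    rwa [hak, ha0] at this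
  refine ⟨p.q3 * e / 2, ?_⟩
  have hexc : ∀ n, 2 ≤ n → excess (p.q3 * e / 2) n = 0 := fun n hn => by
    rw [excess, if_neg (by omega), if_neg (by omega)]
  set b : ℕ → ℝ := fun n =>
    coeffFar p s (reorder (turnFar p) (driveFar p) n) * restCost p z
      + excess (p.q3 * e / 2) n with hb
  have h1 : Maneuver p z !₂[z 0, z 1, ψ] (turnFar p) b := by
    have := maneuver_turn (p := p) (x := z 0) (y := z 1) (a := a) (L := turnFar p) (b := b)
      hz.1.1 hz.1.2.1 (fun n hn => (ha.abs_le hn).trans (ha0 ▸ hθ)) (fun n hn => ?_)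
      (fun n hn => ?_)
    · rwa [ha0, hak, ← eq_vec] at this
    · refine turn_speed_far ?_
      have e1 : a (n + 1) - a n = (ψ - z 2) / turnFar p := by
        simp only [haa]
        push_cast
        ring
      rw [e1, abs_div, abs_of_pos hk0]
      gcongr
    · have := ha.turn_cost_le hr2 hkδ hn
      rw [ha0] at this
      simp only [hb, reorder, if_pos hn, coeffFar, coeffFarWith_wait _ p s hn, one_mul]
      unfold restCost
      linarith
  have h2 : Maneuver p !₂[z 0, z 1, ψ] !₂[0, 0, ψ] (driveFar p) fun n => b (turnFar p + n) := by
    refine maneuver_drive_far hz.1.1 hz.1.2.1 (hψθ.trans hθ) hx hy fun n hn => ?_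
    have e0 : reorder (turnFar p) (driveFar p) (turnFar p + n) = 2 * turnFar p + n := by
      unfold reorder
      rw [if_neg (by omega), if_pos (by omega)]
      ring
    simp only [hb, e0, coeffFar, coeffFarWith_drive _ p s hn]
    have e1 := neg_le_excess hE0 (turnFar p + n)
    have e2 := mul_le_mul_of_nonneg_left hψ4 hq3.le
    have e3 : p.r1 * p.vbar ^ 4 ≤ p.r1 * p.vbar ^ 4 / s * restCost p z := by
      have hv := p.vbar_pos
      calc _ = p.r1 * p.vbar ^ 4 / s * s := by field_simp
        _ ≤ _ := by gcongr
    have hBπ : p.q3 * z 2 ^ 4 ≤ p.q3 * Real.pi ^ 4 := by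
      rw [← Even.pow_abs (by decide : Even 4)]
      gcongr
    -- The share of the orientation in `ℓ*` is at most `q₃ π⁴ / (s + q₃ π⁴)`, as the orientation
    -- costs at most `q₃ π⁴` and the position at least `s`. While driving, the position term shrinks
    -- by `t²` but the orientation term persists; the missing part `1 - t²` of the latter is paid
    -- through this share.
    have e4 : p.q3 * z 2 ^ 4 ≤ p.q3 * Real.pi ^ 4 / (s + p.q3 * Real.pi ^ 4) * restCost p z := by
      rw [div_mul_eq_mul_div, le_div_iff₀ (by positivity)]
      have hπ4 : 0 ≤ p.q3 * Real.pi ^ 4 := by positivity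
      have := mul_le_mul hBπ hfar hs.le hπ4
      unfold restCost
      linarith
    have ht1 : remaining p n ^ 2 ≤ 1 := by
      have hl0 : (0 : ℝ) < driveFar p := Nat.cast_pos.2 hl1
      have hn' : (n : ℝ) ≤ driveFar p := Nat.cast_le.2 hn.le
      exact pow_le_one₀ (div_nonneg (by linarith) hl0.le)
        ((div_le_one hl0).2 (by linarith [(Nat.cast_nonneg n : (0 : ℝ) ≤ n)]))
    have e5 := mul_le_mul_of_nonneg_left e4 (sub_nonneg.2 ht1)
    have e6 := mul_le_mul_of_nonneg_right
      (le_max_right (driveCoeffFront p s n) (remaining p n ^ 2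
        + (1 - remaining p n ^ 2) * (p.q3 * Real.pi ^ 4 / (s + p.q3 * Real.pi ^ 4))
        + p.r1 * p.vbar ^ 4 / s)) hC0
    change _ ≤ driveCoeff p s n * restCost p z at e6
    have e7 : restCost p z = p.q1 * z 0 ^ 4 + p.q2 * z 1 ^ 2 + p.q3 * z 2 ^ 4 := rfl
    have e8 : remaining p n ^ 2 * restCost p z =
        remaining p n ^ 2 * (p.q1 * z 0 ^ 4 + p.q2 * z 1 ^ 2)
          + remaining p n ^ 2 * (p.q3 * z 2 ^ 4) := by
      rw [e7]
      ring
    have he := ha.1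
    nlinarith
  have h3 : Maneuver p !₂[0, 0, ψ] !₂[0, 0, 0] (2 * turnFar p)
      fun n => b (turnFar p + driveFar p + n) := by
    have hdiff : ∀ n : ℕ, ψ * ((2 * (turnFar p : ℝ) - (n + 1 : ℕ)) / (2 * turnFar p))
          - ψ * ((2 * (turnFar p : ℝ) - n) / (2 * turnFar p)) = -ψ / (2 * turnFar p) := fun n => by
      push_cast
      ring
    have hdle : |-ψ / (2 * turnFar p)| ≤ Real.pi / 2 / turnFar p := by
      rw [abs_div, abs_neg, abs_of_pos (a := 2 * (turnFar p : ℝ)) (by positivity), div_div]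
      gcongr
      exact hψθ.trans hθ
    have hfrac : ∀ n ≤ 2 * turnFar p, 0 ≤ (2 * (turnFar p : ℝ) - n) / (2 * turnFar p) ∧
        (2 * (turnFar p : ℝ) - n) / (2 * turnFar p) ≤ 1 := fun n hn => by
      have h0 : (n : ℝ) ≤ 2 * turnFar p := by exact_mod_cast hn
      have h0' : (0 : ℝ) ≤ n := Nat.cast_nonneg n
      exact ⟨div_nonneg (by linarith) (by positivity),
        (div_le_one (by positivity)).2 (by linarith)⟩
    have habs : ∀ n ≤ 2 * turnFar p,
        |ψ * ((2 * (turnFar p : ℝ) - n) / (2 * turnFar p))| ≤ |ψ| := fun n hn => by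
      rw [abs_mul, abs_of_nonneg (hfrac n hn).1]
      exact mul_le_of_le_one_right (abs_nonneg _) (hfrac n hn).2
    have := maneuver_turn (p := p) (x := 0) (y := 0)
      (a := fun n => ψ * ((2 * (turnFar p : ℝ) - n) / (2 * turnFar p)))
      (L := 2 * turnFar p) (b := fun n => b (turnFar p + driveFar p + n))
      (by simpa using p.xbar_pos.le) (by simpa using p.ybar_pos.le)
      (fun n hn => (habs n hn).trans (hψθ.trans hθ))
      (fun n hn => turn_speed_far (by rwa [hdiff])) (fun n hn => ?_)
    · simpa [hk0.ne'] using this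
    · rw [hdiff]
      simp only [hb, hexc _ (by omega : 2 ≤ turnFar p + driveFar p + n), add_zero]
      rcases lt_or_ge n (turnFar p) with h | h
      · have e0 : reorder (turnFar p) (driveFar p) (turnFar p + driveFar p + n) =
            turnFar p + n := by
          unfold reorder
          rw [if_neg (by omega), if_neg (by omega), if_pos (by omega)]
          omega
        have e1 : (ψ * ((2 * (turnFar p : ℝ) - n) / (2 * turnFar p))) ^ 4 ≤ z 2 ^ 4 := by
          rw [← Even.pow_abs (by decide : Even 4), ← Even.pow_abs (by decide : Even 4) (z 2)]
          exact pow_le_pow_left₀ (abs_nonneg _) ((habs n hn.le).trans hψθ) 4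
        -- In this half of the turn the angle is charged to the summand `1` of the coefficient, so
        -- the turning term has to cover the angular speed only.
        have e2 := turn_cost_far_le (b := 0) (d := -ψ / (2 * turnFar p)) (τ := n) hs hsC hr2
          (by rw [abs_zero]; positivity) hdle
        have e3 := mul_le_mul_of_nonneg_left e1 hq3.le
        rw [e0, coeffFar, coeffFarWith_turn _ p s h, add_mul, one_mul]
        have e7 : restCost p z = p.q1 * z 0 ^ 4 + p.q2 * z 1 ^ 2 + p.q3 * z 2 ^ 4 := rfl
        have e8 : (0 : ℝ) ^ 4 = 0 := by norm_num
        have e9 : (0 : ℝ) ^ 2 = 0 := by norm_num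
        rw [e8, mul_zero] at e2
        rw [e8, e9, mul_zero, mul_zero]
        linarith
      · obtain ⟨i, rfl⟩ := Nat.exists_eq_add_of_le h
        have hi : i < turnFar p := by omega
        have hi' : (i : ℝ) ≤ turnFar p := Nat.cast_le.2 hi.le
        have e0 : reorder (turnFar p) (driveFar p) (turnFar p + driveFar p + (turnFar p + i)) =
            2 * turnFar p + driveFar p + i := by
          unfold reorder
          rw [if_neg (by omega), if_neg (by omega), if_neg (by omega)]
          ring
        have e2 := turn_cost_far_le
          (b := ψ * ((2 * (turnFar p : ℝ) - (turnFar p + i : ℕ)) / (2 * turnFar p)))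
          (d := -ψ / (2 * turnFar p)) (τ := (turnFar p : ℝ) - i) hs hsC hr2
          (by
            rw [abs_mul, abs_of_nonneg (hfrac _ hn.le).1]
            push_cast
            calc |ψ| * ((2 * (turnFar p : ℝ) - (turnFar p + i)) / (2 * turnFar p))
                = |ψ| / 2 * ((turnFar p : ℝ) - i) / turnFar p := by
                  field_simp
                  ring
              _ ≤ _ := by
                have : 0 ≤ (turnFar p : ℝ) - i := by linarith
                gcongr
                exact hψθ.trans hθ) hdle
        rw [e0, coeffFar, coeffFarWith_turnBack _ p s hi]
        have e8 : (0 : ℝ) ^ 4 = 0 := by norm_num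
        have e9 : (0 : ℝ) ^ 2 = 0 := by norm_num
        rw [e8, e9, mul_zero, mul_zero]
        linarith
  have h := (h1.append h2).append h3
  rwa [show turnFar p + driveFar p + 2 * turnFar p = lengthFar p by
    unfold lengthFar
    ring] at h

/-! ### Growth bounds -/

theorem exists_controls_near {p : Params} {Θ : Set ℝ} {s : ℝ} (hs : 0 < s)
    (hr2 : p.r2 ≤ p.q3 * p.δ / 2) (hr1 : p.r1 ≤ p.q1 * p.δ / 2) (hfit : CurveFits p s)
    (hΘ : Set.Icc (-Real.pi) Real.pi ⊆ Θ) {z : State} (hz : z ∈ nearSet p Θ s)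
    (hθ : |z 2| ≤ Real.pi) :
    ∃ E, (z 2 = 0 → E = 0) ∧ ∃ u : ℕ → Input, AdmissibleInf p Θ z u ∧
      ∀ n, stageCost p (traj p u z n) (u n) ≤ coeffNear p s n * restCost p z + excess E n := by
  obtain ⟨E, hE, h⟩ := maneuver_near hs hr2 hr1 hfit hz hθ
  refine ⟨E, hE, h.exists_admissibleInf (fun n hn => ?_) hΘ⟩
  have h1 := (turnNear_spec p).2.2
  have h2 := (driveNear_spec p hs).2.2
  have h3 : 2 ≤ n := by
    unfold lengthNear at hn
    omega
  rw [coeffNear_eq_zero p hs hn, excess, if_neg (by omega), if_neg (by omega)]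
  simp

theorem exists_controls_far_front {p : Params} {Θ : Set ℝ} {s : ℝ} (hs : 0 < s)
    (hr2 : p.r2 ≤ p.q3 * p.δ / 2) (hΘ : Set.Icc (-Real.pi) Real.pi ⊆ Θ) {z : State}
    (hz : z ∈ farSet p Θ s) (hθ : |z 2| ≤ Real.pi) {r φ : ℝ} (hφ : |φ| ≤ Real.pi / 2)
    (hx : z 0 = r * Real.cos φ) (hy : z 1 = r * Real.sin φ)
    (hfront : 0 ≤ φ * z 2 ∨ |z 2| + |φ| ≤ Real.pi) :
    ∃ E, (z 2 = 0 → E = 0) ∧ ∃ u : ℕ → Input, AdmissibleInf p Θ z u ∧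
      ∀ n, stageCost p (traj p u z n) (u n) ≤
        coeffFarFront p s n * restCost p z + excess E n := by
  obtain ⟨E, hE, h⟩ := maneuver_far_front hs hr2 hz hθ hφ hx hy hfront
  refine ⟨E, hE, h.exists_admissibleInf (fun n hn => ?_) hΘ⟩
  have h1 := (turnFar_spec p).2.2
  rw [coeffFarFront, coeffFarWith_eq_zero _ p s hn]
  unfold lengthFar at hn
  rw [excess, if_neg (by omega), if_neg (by omega)]
  simp

/-- The signs of `φ` and `θ` differ and `|θ| + |φ| > π`, so the opposite heading `φ ∓ π` lies
between `0` and `θ`, at distance at most `|φ| ≤ π / 2` from `θ`. Reversing the heading changes the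
sign of `r`. -/
theorem exists_controls_far_back {p : Params} {Θ : Set ℝ} {s : ℝ} (hs : 0 < s)
    (hr2 : p.r2 ≤ p.q3 * p.δ / 2) (hΘ : Set.Icc (-Real.pi) Real.pi ⊆ Θ) {z : State}
    (hz : z ∈ farSet p Θ s) (hθ : |z 2| ≤ Real.pi) {r φ : ℝ} (hφ : |φ| ≤ Real.pi / 2)
    (hx : z 0 = r * Real.cos φ) (hy : z 1 = r * Real.sin φ)
    (hback : ¬(0 ≤ φ * z 2 ∨ |z 2| + |φ| ≤ Real.pi)) :
    ∃ E, ∃ u : ℕ → Input, AdmissibleInf p Θ z u ∧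
      ∀ n, stageCost p (traj p u z n) (u n) ≤
        coeffFar p s (reorder (turnFar p) (driveFar p) n) * restCost p z + excess E n := by
  obtain ⟨hneg, hsum⟩ := not_or.1 hback
  rw [not_le] at hneg hsum
  have hψ : ∃ ψ, ((0 ≤ ψ ∧ ψ ≤ z 2) ∨ (z 2 ≤ ψ ∧ ψ ≤ 0)) ∧ |ψ - z 2| ≤ Real.pi / 2 ∧
      z 0 = -r * Real.cos ψ ∧ z 1 = -r * Real.sin ψ := by
    rcases mul_neg_iff.1 hneg with ⟨h1, h2⟩ | ⟨h1, h2⟩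
    · rw [abs_of_neg h2] at hsum hθ
      rw [abs_of_pos h1] at hsum hφ
      refine ⟨φ - Real.pi, Or.inr ⟨by linarith, by linarith⟩,
        abs_le.2 ⟨by linarith, by linarith⟩, ?_, ?_⟩
      · rw [Real.cos_sub_pi, hx]
        ring
      · rw [Real.sin_sub_pi, hy]
        ring
    · rw [abs_of_pos h2] at hsum hθ
      rw [abs_of_neg h1] at hsum hφ
      refine ⟨φ + Real.pi, Or.inl ⟨by linarith, by linarith⟩,
        abs_le.2 ⟨by linarith, by linarith⟩, ?_, ?_⟩
      · rw [Real.cos_add_pi, hx]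
        ring
      · rw [Real.sin_add_pi, hy]
        ring
  obtain ⟨ψ, hψ1, hψ2, hx', hy'⟩ := hψ
  obtain ⟨E, h⟩ := maneuver_far_back hs hr2 hz hθ hψ1 hψ2 hx' hy'
  refine ⟨E, h.exists_admissibleInf (fun n hn => ?_) hΘ⟩
  have h1 := (turnFar_spec p).2.2
  have h2 : reorder (turnFar p) (driveFar p) n = n := by
    unfold lengthFar at hn
    unfold reorder
    rw [if_neg (by omega), if_neg (by omega), if_neg (by omega)]
  rw [h2, coeffFar, coeffFarWith_eq_zero _ p s hn]
  unfold lengthFar at hn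
  rw [excess, if_neg (by omega), if_neg (by omega)]
  simp

theorem value_le_near {p : Params} {Θ : Set ℝ} {s : ℝ} (hs : 0 < s)
    (hr2 : p.r2 ≤ p.q3 * p.δ / 2) (hr1 : p.r1 ≤ p.q1 * p.δ / 2) (hfit : CurveFits p s)
    (hΘ : Set.Icc (-Real.pi) Real.pi ⊆ Θ) {z : State} (hz : z ∈ nearSet p Θ s)
    (hθ : |z 2| ≤ Real.pi) {i : ℕ} (hi : 1 ≤ i) :
    value p Θ i z ≤ ENNReal.ofReal (growthNear p s i * minStageCost p Θ z) := by
  obtain ⟨E, -, u, hu, hc⟩ := exists_controls_near hs hr2 hr1 hfit hΘ hz hθ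
  exact value_le_accumulated hz.1 (coeffNear_nonneg p s) (fun _ => coeffNear_eq_zero p hs)
    (coeffNear_zero p s) Function.injective_id rfl hu hc hi

theorem value_le_far_front {p : Params} {Θ : Set ℝ} {s : ℝ} (hs : 0 < s)
    (hr2 : p.r2 ≤ p.q3 * p.δ / 2) (hΘ : Set.Icc (-Real.pi) Real.pi ⊆ Θ) {z : State}
    (hz : z ∈ farSet p Θ s) (hθ : |z 2| ≤ Real.pi)
    (hfront : 0 ≤ z 0 * z 1 * z 2 ∨ |z 2| + Real.arctan (|z 1| / |z 0|) ≤ Real.pi)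
    {i : ℕ} (hi : 1 ≤ i) :
    value p Θ i z ≤ ENNReal.ofReal (growthFarFront p s i * minStageCost p Θ z) := by
  obtain ⟨r, φ, hφ, hx, hy, hf⟩ := exists_polar_of_front hfront
  obtain ⟨E, -, u, hu, hc⟩ := exists_controls_far_front hs hr2 hΘ hz hθ hφ hx hy hf
  exact value_le_accumulated hz.1 (coeffFarFront_nonneg p hs)
    (fun _ => coeffFarWith_eq_zero _ p s) (coeffFarWith_zero _ p s) Function.injective_id rfl
    hu hc hi

theorem value_le_far {p : Params} {Θ : Set ℝ} {s : ℝ} (hs : 0 < s)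
    (hr2 : p.r2 ≤ p.q3 * p.δ / 2) (hΘ : Set.Icc (-Real.pi) Real.pi ⊆ Θ) {z : State}
    (hz : z ∈ farSet p Θ s) (hθ : |z 2| ≤ Real.pi) {i : ℕ} (hi : 1 ≤ i) :
    value p Θ i z ≤ ENNReal.ofReal (growthFar p s i * minStageCost p Θ z) := by
  obtain ⟨r, φ, hφ, hx, hy⟩ := exists_polar (z 0) (z 1)
  by_cases hf : 0 ≤ φ * z 2 ∨ |z 2| + |φ| ≤ Real.pi
  · obtain ⟨E, -, u, hu, hc⟩ := exists_controls_far_front hs hr2 hΘ hz hθ hφ hx hy hf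
    refine value_le_accumulated hz.1 (coeffFar_nonneg p hs)
      (fun _ => coeffFarWith_eq_zero _ p s) (coeffFarWith_zero _ p s) Function.injective_id rfl
      hu (fun n => (hc n).trans (add_le_add_left ?_ _)) hi
    exact mul_le_mul_of_nonneg_right (coeffFarWith_le (driveCoeffFront_le p s) p s n)
      (restCost_nonneg p z)
  · obtain ⟨E, u, hu, hc⟩ := exists_controls_far_back hs hr2 hΘ hz hθ hφ hx hy hf
    have hk := (turnFar_spec p).2.2
    exact value_le_accumulated hz.1 (coeffFar_nonneg p hs)
      (fun _ => coeffFarWith_eq_zero _ p s) (coeffFarWith_zero _ p s)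
      (reorder_injective (turnFar p) (driveFar p)) (if_pos hk) hu hc hi

theorem growthBound_growth {p : Params} {Θ : Set ℝ} {s : ℝ} (hs : 0 < s)
    (hr2 : p.r2 ≤ p.q3 * p.δ / 2) (hr1 : p.r1 ≤ p.q1 * p.δ / 2) (hfit : CurveFits p s)
    (hΘ : Set.Icc (-Real.pi) Real.pi ⊆ Θ) : GrowthBound p Θ (growth p s) := by
  intro z hz hθ i hi
  have hm : 0 ≤ minStageCost p Θ z := by
    rw [minStageCost_eq hz]
    exact restCost_nonneg p z
  rcases min_choice (i : ℝ) (max (growthNear p s i) (growthFar p s i)) with h | h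
  · rw [growth, h]
    exact value_le_rest hz i
  · rw [growth, h]
    by_cases hn : z ∈ nearSet p Θ s
    · refine (value_le_near hs hr2 hr1 hfit hΘ hn hθ hi).trans (ENNReal.ofReal_le_ofReal ?_)
      exact mul_le_mul_of_nonneg_right (le_max_left _ _) hm
    · refine (value_le_far hs hr2 hΘ ⟨hz, hn⟩ hθ hi).trans (ENNReal.ofReal_le_ofReal ?_)
      exact mul_le_mul_of_nonneg_right (le_max_right _ _) hm

end UnicycleMPC

end

/-! ### Assembly of the main theorem -/

open UnicycleMPC in
theorem mainTheorem2 (p : Params) (s : ℝ) (hs : 0 < s)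
    (hr2 : p.r2 ≤ p.q3 * p.δ / 2) (hr1 : p.r1 ≤ p.q1 * p.δ / 2) (hfit : CurveFits p s) :
    -- the sequence of growth bounds is monotone and bounded
    (Monotone (growth p s) ∧ BddAbove (Set.range (growth p s))) ∧
    -- the orientation may be unconstrained (`Θ = ℝ`) or constrained to any set containing `[-π, π]`
    (∀ Θ : Set ℝ, Set.Icc (-Real.pi) Real.pi ⊆ Θ →
      -- lower and upper bounds of the minimal stage cost by `𝒦_∞` functions
      (∃ ηlow ηup : ℝ≥0 → ℝ≥0, IsClassKInf ηlow ∧ IsClassKInf ηup ∧ ∀ z ∈ stateSet p Θ,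
        (ηlow ‖z‖₊ : ℝ) ≤ minStageCost p Θ z ∧ minStageCost p Θ z ≤ (ηup ‖z‖₊ : ℝ)) ∧
      -- admissible manoeuvres from states with orientation zero
      (∀ z ∈ nearSet p Θ s, z 2 = 0 → ∃ u : ℕ → Input, AdmissibleInf p Θ z u ∧
        ∀ n, stageCost p (traj p u z n) (u n) ≤ coeffNear p s n * minStageCost p Θ z) ∧
      (∀ z ∈ farSet p Θ s, z 2 = 0 → ∃ u : ℕ → Input, AdmissibleInf p Θ z u ∧
        ∀ n, stageCost p (traj p u z n) (u n) ≤ coeffFarFront p s n * minStageCost p Θ z) ∧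
      -- growth bounds on both parts, for every orientation in `[-π, π]`
      (∀ z ∈ nearSet p Θ s, |z 2| ≤ Real.pi → ∀ i, 1 ≤ i →
        value p Θ i z ≤ ENNReal.ofReal (growthNear p s i * minStageCost p Θ z)) ∧
      (∀ z ∈ farSet p Θ s, |z 2| ≤ Real.pi → ∀ i, 1 ≤ i →
        value p Θ i z ≤ ENNReal.ofReal (growthFar p s i * minStageCost p Θ z)) ∧
      (∀ z ∈ farSet p Θ s, |z 2| ≤ Real.pi →
        (0 ≤ z 0 * z 1 * z 2 ∨ |z 2| + Real.arctan (|z 1| / |z 0|) ≤ Real.pi) → ∀ i, 1 ≤ i →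
        value p Θ i z ≤ ENNReal.ofReal (growthFarFront p s i * minStageCost p Θ z)) ∧
      -- growth bounds for every feasible position and every orientation in `[-π, π]`
      (∀ z ∈ stateSet p Θ, |z 2| ≤ Real.pi → ∀ i, 1 ≤ i →
        value p Θ i z ≤ ENNReal.ofReal (growth p s i * minStageCost p Θ z)) ∧
      -- optimal control sequences exist
      (IsClosed Θ → ∀ N, 1 ≤ N → ∃ μ : State → Input, IsMPCFeedback p Θ N μ)) ∧
    -- stability of the MPC closed loop for every horizon with positive performance index
    (∀ N, 2 ≤ N → 0 < perfIndex (growth p s) N →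
      -- orientations represented in `[-π, π]`: on the whole state constraint set
      (∀ μ : State → Input, IsMPCFeedback p (Set.Icc (-Real.pi) Real.pi) N μ →
        RelaxedLyapunovOn p (Set.Icc (-Real.pi) Real.pi) N (perfIndex (growth p s) N) μ
          (stateSet p (Set.Icc (-Real.pi) Real.pi)) ∧
        AsymptoticallyStableOn p μ (stateSet p (Set.Icc (-Real.pi) Real.pi))) ∧
      -- orientations in `ℝ` without constraint: on a sublevel set of the value function
      (∀ μ : State → Input, IsMPCFeedback p Set.univ N μ →
        RelaxedLyapunovOn p Set.univ N (perfIndex (growth p s) N) μ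
          {z | z ∈ stateSet p Set.univ ∧
            value p Set.univ N z ≤ ENNReal.ofReal (p.q3 * Real.pi ^ 4)} ∧
        AsymptoticallyStableOn p μ
          {z | z ∈ stateSet p Set.univ ∧
            value p Set.univ N z ≤ ENNReal.ofReal (p.q3 * Real.pi ^ 4)})) := by
  refine ⟨⟨growth_mono p hs, growth_bddAbove p hs⟩, fun Θ hΘ => ⟨exists_bounds p Θ, ?_, ?_, ?_, ?_,
    ?_, growthBound_growth hs hr2 hr1 hfit hΘ, fun h N _ => exists_isMPCFeedback p h N⟩,
    fun N hN hα => ⟨fun μ hμ => ?_, fun μ hμ => ?_⟩⟩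
  -- At orientation zero there is nothing to shrink, so `E = 0` and the pointwise bounds hold
  -- without the excess.
  · intro z hz hz0
    obtain ⟨E, hE, u, hu, hc⟩ := exists_controls_near hs hr2 hr1 hfit hΘ hz
      (by simpa [hz0] using Real.pi_pos.le)
    refine ⟨u, hu, fun n => ?_⟩
    have := hc n
    rwa [hE hz0, excess, neg_zero, ite_self, ite_self, add_zero, ← minStageCost_eq hz.1] at this
  · intro z hz hz0
    obtain ⟨r, φ, hφ, hx, hy⟩ := exists_polar (z 0) (z 1)
    obtain ⟨E, hE, u, hu, hc⟩ := exists_controls_far_front hs hr2 hΘ hz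
      (by simpa [hz0] using Real.pi_pos.le) hφ hx hy (Or.inl (by simp [hz0]))
    refine ⟨u, hu, fun n => ?_⟩
    have := hc n
    rwa [hE hz0, excess, neg_zero, ite_self, ite_self, add_zero, ← minStageCost_eq hz.1] at this
  · exact fun z hz hθ i hi => value_le_near hs hr2 hr1 hfit hΘ hz hθ hi
  · exact fun z hz hθ i hi => value_le_far hs hr2 hΘ hz hθ hi
  · exact fun z hz hθ hf i hi => value_le_far_front hs hr2 hΘ hz hθ hf hi
  · exact stable_Icc (growthBound_growth hs hr2 hr1 hfit subset_rfl)
      (fun _ hk => one_le_growth p hs hk) hN hα hμ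
  · exact stable_univ (growthBound_growth hs hr2 hr1 hfit (Set.subset_univ _))
      (fun _ hk => one_le_growth p hs hk) hN hα hμ
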